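/- **Setting.** Let $n\ge 2$ be even and $0<\epsilon\le 1$. Let $|\psi\rangle=|\phi_1\rangle_C\otimes|\phi_2\rangle_{\overline C}$ be an $n$-qubit pure state that is a product across an unknown cut $C\subset[n]$ with $|C|=n/2$. Assume that each factor $|\phi_i\rangle$ has trace distance at least $\epsilon$ from every pure $n/2$-qubit state that is a product across some nontrivial bipartition of its qubits. Put $t=2\lceil 1/\epsilon^2\rceil$, and let $z\in\mathbb Z_2^n$ act on $t$ copies of a state, arranged in $t/2$ pairs, by the operator $R(z)$ which swaps the $j$-th qubits of the two copies in every pair, for every $j$ with $z_j=1$. Let $U=\sum_z|z\rangle\langle z|\otimes R(z)$. **Adaptive Fourier-sampling algorithm.** Keep a list of linearly independent samples in $\mathbb Z_2^n$, initially empty. While fewer than $n-2$ samples are kept, let $\Sigma$ be the subspace of $\mathbb Z_2^n$ orthogonal (mod 2) to all kept samples, take $t$ fresh copies of $|\psi\rangle$, prepare $(H^{\otimes n}\otimes I)\,U\,\bigl(|\Sigma\rangle\otimes|\psi\rangle^{\otimes t}\bigr)$ with $|\Sigma\rangle=|\Sigma|^{-1/2}\sum_{z\in\Sigma}|z\rangle$,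 and measure the first register; keep the outcome if it is not in the span of the kept samples, otherwise discard it and repeat. When $n-2$ samples are kept, compute the nullspace of the matrix with these rows and, if it is $\mathrm{span}\{1^S0^{\overline S},0^S1^{\overline S}\}$ for some $S\subseteq[n]$, output $S$ or $\overline S$. Abort without success if this is not reached within $rn$ rounds of sampling, where $r$ is an absolute constant. **Theorem.** There are absolute constants $r,K$ and fixed classical programs (for a random access machine with unit-cost addition and subtraction), independent of $n$, $\epsilon$ and the state, such that the following holds for all $n,\epsilon$ as above. 1. (Success.) For every $C,\phi_1,\phi_2$ as above, with probability at least $2/3$ the algorithm outputs $C$ or $\overline C$, i.e. the hidden cut. 2. (Copies.) Every round acts coherently on $t\le K/\epsilon^2$ copies, and the algorithm uses at most $rn\cdot t\le Kn/\epsilon^2$ copies in total. 3. (Circuits.) In every round, the state to be measured is prepared exactly from $|0^n\rangle\otimes|\psi\rangle^{\otimes t}\otimes|0^a\rangle$, with the $a\le Kn/\epsilon^2$ ancillas returned to $|0^a\rangle$, by a circuit of Hadamard, CNOT and controlled-SWAP gates of depth at most $Kn^2+K\log(1/\epsilon)$. The circuit is computed from $n$, $t$ and the kept samples in time at most $K(n/\epsilon)^K$.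 4. (Classical processing.) The decision whether to keep a sample, and the computation of the final output from the kept samples, each take time at most $Kn^K$. -/

import Mathlib

open Finset

noncomputable section

namespace HiddenCut

/-! ### Qubits, states, trace distance, separability -/

/-- Bit strings indexed by `ι`, with bitwise addition modulo two. -/
abbrev Bits (ι : Type) : Type := ι → ZMod 2

/-- Amplitude vectors on qubits labelled by `ι`, in the computational basis: the space
`(ℂ²)^{⊗ι}`. -/
abbrev Amp (ι : Type) : Type := Bits ι → ℂ

/-- A pure state is a unit vector. -/
def IsState {ι : Type} [Fintype ι] [DecidableEq ι] (ψ : Amp ι) : Prop :=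
  ∑ x, ‖ψ x‖ ^ 2 = 1

/-- `|a⟩_S ⊗ |b⟩_{Sᶜ}`, with the qubits of the two factors in their original places. -/
def productState {ι : Type} [Fintype ι] [DecidableEq ι] (S : Finset ι)
    (a : Amp {i // i ∈ S}) (b : Amp {i // i ∈ Sᶜ}) : Amp ι :=
  fun x => a (fun i => x i) * b (fun i => x i)

/-- The density matrix `|ψ⟩⟨ψ|`. -/
def density {ι : Type} (ψ : Amp ι) : Matrix (Bits ι) (Bits ι) ℂ :=
  Matrix.vecMulVec ψ (star ψ)

/-- The trace norm (Schatten 1-norm): the sum of the singular values. -/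
def traceNorm {d : Type} [Fintype d] [DecidableEq d] (A : Matrix d d ℂ) : ℝ :=
  ∑ i, √((Matrix.isHermitian_conjTranspose_mul_self A).eigenvalues i)

/-- The trace distance of two density matrices. -/
def traceDist {d : Type} [Fintype d] [DecidableEq d] (ρ σ : Matrix d d ℂ) : ℝ :=
  (1 / 2) * traceNorm (ρ - σ)

/-- The state `φ` has trace distance at least `ε` from every pure state that is a product across
some nontrivial bipartition of its qubits. -/
def FarFromSeparable {ι : Type} [Fintype ι] [DecidableEq ι] (ε : ℝ) (φ : Amp ι) : Prop :=
  ∀ S : Finset ι, S.Nonempty → Sᶜ.Nonempty →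
    ∀ (a : Amp {i // i ∈ S}) (b : Amp {i // i ∈ Sᶜ}), IsState a → IsState b →
      ε ≤ traceDist (density φ) (density (productState S a b))

/-! ### Fourier sampling for the swap action of `Z_2^n` on copies arranged in `m` pairs -/

/-- Labels of `t = 2 m` copies, arranged in `m` pairs. -/
abbrev Copy (m : ℕ) : Type := Fin m × ZMod 2

/-- Labels of the qubits of `2 m` copies of an `n`-qubit state. -/
abbrev CopyQubit (n m : ℕ) : Type := Copy m × Fin n

/-- `|ψ⟩^{⊗ 2m}`. -/
def copies {n : ℕ} (m : ℕ) (ψ : Amp (Fin n)) : Amp (CopyQubit n m) :=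
  fun w => ∏ c : Copy m, ψ (fun j => w (c, j))

/-- The action of `z ∈ Z_2^n` on basis states of the copies: for every `j` with `z j = 1`, the
`j`-th qubits of the two copies in each pair are swapped. It is an involution. -/
def swapAction {n m : ℕ} (z : Bits (Fin n)) (w : Bits (CopyQubit n m)) : Bits (CopyQubit n m) :=
  fun q => w ((q.1.1, q.1.2 + z q.2), q.2)

/-- Joint amplitudes of the `n`-qubit group register and of the copies. -/
abbrev Joint (n m : ℕ) : Type := Bits (Fin n) → Bits (CopyQubit n m) → ℂ

/-- The controlled group action `∑_z |z⟩⟨z| ⊗ R(z)`. -/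
def controlledAction {n m : ℕ} (Φ : Joint n m) : Joint n m :=
  fun z w => Φ z (swapAction z w)

/-- A Hadamard gate on every qubit of the group register. -/
def hadamardGroup {n m : ℕ} (Φ : Joint n m) : Joint n m :=
  fun y w => ∑ z, ((-1 : ℂ) ^ (y ⬝ᵥ z).val / (√(2 ^ n) : ℝ)) * Φ z w

/-- The uniform superposition `|Z⟩` over a set `Z` of bit strings. -/
def uniformState {n : ℕ} (Z : Finset (Bits (Fin n))) : Amp (Fin n) :=
  fun z => if z ∈ Z then ((1 / √(#Z : ℝ) : ℝ) : ℂ) else 0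

/-- `(H^{⊗n} ⊗ I) U (|Z⟩ ⊗ |ψ⟩^{⊗2m})`. -/
def fourierState {n : ℕ} (m : ℕ) (Z : Finset (Bits (Fin n))) (ψ : Amp (Fin n)) : Joint n m :=
  hadamardGroup (controlledAction (fun z w => uniformState Z z * copies m ψ w))

/-- Born rule: the probability that measuring the group register of the Fourier-sampling state
gives `y`. -/
def sampleProb {n : ℕ} (m : ℕ) (Z : Finset (Bits (Fin n))) (ψ : Amp (Fin n))
    (y : Bits (Fin n)) : ℝ :=
  ∑ w, ‖fourierState m Z ψ y w‖ ^ 2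

/-! ### The adaptive algorithm -/

/-- The subspace of the strings orthogonal to all kept samples. -/
def orth {n : ℕ} (ys : List (Bits (Fin n))) : Finset (Bits (Fin n)) :=
  univ.filter fun z => ∀ y ∈ ys, z ⬝ᵥ y = 0

/-- The span of the kept samples. -/
def spanOf {n : ℕ} (ys : List (Bits (Fin n))) : Submodule (ZMod 2) (Bits (Fin n)) :=
  Submodule.span (ZMod 2) {y | y ∈ ys}

/-- The kept samples are linearly independent. -/
def Indep {n : ℕ} (ys : List (Bits (Fin n))) : Prop :=
  LinearIndependent (ZMod 2) (fun i : Fin ys.length => ys.get i)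

/-- The indicator string `1^S 0^{Sᶜ}`. -/
def indicator {n : ℕ} (S : Finset (Fin n)) : Bits (Fin n) :=
  fun j => if j ∈ S then 1 else 0

/-- The nullspace of the matrix with rows `ys` is spanned by the indicators of `S` and `Sᶜ`. -/
def NullspaceIsCut {n : ℕ} (ys : List (Bits (Fin n))) (S : Finset (Fin n)) : Prop :=
  (orth ys : Set (Bits (Fin n))) = Submodule.span (ZMod 2) {indicator S, indicator Sᶜ}

open Classical in
/-- The sampling loop. With kept samples `ys`, and while fewer than `n - 2` samples are kept, take
`2 m` fresh copies of `ψ`, prepare the uniform superposition over `orth ys` in the group register,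
run the Fourier-sampling circuit and measure the group register; keep the outcome if it is
outside the span of `ys` (in particular nonzero), discard it otherwise, and repeat. The loop is
cut off after `r` rounds, so that it consumes at most `r * (2 * m)` copies.
The value is the probability that the list of samples kept at the end satisfies `E`. -/
def loopProb {n : ℕ} (m : ℕ) (ψ : Amp (Fin n)) (E : List (Bits (Fin n)) → Prop) :
    ℕ → List (Bits (Fin n)) → ℝ
  | 0, ys => if E ys then 1 else 0
  | r + 1, ys =>
    if ys.length + 2 < n then
      ∑ y, sampleProb m (orth ys) ψ y *
        loopProb m ψ E r (if y ∈ spanOf ys then ys else ys ++ [y])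
    else if E ys then 1 else 0

/-! ### Quantum circuits -/

/-- Elementary gates on wires labelled by `W`: Hadamard, controlled-NOT (control first) and
controlled-SWAP (control first). -/
inductive Gate (W : Type) : Type where
  | had (q : W) : Gate W
  | cnot (c q : W) (h : c ≠ q) : Gate W
  | cswap (c p q : W) (hcp : c ≠ p) (hcq : c ≠ q) (hpq : p ≠ q) : Gate W

/-- The wires a gate acts on. -/
def Gate.wires {W : Type} [DecidableEq W] : Gate W → Finset W
  | .had q => {q}
  | .cnot c q _ => {c, q}
  | .cswap c p q _ _ _ => {c, p, q}

/-- The unitary of a gate. -/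
def Gate.apply {W : Type} [DecidableEq W] : Gate W → Amp W → Amp W
  | .had q, v => fun x =>
      ∑ b : ZMod 2, ((-1 : ℂ) ^ (x q * b).val / (√2 : ℝ)) * v (Function.update x q b)
  | .cnot c q _, v => fun x => v (Function.update x q (x q + x c))
  | .cswap c p q _ _ _, v => fun x => v (if x c = 1 then fun w => x (Equiv.swap p q w) else x)

/-- A circuit is a list of gates, the first gate being applied first. -/
abbrev Circuit (W : Type) : Type := List (Gate W)

/-- The unitary of a circuit. -/
def Circuit.run {W : Type} [DecidableEq W] (c : Circuit W) (v : Amp W) : Amp W :=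
  c.foldl (fun u g => g.apply u) v

/-- For every wire, the length of the longest chain of successive gates that ends on this wire. -/
def Circuit.wireDepth {W : Type} [DecidableEq W] (c : Circuit W) : W → ℕ :=
  c.foldl (fun d g w => if w ∈ g.wires then g.wires.sup d + 1 else d w) (fun _ => 0)

/-- The depth of a circuit. -/
def Circuit.depth {W : Type} [Fintype W] [DecidableEq W] (c : Circuit W) : ℕ :=
  univ.sup (Circuit.wireDepth c)

/-- The wires of one run: the group register, the copies, and `a` further ancillary qubits. -/
abbrev Wire (n m a : ℕ) : Type := Fin n ⊕ (CopyQubit n m ⊕ Fin a)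

/-- The state `Φ ⊗ |0^a⟩`. -/
def withAncillas {n m : ℕ} (a : ℕ) (Φ : Joint n m) : Amp (Wire n m a) :=
  fun x => if ∀ k : Fin a, x (.inr (.inr k)) = 0
    then Φ (fun j => x (.inl j)) (fun q => x (.inr (.inl q))) else 0

/-- The circuit maps `|0^n⟩ ⊗ |ψ⟩^{⊗2m} ⊗ |0^a⟩` to the Fourier-sampling state of `Z`, and returns
the ancillas to zero. -/
def PreparesFourierState {n m a : ℕ} (c : Circuit (Wire n m a)) (Z : Finset (Bits (Fin n))) :
    Prop :=
  ∀ ψ : Amp (Fin n),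
    Circuit.run c (withAncillas a (fun z w => if z = 0 then copies m ψ w else 0)) =
      withAncillas a (fourierState m Z ψ)

/-! ### Classical computation: a random access machine with a step count -/

/-- The memory: arrays with constant names, whose cells are addressed by a row and a column. Cells
hold natural numbers. -/
abbrev Mem : Type := ℕ → ℕ → ℕ → ℕ

/-- Expressions: constants, memory cells, addition, truncated subtraction. -/
inductive Expr : Type where
  | lit (k : ℕ) : Expr
  | read (arr : ℕ) (i j : Expr) : Expr
  | add (e f : Expr) : Expr
  | sub (e f : Expr) : Expr

def Expr.eval (s : Mem) : Expr → ℕ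
  | .lit k => k
  | .read arr i j => s arr (i.eval s) (j.eval s)
  | .add e f => e.eval s + f.eval s
  | .sub e f => e.eval s - f.eval s

/-- Every constant, memory access and arithmetic operation costs one step. Numbers grow by at most
one bit per addition, as there is no multiplication. -/
def Expr.cost : Expr → ℕ
  | .lit _ => 1
  | .read _ i j => i.cost + j.cost + 1
  | .add e f => e.cost + f.cost + 1
  | .sub e f => e.cost + f.cost + 1

/-- Programs. Conditions are true when they are nonzero. -/
inductive Prog : Type where
  | skip : Prog
  | write (arr : ℕ) (i j e : Expr) : Prog
  | seq (p q : Prog) : Prog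
  | cond (e : Expr) (p q : Prog) : Prog
  | loop (e : Expr) (p : Prog) : Prog

/-- `Mem.set s arr i j v` is `s` with `v` stored in the cell `(i, j)` of `arr`. -/
def Mem.set (s : Mem) (arr i j v : ℕ) : Mem :=
  fun arr' i' j' => if arr' = arr ∧ i' = i ∧ j' = j then v else s arr' i' j'

/-- `Exec p s s' T`: started in memory `s`, the program `p` halts in memory `s'` after exactly `T`
steps. -/
inductive Exec : Prog → Mem → Mem → ℕ → Prop where
  | skip (s : Mem) : Exec .skip s s 1
  | write (s : Mem) (arr : ℕ) (i j e : Expr) :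
      Exec (.write arr i j e) s (Mem.set s arr (i.eval s) (j.eval s) (e.eval s))
        (i.cost + j.cost + e.cost + 1)
  | seq {p q : Prog} {s s' s'' : Mem} {T U : ℕ} :
      Exec p s s' T → Exec q s' s'' U → Exec (.seq p q) s s'' (T + U)
  | condTrue {e : Expr} {p q : Prog} {s s' : Mem} {T : ℕ} :
      e.eval s ≠ 0 → Exec p s s' T → Exec (.cond e p q) s s' (e.cost + 1 + T)
  | condFalse {e : Expr} {p q : Prog} {s s' : Mem} {T : ℕ} :
      e.eval s = 0 → Exec q s s' T → Exec (.cond e p q) s s' (e.cost + 1 + T)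
  | loopDone {e : Expr} {p : Prog} {s : Mem} :
      e.eval s = 0 → Exec (.loop e p) s s (e.cost + 1)
  | loopStep {e : Expr} {p : Prog} {s s' s'' : Mem} {T U : ℕ} :
      e.eval s ≠ 0 → Exec p s s' T → Exec (.loop e p) s' s'' U →
        Exec (.loop e p) s s'' (e.cost + 1 + T + U)

/-- Started in memory `s`, the program halts within `time` steps in a memory satisfying `post`. -/
def HaltsWithin (p : Prog) (s : Mem) (time : ℝ) (post : Mem → Prop) : Prop :=
  ∃ (s' : Mem) (T : ℕ), Exec p s s' T ∧ (T : ℝ) ≤ time ∧ post s'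

/-! ### Input and output conventions of the classical programs -/

/-- The `j`-th bit of a string, as a number, and zero beyond its length. -/
def bitAt {n : ℕ} (y : Bits (Fin n)) (j : ℕ) : ℕ :=
  if h : j < n then (y ⟨j, h⟩).val else 0

/-- Initial memory: array `0` holds `n`, `m` and the number of strings in `ys`, the rows of array
`1` hold the strings in `ys`, row `0` of array `2` holds `y`; all other cells hold zero. -/
def inputMem {n : ℕ} (m : ℕ) (ys : List (Bits (Fin n))) (y : Bits (Fin n)) : Mem :=
  fun arr i j =>
    if arr = 0 ∧ i = 0 then [n, m, ys.length].getD j 0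
    else if arr = 1 then bitAt (ys.getD i 0) j
    else if arr = 2 ∧ i = 0 then bitAt y j
    else 0

/-- Row `0` of array `3` of the final memory holds the indicator string of `S`. -/
def WritesSet {n : ℕ} (S : Finset (Fin n)) (s : Mem) : Prop :=
  ∀ j : Fin n, s 3 0 j = if j ∈ S then 1 else 0

/-- Wires are named by a row and a column: row `0` is the group register, the next `2 m` rows are
the copies, and the row after these holds the ancillas. -/
def wireCode {n m a : ℕ} : Wire n m a → List ℕ
  | .inl j => [0, (j : ℕ)]
  | .inr (.inl ((i, b), j)) => [1 + 2 * (i : ℕ) + b.val, (j : ℕ)]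
  | .inr (.inr k) => [2 * m + 1, (k : ℕ)]

/-- A gate is described by its kind and the names of its wires. -/
def gateCode {n m a : ℕ} : Gate (Wire n m a) → List ℕ
  | .had q => 1 :: wireCode q
  | .cnot c q _ => 2 :: (wireCode c ++ wireCode q)
  | .cswap c p q _ _ _ => 3 :: (wireCode c ++ wireCode p ++ wireCode q)

/-- The final memory describes the circuit `c`: the first two cells of array `3` hold the numbers
of ancillas and of gates, and the rows of array `4` the gates. -/
def WritesCircuit {n m a : ℕ} (c : Circuit (Wire n m a)) (s : Mem) : Prop :=
  s 3 0 0 = a ∧ s 3 0 1 = c.length ∧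
    ∀ (g : Fin c.length) (k : ℕ), k < (gateCode (c.get g)).length →
      s 4 g k = (gateCode (c.get g)).getD k 0

/-- Half of the number of copies used per round: `t = 2 ⌈1/ε²⌉`. -/
def pairs (ε : ℝ) : ℕ := ⌈1 / ε ^ 2⌉₊

end HiddenCut

end

/-!
Write `p(s) = ⟨ψ ⊗ ψ| R(s) |ψ ⊗ ψ⟩` for the purity of the reduced state of `ψ` on the
qubits in the support of `s` (`swapValue`). Measuring the Fourier-sampling state of a subspace `Σ`
yields `y` with probability `2^{-n} ∑_{s ∈ Σ} (-1)^{y·s} p(s)^m` (`sampleProb_eq`), where `m` is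
the number of pairs of copies. Across the hidden cut `p` is multiplicative, and it does not change
when `1^C` or its complement is added to `s`; by this symmetry all outcomes are orthogonal to both
indicators (`sampleProb_eq_zero`), so that these are never lost from `Σ`.

If a factor is far from all product states, its purities on nontrivial sets of qubits are at most
`1 - ε²`: a purity is the sum of the fourth powers of the Schmidt coefficients, hence at most the
square of the largest one, which is the largest squared overlap with a product state
(`FarFromSeparable.swapValue_eq`); overlaps are compared with trace distances by
`traceDist_density_sq_le`. With `m ≥ 1/ε²` pairs, `p(s)^m ≤ 1/2` unless `s` is constant on `C` and
on its complement, which leaves four strings (`exists_swapValue_pow`). All outcomes in the span of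
the kept samples, the annihilator of `Σ`, are equally likely, with total probability `|Σ|^{-1}
∑_{s ∈ Σ} p(s)^m ≤ 1/2 + 2/|Σ| ≤ 3/4` as long as `|Σ| ≥ 8` (`sum_sampleProb_span_le`). So each
round keeps its sample with probability at least `1/4`, and with the potential `2^d`, where `d` is
the number of samples still missing, the failure probability after `r` rounds is at most `2^d
(7/8)^r` (`one_sub_le_loopProb`). After `n - 2` samples, `Σ` has four elements and is spanned by
the two indicators (`nullspaceIsCut_of_mem`).

The circuit and the classical programs rest on a generating set of `Σ` in reduced form
(`IsReduced`): the rows `G q` of a square matrix such that `∑_q z_q G_q = z` for `z ∈ Σ`. It is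
updated when a sample is appended by adding one row to others (`IsReduced.step`). Hadamard gates
on the free coordinates (`G_qq = 1`) followed by controlled-NOT gates from these to the others
prepare `|Σ⟩` (`run_prepare`). For the controlled action, the group register is copied to `m`
blocks of ancillas along a binomial tree of depth `O(log m)`, all controlled swaps are done in one
layer, and the copying is undone (`run_controlledAction`, `depth_samplingCircuit_le`).

On the machine, elimination is a loop of matrix updates (`runs_elimProg`). A sample is in the span
when all `G q` are orthogonal to it; the cut is a nonzero row of the final matrix
(`IsReduced.eq_indicator`); and the gates of the circuit are listed by nested loops, with tables
that replace multiplication (`runs_prepareProg`). Running times are bounded by a constant for each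
program, `Prog.weight`, times the number of iterations.
-/

namespace HiddenCut

/-! ### Trace distance and overlap -/

open scoped ComplexOrder in
/-- Cauchy–Schwarz for the singular values, of which `A.rank` are nonzero. -/
theorem traceNorm_sq_le {d : Type} [Fintype d] [DecidableEq d] (A : Matrix d d ℂ) :
    traceNorm A ^ 2 ≤ A.rank * (Matrix.trace (A.conjTranspose * A)).re := by
  classical
  set hA := Matrix.isHermitian_conjTranspose_mul_self A
  have hnn : ∀ i, 0 ≤ hA.eigenvalues i := Matrix.eigenvalues_conjTranspose_mul_self_nonneg A
  have h1 : traceNorm A =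
      ∑ i ∈ univ.filter (fun i => hA.eigenvalues i ≠ 0), √(hA.eigenvalues i) := by
    rw [traceNorm, sum_filter_of_ne]
    intro i _ h h0
    exact h (by rw [h0, Real.sqrt_zero])
  have h2 : (Matrix.trace (A.conjTranspose * A)).re =
      ∑ i ∈ univ.filter (fun i => hA.eigenvalues i ≠ 0), √(hA.eigenvalues i) ^ 2 := by
    rw [hA.trace_eq_sum_eigenvalues, sum_filter_of_ne]
    · rw [Complex.re_sum]
      exact sum_congr rfl fun i _ => by rw [Real.sq_sqrt (hnn i)]; rfl
    · intro i _ h h0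
      exact h (by rw [h0, Real.sqrt_zero]; simp)
  have h3 : (A.rank : ℝ) = #(univ.filter (fun i => hA.eigenvalues i ≠ 0)) := by
    rw [← Matrix.rank_conjTranspose_mul_self A, hA.rank_eq_card_non_zero_eigs,
      Fintype.card_subtype]
  rw [h1, h2, h3]
  exact sq_sum_le_card_mul_sum_sq

theorem rank_add_le_add {d : Type} [Fintype d] (A B : Matrix d d ℂ) :
    (A + B).rank ≤ A.rank + B.rank := by
  have h : LinearMap.range (A + B).mulVecLin ≤
      LinearMap.range A.mulVecLin ⊔ LinearMap.range B.mulVecLin := by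
    rintro _ ⟨v, rfl⟩
    rw [Matrix.mulVecLin_apply, Matrix.add_mulVec]
    exact Submodule.add_mem_sup ⟨v, rfl⟩ ⟨v, rfl⟩
  exact (Submodule.finrank_mono h).trans (Submodule.finrank_add_le_finrank_add_finrank _ _)

theorem IsState.star_dotProduct {ι : Type} [Fintype ι] [DecidableEq ι] {φ : Amp ι}
    (h : IsState φ) : star φ ⬝ᵥ φ = 1 := by
  have : star φ ⬝ᵥ φ = ((∑ x, ‖φ x‖ ^ 2 : ℝ) : ℂ) := by
    simp only [dotProduct, Pi.star_apply, Complex.ofReal_sum]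
    refine sum_congr rfl fun x _ => ?_
    rw [Complex.ofReal_pow, ← Complex.conj_mul']; rfl
  rw [this, h]; simp

open scoped ComplexOrder in
/-- Two pure states with overlap `c` have trace distance at most `√(1 - |c|²)`. -/
theorem traceDist_density_sq_le {ι : Type} [Fintype ι] [DecidableEq ι] {φ χ : Amp ι}
    (hφ : IsState φ) (hχ : IsState χ) :
    traceDist (density φ) (density χ) ^ 2 ≤ 1 - ‖star φ ⬝ᵥ χ‖ ^ 2 := by
  have hr : ((density φ - density χ).rank : ℝ) ≤ 2 := by
    have : density φ - density χ =
        Matrix.vecMulVec φ (star φ) + Matrix.vecMulVec (-χ) (star χ) := by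
      rw [Matrix.neg_vecMulVec, ← sub_eq_add_neg]; rfl
    rw [this]
    have h := (rank_add_le_add (Matrix.vecMulVec φ (star φ)) (Matrix.vecMulVec (-χ) (star χ))).trans
      (add_le_add (Matrix.rank_vecMulVec_le _ _) (Matrix.rank_vecMulVec_le _ _))
    exact_mod_cast h
  have h1 : star χ ⬝ᵥ φ = star (star φ ⬝ᵥ χ) := by
    simp [dotProduct, mul_comm]
  have ht : (Matrix.trace ((density φ - density χ).conjTranspose * (density φ - density χ))).re =
      2 * (1 - ‖star φ ⬝ᵥ χ‖ ^ 2) := by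
    have h2 : Matrix.trace ((density φ - density χ).conjTranspose * (density φ - density χ)) =
        2 - 2 * ((‖star φ ⬝ᵥ χ‖ ^ 2 : ℝ) : ℂ) := by
      have h3 : (star φ ⬝ᵥ χ) * (star χ ⬝ᵥ φ) = ((‖star φ ⬝ᵥ χ‖ ^ 2 : ℝ) : ℂ) := by
        rw [h1, Complex.ofReal_pow, ← Complex.mul_conj']; rfl
      rw [density, density, Matrix.conjTranspose_sub, Matrix.conjTranspose_vecMulVec,
        Matrix.conjTranspose_vecMulVec, star_star, star_star, Matrix.sub_mul, Matrix.mul_sub,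
        Matrix.mul_sub]
      simp only [Matrix.vecMulVec_mul_vecMulVec, Matrix.trace_sub, Matrix.trace_vecMulVec,
        dotProduct_smul, smul_eq_mul]
      rw [hφ.star_dotProduct, hχ.star_dotProduct, dotProduct_comm φ (star φ),
        dotProduct_comm χ (star χ), hφ.star_dotProduct, hχ.star_dotProduct,
        dotProduct_comm φ (star χ), dotProduct_comm χ (star φ), h3,
        mul_comm (star χ ⬝ᵥ φ), h3]
      ring
    rw [h2, ← Complex.ofReal_ofNat, ← Complex.ofReal_mul, ← Complex.ofReal_sub, Complex.ofReal_re]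
    ring
  have hn := traceNorm_sq_le (density φ - density χ)
  rw [ht] at hn
  have hpos : 0 ≤ 2 * (1 - ‖star φ ⬝ᵥ χ‖ ^ 2) := by
    rw [← ht]
    exact (Complex.le_def.1 (Matrix.posSemidef_conjTranspose_mul_self _).trace_nonneg).1
  rw [traceDist, mul_pow]
  nlinarith

/-! ### Purities -/

/-- Splitting the bits of a string into those in `S` and those outside. -/
def splitEquiv {ι : Type} [Fintype ι] [DecidableEq ι] (S : Finset ι) :
    Bits ι ≃ Bits {i // i ∈ S} × Bits {i // i ∈ Sᶜ} where
  toFun x := (fun i => x i, fun i => x i)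
  invFun p i := if h : i ∈ S then p.1 ⟨i, h⟩ else p.2 ⟨i, mem_compl.2 h⟩
  left_inv x := by funext i; by_cases h : i ∈ S <;> simp [h]
  right_inv p := by
    refine Prod.ext (funext fun i => ?_) (funext fun i => ?_)
    · simp [i.2]
    · simp [mem_compl.1 i.2]

theorem sum_split {ι : Type} [Fintype ι] [DecidableEq ι] {M : Type} [AddCommMonoid M]
    (S : Finset ι) (f : Bits ι → M) :
    ∑ x, f x = ∑ a, ∑ b, f ((splitEquiv S).symm (a, b)) := by
  rw [← Fintype.sum_prod_type', ← (splitEquiv S).symm.sum_comp]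

/-- The string that agrees with `y` where `s` is `1` and with `x` elsewhere. -/
def mix {ι : Type} (s x y : Bits ι) : Bits ι := fun i => if s i = 0 then x i else y i

/-- `⟨φ ⊗ φ| R |φ ⊗ φ⟩`, where `R` swaps the qubits in the support of `s` between two copies
of `φ`; this is the purity of the reduced state on these qubits. -/
def swapValue {ι : Type} [Fintype ι] [DecidableEq ι] (φ : Amp ι) (s : Bits ι) : ℂ :=
  ∑ x, ∑ y, (star (φ x) * star (φ y)) * (φ (mix s x y) * φ (mix s y x))

theorem swapValue_productState {ι : Type} [Fintype ι] [DecidableEq ι] (S : Finset ι)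
    (a : Amp {i // i ∈ S}) (b : Amp {i // i ∈ Sᶜ}) (s : Bits ι) :
    swapValue (productState S a b) s =
      swapValue a (fun i => s i) * swapValue b (fun i => s i) := by
  simp only [swapValue]
  rw [sum_split S, sum_mul_sum]
  refine sum_congr rfl fun x _ => sum_congr rfl fun y _ => ?_
  rw [sum_split S, sum_mul_sum]
  refine sum_congr rfl fun x' _ => sum_congr rfl fun y' _ => ?_
  have e1 : ∀ x y, (fun i : {i // i ∈ S} => (splitEquiv S).symm (x, y) i) = x := fun x y =>
    congrArg Prod.fst ((splitEquiv S).apply_symm_apply (x, y))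
  have e2 : ∀ x y, (fun i : {i // i ∈ Sᶜ} => (splitEquiv S).symm (x, y) i) = y := fun x y =>
    congrArg Prod.snd ((splitEquiv S).apply_symm_apply (x, y))
  have m1 : ∀ u v : Bits ι, (fun i : {i // i ∈ S} => mix s u v i) =
    mix (fun i : {i // i ∈ S} => s i) (fun i => u i) (fun i => v i) := fun u v => rfl
  have m2 : ∀ u v : Bits ι, (fun i : {i // i ∈ Sᶜ} => mix s u v i) =
    mix (fun i : {i // i ∈ Sᶜ} => s i) (fun i => u i) (fun i => v i) := fun u v => rfl
  simp only [productState, m1, m2, e1, e2, star_mul']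
  ring

theorem swapValue_const {ι : Type} [Fintype ι] [DecidableEq ι] {φ : Amp ι} (h : IsState φ)
    {s : Bits ι} {c : ZMod 2} (hs : ∀ i, s i = c) : swapValue φ s = 1 := by
  have h2 : ∀ c : ZMod 2, c = 0 ∨ c = 1 := by decide
  have h1 := h.star_dotProduct
  have h3 : ∑ x, ∑ y, (star (φ x) * φ x) * (star (φ y) * φ y) = 1 := by
    rw [← sum_mul_sum]
    simp only [dotProduct, Pi.star_apply] at h1
    rw [h1, one_mul]
  rw [swapValue, ← h3]
  refine sum_congr rfl fun x _ => sum_congr rfl fun y _ => ?_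
  rcases h2 c with rfl | rfl
  · rw [show mix s x y = x from funext fun i => by simp [mix, hs],
      show mix s y x = y from funext fun i => by simp [mix, hs]]
    ring
  · rw [show mix s x y = y from funext fun i => by simp [mix, hs],
      show mix s y x = x from funext fun i => by simp [mix, hs]]
    ring

/-- If no product unit vector has squared overlap more than `κ` with the bipartite vector `M`, then
`M`, as a matrix, has squared operator norm at most `κ`. -/
theorem sum_norm_sq_contract_le {X Y : Type} [Fintype X] [Fintype Y] {M : X → Y → ℂ} {κ : ℝ}
    (hκ : 0 ≤ κ) (h : ∀ (a : X → ℂ) (b : Y → ℂ), ∑ x, ‖a x‖ ^ 2 = 1 → ∑ y, ‖b y‖ ^ 2 = 1 →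
      ‖∑ x, ∑ y, star (a x) * star (b y) * M x y‖ ^ 2 ≤ κ) (a : X → ℂ) :
    ∑ y, ‖∑ x, star (a x) * M x y‖ ^ 2 ≤ κ * ∑ x, ‖a x‖ ^ 2 := by
  set u : Y → ℂ := fun y => ∑ x, star (a x) * M x y with hu
  set A := ∑ x, ‖a x‖ ^ 2 with hA
  set U := ∑ y, ‖u y‖ ^ 2 with hU
  change U ≤ κ * A
  have hu' : ∀ y, u y = ∑ x, star (a x) * M x y := fun y => by rw [hu]
  clear_value u
  have hA0 : 0 ≤ A := sum_nonneg fun _ _ => by positivity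
  have hU0 : 0 ≤ U := sum_nonneg fun _ _ => by positivity
  rcases hA0.eq_or_lt with hA1 | hA1
  · have ha : ∀ x, a x = 0 := fun x => by
      have := (sum_eq_zero_iff_of_nonneg (fun x _ => by positivity)).1 hA1.symm x (mem_univ x)
      simpa using this
    have : U = 0 := by simp [hU, hu, ha]
    rw [this, ← hA1, mul_zero]
  rcases hU0.eq_or_lt with hU1 | hU1
  · rw [← hU1]
    positivity
  have hsA : (√A) ^ 2 = A := Real.sq_sqrt hA0
  have hsU : (√U) ^ 2 = U := Real.sq_sqrt hU0
  have hpA : 0 < √A := Real.sqrt_pos.2 hA1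
  have hpU : 0 < √U := Real.sqrt_pos.2 hU1
  have key := h (fun x => a x / (√A : ℝ)) (fun y => u y / (√U : ℝ))
    (by
      simp only [norm_div, Complex.norm_real, Real.norm_eq_abs, abs_of_pos hpA, div_pow, hsA]
      rw [← sum_div, ← hA, div_self hA1.ne'])
    (by
      simp only [norm_div, Complex.norm_real, Real.norm_eq_abs, abs_of_pos hpU, div_pow, hsU]
      rw [← sum_div, ← hU, div_self hU1.ne'])
  have hval : ∑ x, ∑ y, star (a x / (√A : ℝ)) * star (u y / (√U : ℝ)) * M x y =
      ((√U / √A : ℝ) : ℂ) := by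
    have h1 : ∑ y, star (u y) * u y = ((√U * √U : ℝ) : ℂ) := by
      rw [← pow_two, hsU, hU, Complex.ofReal_sum]
      refine sum_congr rfl fun y _ => ?_
      rw [Complex.ofReal_pow, ← Complex.conj_mul']; rfl
    have hcA : ((√A : ℝ) : ℂ) ≠ 0 := by exact_mod_cast hpA.ne'
    have hcU : ((√U : ℝ) : ℂ) ≠ 0 := by exact_mod_cast hpU.ne'
    have h2 : ∑ x, ∑ y, star (a x / (√A : ℝ)) * star (u y / (√U : ℝ)) * M x y =
        (∑ y, star (u y) * u y) / (((√A : ℝ) : ℂ) * ((√U : ℝ) : ℂ)) := by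
      rw [sum_comm, Finset.sum_div]
      refine sum_congr rfl fun y _ => ?_
      have huy : star (u y) * u y = ∑ x, star (u y) * (star (a x) * M x y) := by
        rw [← mul_sum, ← hu']
      rw [huy, Finset.sum_div]
      refine sum_congr rfl fun x _ => ?_
      simp only [Complex.star_def, map_div₀, Complex.conj_ofReal]
      field_simp
    rw [h2, h1]
    push_cast
    field_simp
  rw [hval, Complex.norm_real, Real.norm_eq_abs, sq_abs, div_pow, hsA, hsU,
    div_le_iff₀ hA1] at key
  exact key

/-- The purity of a reduced state of a bipartite vector is a sum of squares. -/
theorem swapValue_eq_sum_norm_sq {ι : Type} [Fintype ι] [DecidableEq ι] (φ : Amp ι) (s : Bits ι)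
    (S : Finset ι) (hS : S = univ.filter fun i => s i ≠ 0) :
    swapValue φ s = ((∑ b, ∑ b', ‖∑ a, star (φ ((splitEquiv S).symm (a, b))) *
      φ ((splitEquiv S).symm (a, b'))‖ ^ 2 : ℝ) : ℂ) := by
  have hm : ∀ a b a' b', mix s ((splitEquiv S).symm (a, b)) ((splitEquiv S).symm (a', b')) =
      (splitEquiv S).symm (a', b) := by
    intro a b a' b'
    funext i
    by_cases hi : s i = 0
    · have : i ∉ S := by simp [hS, hi]
      simp [mix, hi, splitEquiv, this]
    · have : i ∈ S := by simp [hS, hi]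
      simp [mix, hi, splitEquiv, this]
  rw [swapValue, sum_split S]
  simp_rw [sum_split S (fun y => star (φ _) * star (φ y) * _), hm]
  rw [sum_comm]
  push_cast
  refine sum_congr rfl fun b _ => ?_
  have : ∀ a, ∑ a', ∑ b', star (φ ((splitEquiv S).symm (a, b))) *
      star (φ ((splitEquiv S).symm (a', b'))) *
      (φ ((splitEquiv S).symm (a', b)) * φ ((splitEquiv S).symm (a, b'))) =
      ∑ b', ∑ a', star (φ ((splitEquiv S).symm (a, b))) *
      star (φ ((splitEquiv S).symm (a', b'))) *
      (φ ((splitEquiv S).symm (a', b)) * φ ((splitEquiv S).symm (a, b'))) := fun a => sum_comm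
  simp_rw [this]
  rw [sum_comm]
  refine sum_congr rfl fun b' _ => ?_
  rw [← Complex.mul_conj', map_sum, sum_mul_sum]
  refine sum_congr rfl fun a _ => sum_congr rfl fun a' _ => ?_
  simp only [map_mul, Complex.star_def, Complex.conj_conj]
  ring

theorem sum_norm_sq_split {ι : Type} [Fintype ι] [DecidableEq ι] {φ : Amp ι} (h : IsState φ)
    (S : Finset ι) : ∑ b, ∑ a, ‖φ ((splitEquiv S).symm (a, b))‖ ^ 2 = 1 := by
  rw [sum_comm, ← sum_split S (fun x => ‖φ x‖ ^ 2)]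
  exact h

theorem isState_productState {ι : Type} [Fintype ι] [DecidableEq ι] {S : Finset ι}
    {a : Amp {i // i ∈ S}} {b : Amp {i // i ∈ Sᶜ}} (ha : IsState a) (hb : IsState b) :
    IsState (productState S a b) := by
  have e1 : ∀ x y, (fun i : {i // i ∈ S} => (splitEquiv S).symm (x, y) i) = x := fun x y =>
    congrArg Prod.fst ((splitEquiv S).apply_symm_apply (x, y))
  have e2 : ∀ x y, (fun i : {i // i ∈ Sᶜ} => (splitEquiv S).symm (x, y) i) = y := fun x y =>
    congrArg Prod.snd ((splitEquiv S).apply_symm_apply (x, y))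
  rw [IsState, sum_split S]
  simp only [productState, e1, e2, norm_mul, mul_pow]
  rw [← sum_mul_sum, ha, hb, one_mul]

/-- The reduced states of a state far from all product states have small purity, as the purity is
at most the largest squared overlap with a product state. -/
theorem FarFromSeparable.swapValue_eq {ι : Type} [Fintype ι] [DecidableEq ι] {ε : ℝ} {φ : Amp ι}
    (hφ : IsState φ) (h0 : 0 < ε) (h1 : ε ≤ 1) (hfar : FarFromSeparable ε φ) {s : Bits ι}
    (hs : ¬ ∃ c, ∀ i, s i = c) : ∃ r : ℝ, 0 ≤ r ∧ r ≤ 1 - ε ^ 2 ∧ swapValue φ s = r := by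
  set S := univ.filter fun i => s i ≠ 0 with hS
  have h2 : ∀ c : ZMod 2, c ≠ 0 → c = 1 := by decide
  have hne : S.Nonempty := by
    by_contra hne
    refine hs ⟨0, fun i => by_contra fun hi => hne ⟨i, by simp [hS, hi]⟩⟩
  have hne' : Sᶜ.Nonempty := by
    by_contra hne
    exact hs ⟨1, fun i => h2 _ fun hi => hne ⟨i, by simp [hS, hi]⟩⟩
  have hκ : (0 : ℝ) ≤ 1 - ε ^ 2 := by nlinarith
  have key := sum_norm_sq_contract_le (M := fun a b => φ ((splitEquiv S).symm (a, b))) hκ (by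
    intro a b ha hb
    have hd := hfar S hne hne' a b ha hb
    have ht := traceDist_density_sq_le (isState_productState ha hb) hφ
    have ht' := traceDist_density_sq_le hφ (isState_productState ha hb)
    have e1 : ∀ x y, (fun i : {i // i ∈ S} => (splitEquiv S).symm (x, y) i) = x := fun x y =>
      congrArg Prod.fst ((splitEquiv S).apply_symm_apply (x, y))
    have e2 : ∀ x y, (fun i : {i // i ∈ Sᶜ} => (splitEquiv S).symm (x, y) i) = y := fun x y =>
      congrArg Prod.snd ((splitEquiv S).apply_symm_apply (x, y))
    have hn : ‖star φ ⬝ᵥ productState S a b‖ = ‖∑ x, ∑ y, star (a x) * star (b y) *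
        φ ((splitEquiv S).symm (x, y))‖ := by
      rw [← norm_star]
      congr 1
      rw [dotProduct, star_sum, sum_split S]
      refine sum_congr rfl fun x _ => sum_congr rfl fun y _ => ?_
      simp only [productState, e1, e2, star_mul', Pi.star_apply, star_star]
      ring
    rw [← hn]
    nlinarith)
  refine ⟨_, by positivity, ?_, swapValue_eq_sum_norm_sq φ s S hS⟩
  calc _ ≤ ∑ b, (1 - ε ^ 2) * ∑ a, ‖φ ((splitEquiv S).symm (a, b))‖ ^ 2 :=
        sum_le_sum fun b _ => key (fun a => φ ((splitEquiv S).symm (a, b)))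
    _ = 1 - ε ^ 2 := by rw [← mul_sum, sum_norm_sq_split hφ, mul_one]

/-! ### Duality over the field with two elements -/

/-- The dot product as a bilinear form. -/
abbrev dotForm (n : ℕ) : LinearMap.BilinForm (ZMod 2) (Bits (Fin n)) :=
  dotProductBilin (ZMod 2) (ZMod 2)

theorem dotForm_nondegenerate (n : ℕ) : (dotForm n).Nondegenerate := by
  constructor
  · intro v h
    exact dotProduct_eq_zero v h
  · intro v h
    exact dotProduct_eq_zero v fun w => (dotProduct_comm v w).trans (h w)

theorem dotForm_isRefl (n : ℕ) : (dotForm n).IsRefl := fun v w h =>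
  (dotProduct_comm w v).trans h

theorem mem_orth {n : ℕ} {ys : List (Bits (Fin n))} {z : Bits (Fin n)} :
    z ∈ orth ys ↔ ∀ y ∈ ys, z ⬝ᵥ y = 0 := by simp [orth]

theorem mem_orth_iff {n : ℕ} {ys : List (Bits (Fin n))} {z : Bits (Fin n)} :
    z ∈ orth ys ↔ z ∈ (dotForm n).orthogonal (spanOf ys) := by
  rw [mem_orth, LinearMap.BilinForm.mem_orthogonal_iff]
  constructor
  · intro h y hy
    change y ⬝ᵥ z = 0
    rw [spanOf] at hy
    induction hy using Submodule.span_induction with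
    | mem x hx => rw [dotProduct_comm]; exact h x hx
    | zero => exact zero_dotProduct z
    | add x y _ _ hx hy => rw [add_dotProduct, hx, hy, add_zero]
    | smul a x _ hx => rw [smul_dotProduct, hx, smul_zero]
  · intro h y hy
    rw [dotProduct_comm]
    exact h y (Submodule.subset_span hy)

theorem mem_spanOf_iff {n : ℕ} {ys : List (Bits (Fin n))} {y : Bits (Fin n)} :
    y ∈ spanOf ys ↔ ∀ z ∈ orth ys, z ⬝ᵥ y = 0 := by
  rw [← (dotForm n).orthogonal_orthogonal (dotForm_nondegenerate n) (dotForm_isRefl n) (spanOf ys),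
    LinearMap.BilinForm.mem_orthogonal_iff]
  exact forall_congr' fun z => by rw [mem_orth_iff]; rfl

theorem zero_mem_orth {n : ℕ} (ys : List (Bits (Fin n))) : 0 ∈ orth ys :=
  mem_orth.2 fun _ _ => zero_dotProduct _

theorem add_mem_orth {n : ℕ} {ys : List (Bits (Fin n))} {a b : Bits (Fin n)} (ha : a ∈ orth ys)
    (hb : b ∈ orth ys) : a + b ∈ orth ys :=
  mem_orth.2 fun y hy => by rw [add_dotProduct, mem_orth.1 ha y hy, mem_orth.1 hb y hy, add_zero]

theorem finrank_spanOf {n : ℕ} {ys : List (Bits (Fin n))} (h : Indep ys) :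
    Module.finrank (ZMod 2) (spanOf ys) = ys.length := by
  have : {y | y ∈ ys} = Set.range (fun i : Fin ys.length => ys.get i) := by
    ext y
    simp only [Set.mem_ofPred_eq, Set.mem_range]
    exact List.mem_iff_get
  rw [spanOf, this, finrank_span_eq_card h, Fintype.card_fin]

theorem card_orth {n : ℕ} {ys : List (Bits (Fin n))} (h : Indep ys) :
    #(orth ys) = 2 ^ (n - ys.length) := by
  classical
  have h1 := (dotForm n).finrank_orthogonal (dotForm_nondegenerate n) (spanOf ys)
  rw [finrank_spanOf h, Module.finrank_fin_fun] at h1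
  have h2 := Module.card_eq_pow_finrank (K := ZMod 2) (V := (dotForm n).orthogonal (spanOf ys))
  rw [h1, ZMod.card] at h2
  rw [← h2, Fintype.card_subtype]
  congr 1
  ext z
  simp [mem_orth_iff]

open Classical in
theorem card_spanOf {n : ℕ} {ys : List (Bits (Fin n))} (h : Indep ys) :
    #(univ.filter fun y => y ∈ spanOf ys) = 2 ^ ys.length := by
  have h2 := Module.card_eq_pow_finrank (K := ZMod 2) (V := spanOf ys)
  rw [finrank_spanOf h, ZMod.card] at h2
  rw [← h2, Fintype.card_subtype]

theorem indep_nil {n : ℕ} : Indep ([] : List (Bits (Fin n))) :=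
  linearIndependent_empty_type (v := fun i : Fin 0 => ([] : List (Bits (Fin n))).get i)

theorem Indep.append {n : ℕ} {ys : List (Bits (Fin n))} {y : Bits (Fin n)} (h : Indep ys)
    (hy : y ∉ spanOf ys) : Indep (ys ++ [y]) := by
  have hr : {y | y ∈ ys} = Set.range (fun i : Fin ys.length => ys.get i) := by
    ext y
    simp only [Set.mem_ofPred_eq, Set.mem_range]
    exact List.mem_iff_get
  have h1 := LinearIndependent.finSnoc h (x := y) (by rw [← hr]; exact hy)
  have hl : (ys ++ [y]).length = ys.length + 1 := by simp
  have h2 := h1.comp (Fin.cast hl) (Fin.cast_injective hl)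
  suffices hg : (fun i : Fin (ys ++ [y]).length => (ys ++ [y]).get i) =
      Fin.snoc (fun i : Fin ys.length => ys.get i) y ∘ Fin.cast hl by
    rw [Indep, hg]
    exact h2
  funext i
  obtain ⟨i, hi⟩ := i
  simp only [List.get_eq_getElem, Function.comp, Fin.cast_mk, Fin.snoc]
  rw [hl] at hi
  by_cases h : i < ys.length
  · simp [h, List.getElem_append_left h]
  · have : i = ys.length := by omega
    subst this
    simp

/-! ### Outcome probabilities -/

theorem zmod_two_cases : ∀ c : ZMod 2, c = 0 ∨ c = 1 := by decide

theorem neg_one_pow_val_add : ∀ a b : ZMod 2,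
    ((-1 : ℂ)) ^ (a + b).val = (-1) ^ a.val * (-1) ^ b.val := by
  have h1 : (1 : ZMod 2).val = 1 := rfl
  have h2 : (1 + 1 : ZMod 2).val = 0 := rfl
  intro a b
  rcases zmod_two_cases a with rfl | rfl <;> rcases zmod_two_cases b with rfl | rfl <;>
    simp [h1, h2]

theorem star_neg_one_pow (k : ℕ) : star ((-1 : ℂ) ^ k) = (-1) ^ k := by
  simp

/-- Registers of the copies as pairs of strings. -/
def pairEquiv (n m : ℕ) : (Fin m → Bits (Fin n) × Bits (Fin n)) ≃ Bits (CopyQubit n m) where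
  toFun p q := if q.1.2 = 0 then (p q.1.1).1 q.2 else (p q.1.1).2 q.2
  invFun w i := (fun j => w ((i, 0), j), fun j => w ((i, 1), j))
  left_inv p := by simp
  right_inv w := by
    funext ⟨⟨i, b⟩, j⟩
    rcases zmod_two_cases b with rfl | rfl <;> simp

theorem copies_pairEquiv {n m : ℕ} (ψ : Amp (Fin n)) (p : Fin m → Bits (Fin n) × Bits (Fin n)) :
    copies m ψ (pairEquiv n m p) = ∏ i, ψ (p i).1 * ψ (p i).2 := by
  rw [copies, Fintype.prod_prod_type]
  have h2 : ∀ f : ZMod 2 → ℂ, ∏ b, f b = f 0 * f 1 := Fin.prod_univ_two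
  refine prod_congr rfl fun i _ => ?_
  rw [h2]
  simp [pairEquiv]

theorem swapAction_pairEquiv {n m : ℕ} (s : Bits (Fin n))
    (p : Fin m → Bits (Fin n) × Bits (Fin n)) :
    swapAction s (pairEquiv n m p) =
      pairEquiv n m (fun i => (mix s (p i).1 (p i).2, mix s (p i).2 (p i).1)) := by
  have h11 : (1 + 1 : ZMod 2) = 0 := rfl
  funext ⟨⟨i, b⟩, j⟩
  simp only [swapAction, pairEquiv, mix, Equiv.coe_fn_mk]
  rcases zmod_two_cases b with rfl | rfl <;> rcases zmod_two_cases (s j) with h | h <;>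
    simp [h, h11]

theorem sum_star_copies_mul {n m : ℕ} (ψ : Amp (Fin n)) (s : Bits (Fin n)) :
    ∑ w, star (copies m ψ w) * copies m ψ (swapAction s w) = swapValue ψ s ^ m := by
  rw [← (pairEquiv n m).sum_comp]
  simp_rw [swapAction_pairEquiv, copies_pairEquiv, star_prod, ← prod_mul_distrib]
  have := Fintype.sum_pow (fun xy : Bits (Fin n) × Bits (Fin n) =>
    (star (ψ xy.1) * star (ψ xy.2)) * (ψ (mix s xy.1 xy.2) * ψ (mix s xy.2 xy.1))) m
  rw [Fintype.sum_prod_type] at this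
  rw [swapValue, this]
  refine sum_congr rfl fun p _ => prod_congr rfl fun i _ => ?_
  simp only [star_mul']

theorem swapAction_swapAction {n m : ℕ} (z z' : Bits (Fin n)) (w : Bits (CopyQubit n m)) :
    swapAction z' (swapAction z w) = swapAction (z + z') w := by
  funext q
  simp only [swapAction, Pi.add_apply]
  congr 3
  ring

theorem bits_add_self {ι : Type} (z : Bits ι) : z + z = 0 := by
  funext j
  exact (show ∀ a : ZMod 2, a + a = 0 by decide) (z j)

theorem swapAction_zero {n m : ℕ} (w : Bits (CopyQubit n m)) :
    swapAction (0 : Bits (Fin n)) w = w := by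
  funext q; simp [swapAction]

theorem sum_star_copies_swapAction {n m : ℕ} (ψ : Amp (Fin n)) (z z' : Bits (Fin n)) :
    ∑ w, star (copies m ψ (swapAction z w)) * copies m ψ (swapAction z' w) =
      swapValue ψ (z + z') ^ m := by
  have hinv : Function.Involutive (swapAction z : Bits (CopyQubit n m) → _) := fun w => by
    rw [swapAction_swapAction, bits_add_self, swapAction_zero]
  rw [← sum_star_copies_mul, ← (Equiv.ofBijective _ hinv.bijective).sum_comp]
  refine sum_congr rfl fun w _ => ?_
  simp only [Equiv.ofBijective_apply]
  rw [hinv w, swapAction_swapAction]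

/-- The outcome distribution is the Fourier transform on `Z` of the `m`-th powers of the
purities. -/
theorem sampleProb_eq {n m : ℕ} {Z : Finset (Bits (Fin n))} (h0 : 0 ∈ Z)
    (hadd : ∀ a ∈ Z, ∀ b ∈ Z, a + b ∈ Z) (ψ : Amp (Fin n)) (y : Bits (Fin n)) :
    ((sampleProb m Z ψ y : ℝ) : ℂ) =
      (∑ s ∈ Z, (-1) ^ (y ⬝ᵥ s).val * swapValue ψ s ^ m) / 2 ^ n := by
  have hZ : (0 : ℝ) < #Z := by exact_mod_cast card_pos.2 ⟨0, h0⟩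
  have hF : ∀ w, fourierState m Z ψ y w = ((√(2 ^ n) : ℝ) : ℂ)⁻¹ * ((√(#Z : ℝ) : ℝ) : ℂ)⁻¹ *
      ∑ z ∈ Z, (-1) ^ (y ⬝ᵥ z).val * copies m ψ (swapAction z w) := by
    intro w
    simp only [fourierState, hadamardGroup, controlledAction, uniformState]
    rw [mul_sum, ← sum_subset (subset_univ Z)]
    · refine sum_congr rfl fun z hz => ?_
      rw [if_pos hz]
      push_cast
      ring
    · intro z _ hz
      rw [if_neg hz, zero_mul, mul_zero]
  have hc : star (((√(2 ^ n) : ℝ) : ℂ)⁻¹ * ((√(#Z : ℝ) : ℝ) : ℂ)⁻¹) *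
      (((√(2 ^ n) : ℝ) : ℂ)⁻¹ * ((√(#Z : ℝ) : ℝ) : ℂ)⁻¹) = (2 ^ n * (#Z : ℂ))⁻¹ := by
    have h1 : ((√(2 ^ n) : ℝ) : ℂ) * ((√(2 ^ n) : ℝ) : ℂ) = 2 ^ n := by
      rw [← Complex.ofReal_mul, Real.mul_self_sqrt (by positivity)]; norm_num
    have h2 : ((√(#Z : ℝ) : ℝ) : ℂ) * ((√(#Z : ℝ) : ℝ) : ℂ) = #Z := by
      rw [← Complex.ofReal_mul, Real.mul_self_sqrt hZ.le]; norm_num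
    rw [← h1, ← h2]
    simp only [Complex.star_def, map_mul, map_inv₀, Complex.conj_ofReal]
    ring
  have hsq : ∀ v : ℂ, ((‖v‖ ^ 2 : ℝ) : ℂ) = star v * v := fun v => by
    rw [Complex.ofReal_pow, ← Complex.conj_mul']; rfl
  rw [sampleProb, Complex.ofReal_sum]
  have hterm : ∀ w, ((‖fourierState m Z ψ y w‖ ^ 2 : ℝ) : ℂ) = (2 ^ n * (#Z : ℂ))⁻¹ *
      ∑ z ∈ Z, ∑ z' ∈ Z, (-1) ^ (y ⬝ᵥ (z + z')).val *
        (star (copies m ψ (swapAction z w)) * copies m ψ (swapAction z' w)) := by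
    intro w
    rw [hsq, hF, star_mul', mul_mul_mul_comm, hc, star_sum, sum_mul_sum]
    congr 1
    refine sum_congr rfl fun z _ => sum_congr rfl fun z' _ => ?_
    rw [dotProduct_add, neg_one_pow_val_add, star_mul', star_neg_one_pow]
    ring
  simp_rw [hterm]
  rw [← mul_sum, sum_comm]
  have hz : ∀ z ∈ Z, ∑ w, ∑ z' ∈ Z, (-1) ^ (y ⬝ᵥ (z + z')).val *
        (star (copies m ψ (swapAction z w)) * copies m ψ (swapAction z' w)) =
      ∑ s ∈ Z, (-1) ^ (y ⬝ᵥ s).val * swapValue ψ s ^ m := by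
    intro z hz
    rw [sum_comm]
    simp_rw [← mul_sum, sum_star_copies_swapAction]
    refine sum_bij' (fun z' _ => z + z') (fun s _ => z + s) (fun z' hz' => hadd _ hz _ hz')
      (fun s hs => hadd _ hz _ hs) (fun z' _ => ?_) (fun s _ => ?_) (fun _ _ => rfl)
    · rw [← add_assoc, bits_add_self, zero_add]
    · rw [← add_assoc, bits_add_self, zero_add]
  rw [sum_congr rfl hz, sum_const, nsmul_eq_mul]
  have hZ' : (#Z : ℂ) ≠ 0 := by exact_mod_cast hZ.ne'
  field_simp

/-! ### Success probability of the sampling loop -/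

theorem sum_neg_one_pow_dotProduct {n : ℕ} {s : Bits (Fin n)} (hs : s ≠ 0) :
    ∑ y : Bits (Fin n), (-1 : ℂ) ^ (y ⬝ᵥ s).val = 0 := by
  obtain ⟨j, hj⟩ := Function.ne_iff.1 hs
  have hj1 : s j = 1 := (zmod_two_cases (s j)).resolve_left hj
  have h := Equiv.sum_comp (Equiv.addRight (Pi.single j 1 : Bits (Fin n)))
    (fun y : Bits (Fin n) => (-1 : ℂ) ^ (y ⬝ᵥ s).val)
  have h1 : (1 : ZMod 2).val = 1 := rfl
  simp only [Equiv.coe_addRight, add_dotProduct, neg_one_pow_val_add, single_dotProduct, hj1,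
    mul_one, h1, pow_one, mul_neg, sum_neg_distrib] at h
  exact self_eq_neg.1 h.symm

theorem sum_sampleProb {n m : ℕ} {Z : Finset (Bits (Fin n))} (h0 : 0 ∈ Z)
    (hadd : ∀ a ∈ Z, ∀ b ∈ Z, a + b ∈ Z) {ψ : Amp (Fin n)} (hψ : IsState ψ) :
    ∑ y, sampleProb m Z ψ y = 1 := by
  have h : ((∑ y, sampleProb m Z ψ y : ℝ) : ℂ) = 1 := by
    rw [Complex.ofReal_sum]
    simp_rw [sampleProb_eq h0 hadd]
    rw [← sum_div, sum_comm]
    simp_rw [← sum_mul]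
    rw [sum_eq_single_of_mem 0 h0 (fun s _ hs => by
      rw [sum_neg_one_pow_dotProduct hs, zero_mul])]
    rw [swapValue_const hψ (s := 0) (c := 0) (fun _ => rfl)]
    simp
  exact_mod_cast h

theorem sampleProb_nonneg {n m : ℕ} (Z : Finset (Bits (Fin n))) (ψ : Amp (Fin n))
    (y : Bits (Fin n)) : 0 ≤ sampleProb m Z ψ y := sum_nonneg fun _ _ => by positivity

theorem swapValue_add_one {ι : Type} [Fintype ι] [DecidableEq ι] (φ : Amp ι) (s : Bits ι) :
    swapValue φ (s + 1) = swapValue φ s := by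
  have h : ∀ x y, mix (s + 1) x y = mix s y x := by
    intro x y
    funext i
    rcases zmod_two_cases (s i) with hi | hi <;> simp [mix, hi, show (1 + 1 : ZMod 2) = 0 from rfl]
  simp only [swapValue, h]
  refine sum_congr rfl fun x _ => sum_congr rfl fun y _ => ?_
  ring

theorem swapValue_add_indicator {n : ℕ} (C : Finset (Fin n)) (φ₁ : Amp {i // i ∈ C})
    (φ₂ : Amp {i // i ∈ Cᶜ}) (s : Bits (Fin n)) :
    swapValue (productState C φ₁ φ₂) (s + indicator C) = swapValue (productState C φ₁ φ₂) s ∧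
    swapValue (productState C φ₁ φ₂) (s + indicator Cᶜ) =
      swapValue (productState C φ₁ φ₂) s := by
  simp only [swapValue_productState]
  have h1 : (fun i : {i // i ∈ C} => (s + indicator C) i) = (fun i : {i // i ∈ C} => s i) + 1 := by
    funext i; simp [indicator, i.2]
  have h2 : (fun i : {i // i ∈ Cᶜ} => (s + indicator C) i) = fun i : {i // i ∈ Cᶜ} => s i := by
    funext i; simp [indicator, mem_compl.1 i.2]
  have h3 : (fun i : {i // i ∈ C} => (s + indicator Cᶜ) i) = fun i : {i // i ∈ C} => s i := by
    funext i; simp [indicator, i.2]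
  have h4 : (fun i : {i // i ∈ Cᶜ} => (s + indicator Cᶜ) i) =
      (fun i : {i // i ∈ Cᶜ} => s i) + 1 := by
    funext i; simp [indicator]
  rw [h1, h2, h3, h4, swapValue_add_one, swapValue_add_one]
  exact ⟨rfl, rfl⟩

/-- Outcomes are orthogonal to every symmetry of the purities. -/
theorem sampleProb_eq_zero {n m : ℕ} {ys : List (Bits (Fin n))} {ψ : Amp (Fin n)}
    {y h : Bits (Fin n)} (hh : h ∈ orth ys) (hsymm : ∀ s, swapValue ψ (s + h) = swapValue ψ s)
    (hy : h ⬝ᵥ y ≠ 0) : sampleProb m (orth ys) ψ y = 0 := by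
  have key : ((sampleProb m (orth ys) ψ y : ℝ) : ℂ) = 0 := by
    rw [sampleProb_eq (zero_mem_orth ys) (fun _ ha _ hb => add_mem_orth ha hb)]
    have : ∑ s ∈ orth ys, (-1) ^ (y ⬝ᵥ s).val * swapValue ψ s ^ m =
        ∑ s ∈ orth ys, -((-1) ^ (y ⬝ᵥ s).val * swapValue ψ s ^ m) := by
      refine sum_bij' (fun s _ => s + h) (fun s _ => s + h) (fun s hs => add_mem_orth hs hh)
        (fun s hs => add_mem_orth hs hh) (fun s _ => ?_) (fun s _ => ?_) (fun s _ => ?_)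
      · rw [add_assoc, bits_add_self, add_zero]
      · rw [add_assoc, bits_add_self, add_zero]
      · have h1 : (1 : ZMod 2).val = 1 := rfl
        rw [hsymm, dotProduct_add, neg_one_pow_val_add, dotProduct_comm y h,
          (zmod_two_cases _).resolve_left hy, h1]
        ring
    rw [sum_neg_distrib] at this
    rw [self_eq_neg.1 this, zero_div]
  exact_mod_cast key

/-- The number of copies is chosen such that all purities that are not `1` drop to `1/2`. -/
theorem pow_pairs_le {ε : ℝ} (h0 : 0 < ε) (h1 : ε ≤ 1) : (1 - ε ^ 2) ^ pairs ε ≤ 1 / 2 := by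
  have hm : 1 ≤ ε ^ 2 * pairs ε := by
    have := Nat.le_ceil (1 / ε ^ 2)
    rw [div_le_iff₀ (by positivity)] at this
    rw [mul_comm]; exact this
  have h2 : 1 - ε ^ 2 ≤ Real.exp (-ε ^ 2) := by
    have := Real.add_one_le_exp (-ε ^ 2); linarith
  calc (1 - ε ^ 2) ^ pairs ε ≤ Real.exp (-ε ^ 2) ^ pairs ε :=
        pow_le_pow_left₀ (by nlinarith) h2 _
    _ = Real.exp (-(ε ^ 2 * pairs ε)) := by rw [← Real.exp_nat_mul]; congr 1; ring
    _ ≤ Real.exp (-1) := Real.exp_le_exp.2 (by linarith)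
    _ ≤ 1 / 2 := by
      rw [Real.exp_neg, one_div]
      exact inv_anti₀ (by norm_num) (by have := Real.add_one_le_exp (1 : ℝ); linarith)

theorem FarFromSeparable.exists_swapValue {ι : Type} [Fintype ι] [DecidableEq ι] {ε : ℝ}
    {φ : Amp ι} (hφ : IsState φ) (h0 : 0 < ε) (h1 : ε ≤ 1) (hfar : FarFromSeparable ε φ)
    (s : Bits ι) : ∃ r : ℝ, 0 ≤ r ∧ r ≤ 1 ∧ swapValue φ s = r ∧
      ((∃ c, ∀ i, s i = c) ∨ r ≤ 1 - ε ^ 2) := by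
  by_cases hs : ∃ c, ∀ i, s i = c
  · obtain ⟨c, hc⟩ := hs
    exact ⟨1, zero_le_one, le_rfl, by rw [swapValue_const hφ hc]; simp, Or.inl ⟨c, hc⟩⟩
  · obtain ⟨r, hr0, hr1, hr⟩ := hfar.swapValue_eq hφ h0 h1 hs
    exact ⟨r, hr0, hr1.trans (by nlinarith), hr, Or.inr hr1⟩

/-- The strings that are constant on `C` and on its complement. -/
def cutStrings {n : ℕ} (C : Finset (Fin n)) : Finset (Bits (Fin n)) :=
  univ.image fun c : ZMod 2 × ZMod 2 => c.1 • indicator C + c.2 • indicator Cᶜ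

theorem card_cutStrings_le {n : ℕ} (C : Finset (Fin n)) : #(cutStrings C) ≤ 4 :=
  card_image_le.trans (by simp)

theorem mem_cutStrings {n : ℕ} {C : Finset (Fin n)} {s : Bits (Fin n)} {c c' : ZMod 2}
    (h : ∀ i ∈ C, s i = c) (h' : ∀ i ∈ Cᶜ, s i = c') : s ∈ cutStrings C := by
  refine mem_image.2 ⟨(c, c'), mem_univ _, ?_⟩
  funext i
  by_cases hi : i ∈ C
  · simp [indicator, hi, h i hi]
  · simp [indicator, hi, h' i (mem_compl.2 hi)]

theorem exists_swapValue_pow {n : ℕ} {ε : ℝ} (h0 : 0 < ε) (h1 : ε ≤ 1) {C : Finset (Fin n)}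
    {φ₁ : Amp {i // i ∈ C}} {φ₂ : Amp {i // i ∈ Cᶜ}} (hφ₁ : IsState φ₁) (hφ₂ : IsState φ₂)
    (hf₁ : FarFromSeparable ε φ₁) (hf₂ : FarFromSeparable ε φ₂) (s : Bits (Fin n)) :
    ∃ r : ℝ, 0 ≤ r ∧ r ≤ 1 ∧ swapValue (productState C φ₁ φ₂) s ^ pairs ε = r ∧
      (s ∈ cutStrings C ∨ r ≤ 1 / 2) := by
  obtain ⟨r₁, p₁, q₁, e₁, d₁⟩ := hf₁.exists_swapValue hφ₁ h0 h1 (fun i => s i)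
  obtain ⟨r₂, p₂, q₂, e₂, d₂⟩ := hf₂.exists_swapValue hφ₂ h0 h1 (fun i => s i)
  have hε : 0 ≤ 1 - ε ^ 2 := by nlinarith
  refine ⟨(r₁ * r₂) ^ pairs ε, by positivity, pow_le_one₀ (by positivity) (by nlinarith),
    by rw [swapValue_productState, e₁, e₂]; push_cast; rfl, ?_⟩
  have small : r₁ * r₂ ≤ 1 - ε ^ 2 → (r₁ * r₂) ^ pairs ε ≤ 1 / 2 := fun h =>
    (pow_le_pow_left₀ (by positivity) h _).trans (pow_pairs_le h0 h1)
  rcases d₁ with ⟨c, hc⟩ | d₁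
  · rcases d₂ with ⟨c', hc'⟩ | d₂
    · exact Or.inl (mem_cutStrings (fun i hi => hc ⟨i, hi⟩) (fun i hi => hc' ⟨i, hi⟩))
    · exact Or.inr (small (by nlinarith))
  · exact Or.inr (small (by nlinarith))

open Classical in
/-- A sample is discarded with probability at most `3/4`: on the at least eight strings orthogonal
to the kept samples, the purities are `1` for at most four and small for all others. -/
theorem sum_sampleProb_span_le {n : ℕ} {ε : ℝ} (h0 : 0 < ε) (h1 : ε ≤ 1) {C : Finset (Fin n)}
    {φ₁ : Amp {i // i ∈ C}} {φ₂ : Amp {i // i ∈ Cᶜ}} (hφ₁ : IsState φ₁) (hφ₂ : IsState φ₂)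
    (hf₁ : FarFromSeparable ε φ₁) (hf₂ : FarFromSeparable ε φ₂) {ys : List (Bits (Fin n))}
    (hys : Indep ys) (hlen : ys.length + 2 < n) :
    ∑ y ∈ univ.filter (fun y => y ∈ spanOf ys),
      sampleProb (pairs ε) (orth ys) (productState C φ₁ φ₂) y ≤ 3 / 4 := by
  choose q hq0 hq1 hq hqs using exists_swapValue_pow h0 h1 hφ₁ hφ₂ hf₁ hf₂
  have hy : ∀ y ∈ univ.filter (fun y => y ∈ spanOf ys),
      sampleProb (pairs ε) (orth ys) (productState C φ₁ φ₂) y =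
        (∑ s ∈ orth ys, q s) / 2 ^ n := by
    intro y hy
    have hy' := (mem_filter.1 hy).2
    have : ((sampleProb (pairs ε) (orth ys) (productState C φ₁ φ₂) y : ℝ) : ℂ) =
        (((∑ s ∈ orth ys, q s) / 2 ^ n : ℝ) : ℂ) := by
      rw [sampleProb_eq (zero_mem_orth ys) (fun _ ha _ hb => add_mem_orth ha hb)]
      push_cast
      congr 1
      refine sum_congr rfl fun s hs => ?_
      rw [hq, dotProduct_comm, mem_spanOf_iff.1 hy' s hs]
      simp
    exact_mod_cast this
  have hN : (#(orth ys) : ℝ) * 2 ^ ys.length = 2 ^ n := by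
    rw [card_orth hys]
    push_cast
    rw [← pow_add]
    congr 1
    omega
  have h8 : (8 : ℝ) ≤ #(orth ys) := by
    rw [card_orth hys]
    have : 2 ^ 3 ≤ 2 ^ (n - ys.length) := Nat.pow_le_pow_right (by norm_num) (by omega)
    exact_mod_cast this
  have hsum : ∑ s ∈ orth ys, q s ≤ 2 + (#(orth ys) : ℝ) / 2 := by
    have h2 : ∀ s ∈ orth ys, q s ≤ 1 / 2 + if s ∈ cutStrings C then 1 / 2 else 0 := by
      intro s _
      split_ifs with h
      · linarith [hq1 s]
      · linarith [(hqs s).resolve_left h]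
    refine (sum_le_sum h2).trans ?_
    rw [sum_add_distrib, sum_const, nsmul_eq_mul, ← sum_filter, sum_const, nsmul_eq_mul]
    have h3 : (#{a ∈ orth ys | a ∈ cutStrings C} : ℝ) ≤ 4 := by
      refine le_trans ?_ (Nat.cast_le.2 (card_cutStrings_le C))
      exact Nat.cast_le.2 (card_le_card fun s hs => (mem_filter.1 hs).2)
    linarith
  rw [sum_congr rfl hy, sum_const, card_spanOf hys, nsmul_eq_mul, ← hN]
  push_cast
  have hp : (0 : ℝ) < 2 ^ ys.length := by positivity
  rw [mul_div_assoc', mul_comm, mul_div_mul_right _ _ hp.ne', div_le_iff₀ (by linarith)]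
  linarith

/-- Each round succeeds with probability at least `1/4`, whatever happened before, so that the
probability of being `d` samples short after `r` rounds is at most `2^d (7/8)^r`. -/
theorem one_sub_le_loopProb {n : ℕ} {ε : ℝ} (h0 : 0 < ε) (h1 : ε ≤ 1) {C : Finset (Fin n)}
    {φ₁ : Amp {i // i ∈ C}} {φ₂ : Amp {i // i ∈ Cᶜ}} (hφ₁ : IsState φ₁) (hφ₂ : IsState φ₂)
    (hf₁ : FarFromSeparable ε φ₁) (hf₂ : FarFromSeparable ε φ₂)
    {E : List (Bits (Fin n)) → Prop}
    (hE : ∀ ys, Indep ys → indicator C ∈ orth ys → indicator Cᶜ ∈ orth ys →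
      ys.length + 2 = n → E ys) (r : ℕ) :
    ∀ ys : List (Bits (Fin n)), Indep ys → indicator C ∈ orth ys → indicator Cᶜ ∈ orth ys →
      ys.length + 2 ≤ n → 1 - 2 ^ (n - 2 - ys.length) * (7 / 8 : ℝ) ^ r ≤
        loopProb (pairs ε) (productState C φ₁ φ₂) E r ys := by
  classical
  have hdone : ∀ r (ys : List (Bits (Fin n))), Indep ys → indicator C ∈ orth ys →
      indicator Cᶜ ∈ orth ys → ys.length + 2 = n →
      loopProb (pairs ε) (productState C φ₁ φ₂) E r ys = 1 := by
    intro r ys hys hC hC' hlen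
    cases r with
    | zero => rw [loopProb, if_pos (hE ys hys hC hC' hlen)]
    | succ r => rw [loopProb, if_neg (by omega), if_pos (hE ys hys hC hC' hlen)]
  induction r with
  | zero =>
    intro ys hys hC hC' hlen
    rcases hlen.eq_or_lt with hlen | hlen
    · rw [hdone 0 ys hys hC hC' hlen]
      have : (0 : ℝ) < 2 ^ (n - 2 - ys.length) * (7 / 8 : ℝ) ^ 0 := by positivity
      linarith
    · have h2 : (1 : ℝ) ≤ 2 ^ (n - 2 - ys.length) := one_le_pow₀ (by norm_num)
      have h3 : 0 ≤ loopProb (pairs ε) (productState C φ₁ φ₂) E 0 ys := by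
        rw [loopProb]; split_ifs <;> norm_num
      rw [pow_zero, mul_one]
      linarith
  | succ r ih =>
    intro ys hys hC hC' hlen
    rcases hlen.eq_or_lt with hlen | hlen
    · rw [hdone (r + 1) ys hys hC hC' hlen]
      have : (0 : ℝ) < 2 ^ (n - 2 - ys.length) * (7 / 8 : ℝ) ^ (r + 1) := by positivity
      linarith
    rw [loopProb, if_pos hlen]
    set P := fun y => sampleProb (pairs ε) (orth ys) (productState C φ₁ φ₂) y with hP
    set F : ℝ := 2 ^ (n - 2 - ys.length) * (7 / 8 : ℝ) ^ r with hF
    have hF0 : 0 < F := by positivity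
    have hP0 : ∀ y, 0 ≤ P y := fun y => sampleProb_nonneg _ _ _
    have hP1 : ∑ y, P y = 1 := sum_sampleProb (zero_mem_orth ys)
      (fun _ ha _ hb => add_mem_orth ha hb) (isState_productState hφ₁ hφ₂)
    have hPs := sum_sampleProb_span_le h0 h1 hφ₁ hφ₂ hf₁ hf₂ hys hlen
    have hterm : ∀ y, P y * (1 - F / 2 - if y ∈ spanOf ys then F / 2 else 0) ≤
        P y * loopProb (pairs ε) (productState C φ₁ φ₂) E r
          (if y ∈ spanOf ys then ys else ys ++ [y]) := by
      intro y
      by_cases hy : y ∈ spanOf ys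
      · rw [if_pos hy, if_pos hy]
        refine mul_le_mul_of_nonneg_left ?_ (hP0 y)
        have := ih ys hys hC hC' hlen.le
        linarith
      · rw [if_neg hy, if_neg hy]
        by_cases hC1 : indicator C ⬝ᵥ y = 0
        · by_cases hC2 : indicator Cᶜ ⬝ᵥ y = 0
          · refine mul_le_mul_of_nonneg_left ?_ (hP0 y)
            have hmem : ∀ z, z ∈ orth ys → z ⬝ᵥ y = 0 → z ∈ orth (ys ++ [y]) := by
              intro z hz hzy
              refine mem_orth.2 fun x hx => ?_
              rcases List.mem_append.1 hx with hx | hx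
              · exact mem_orth.1 hz x hx
              · rw [List.mem_singleton.1 hx, hzy]
            have := ih (ys ++ [y]) (hys.append hy) (hmem _ hC hC1) (hmem _ hC' hC2)
              (by simp; omega)
            refine le_trans (le_of_eq ?_) this
            have he : n - 2 - ys.length = (n - 2 - (ys ++ [y]).length) + 1 := by
              rw [List.length_append, List.length_singleton]; omega
            rw [hF, he, pow_succ]
            ring
          · have : P y = 0 := sampleProb_eq_zero hC'
              (fun s => (swapValue_add_indicator C φ₁ φ₂ s).2) hC2
            rw [this, zero_mul, zero_mul]
        · have : P y = 0 := sampleProb_eq_zero hC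
            (fun s => (swapValue_add_indicator C φ₁ φ₂ s).1) hC1
          rw [this, zero_mul, zero_mul]
    refine le_trans ?_ (sum_le_sum fun y _ => hterm y)
    have hsum : ∑ y, P y * (1 - F / 2 - if y ∈ spanOf ys then F / 2 else 0) =
        (1 - F / 2) - (∑ y ∈ univ.filter (fun y => y ∈ spanOf ys), P y) * (F / 2) := by
      simp_rw [mul_sub (P _) (1 - F / 2)]
      rw [sum_sub_distrib, ← sum_mul, hP1, one_mul, sum_mul, sum_filter]
      congr 1
      refine sum_congr rfl fun y _ => ?_
      split_ifs <;> simp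
    rw [hsum, pow_succ, ← mul_assoc, ← hF]
    nlinarith

/-- Samples that leave only four strings, among them the two indicators, reveal the cut. -/
theorem nullspaceIsCut_of_mem {n : ℕ} {ys : List (Bits (Fin n))} {C : Finset (Fin n)}
    (hn : 0 < n) (hcard : 2 * #C = n) (hys : Indep ys) (hC : indicator C ∈ orth ys)
    (hC' : indicator Cᶜ ∈ orth ys) (hlen : ys.length + 2 = n) : NullspaceIsCut ys C := by
  have hne : C.Nonempty := card_pos.1 (by omega)
  have hne' : Cᶜ.Nonempty := card_pos.1 (by rw [card_compl, Fintype.card_fin]; omega)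
  obtain ⟨i, hi⟩ := hne
  obtain ⟨i', hi'⟩ := hne'
  have hinj : Function.Injective
      (fun c : ZMod 2 × ZMod 2 => c.1 • indicator C + c.2 • indicator Cᶜ) := by
    rintro ⟨a, b⟩ ⟨a', b'⟩ h
    have e1 := congrFun h i
    have e2 := congrFun h i'
    simp only [Pi.add_apply, Pi.smul_apply, indicator, hi, mem_compl, not_true, if_true, if_false,
      smul_eq_mul, mul_one, mul_zero, add_zero, mem_compl.1 hi', not_false_iff, zero_add] at e1 e2
    rw [e1, e2]
  have hspan : ∀ z, z ∈ cutStrings C ↔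
      z ∈ Submodule.span (ZMod 2) {indicator C, indicator Cᶜ} := by
    intro z
    rw [Submodule.mem_span_pair, cutStrings]
    simp [mem_image]
  have hsub : cutStrings C ⊆ orth ys := by
    intro z hz
    obtain ⟨⟨a, b⟩, _, rfl⟩ := mem_image.1 hz
    have hs : ∀ (c : ZMod 2) (z : Bits (Fin n)), z ∈ orth ys → c • z ∈ orth ys := by
      intro c z hz
      rcases zmod_two_cases c with rfl | rfl
      · rw [zero_smul]; exact zero_mem_orth ys
      · rwa [one_smul]
    exact add_mem_orth (hs _ _ hC) (hs _ _ hC')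
  have heq : cutStrings C = orth ys := by
    refine eq_of_subset_of_card_le hsub ?_
    rw [card_orth hys, cutStrings, card_image_of_injective _ hinj, card_univ, Fintype.card_prod,
      ZMod.card, show n - ys.length = 2 by omega]
    norm_num
  rw [NullspaceIsCut, ← heq]
  ext z
  exact hspan z

/-! ### Reduced generating sets of the nullspace -/

/-- The rows of `G` generate `orth ys`, in reduced form: a row with a zero on the diagonal vanishes,
and a one on the diagonal is the only nonzero entry of its column among the nonzero rows. The
coordinates with a one on the diagonal are free, and a string of `orth ys` is the sum of the rows
selected by its free coordinates. -/
structure IsReduced {n : ℕ} (G : Fin n → Bits (Fin n)) (ys : List (Bits (Fin n))) : Prop where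
  mem : ∀ q, G q ∈ orth ys
  sum_smul : ∀ z ∈ orth ys, ∑ q, z q • G q = z
  row : ∀ q, G q q = 0 → G q = 0
  col : ∀ q q', G q' q' = 1 → q ≠ q' → G q q' = 0

theorem isReduced_nil {n : ℕ} :
    IsReduced (fun q : Fin n => Pi.single q (1 : ZMod 2)) [] where
  mem q := mem_orth.2 (by simp)
  sum_smul z _ := by
    funext j
    simp [Finset.sum_apply, Pi.single_apply]
  row q h := by simp at h
  col q q' _ h := by simp [h.symm]

/-- Imposing orthogonality to one more string: a row `G p` not orthogonal to it is added to all
such rows, itself included. -/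
theorem IsReduced.step {n : ℕ} {G : Fin n → Bits (Fin n)} {ys : List (Bits (Fin n))}
    (h : IsReduced G ys) (y R : Bits (Fin n))
    (hR : (∀ q, G q ⬝ᵥ y = 0) ∨ ∃ p, G p ⬝ᵥ y = 1 ∧ R = G p) :
    IsReduced (fun q => G q + (G q ⬝ᵥ y) • R) (ys ++ [y]) := by
  have hmem : ∀ z, z ∈ orth (ys ++ [y]) ↔ z ∈ orth ys ∧ z ⬝ᵥ y = 0 := by
    intro z
    simp only [mem_orth, List.mem_append, List.mem_singleton]
    exact ⟨fun h => ⟨fun x hx => h x (Or.inl hx), h y (Or.inr rfl)⟩,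
      fun h x hx => hx.elim (h.1 x) fun e => e ▸ h.2⟩
  rcases hR with h0 | ⟨p, hp, rfl⟩
  · have e : (fun q => G q + (G q ⬝ᵥ y) • R) = G := by
      funext q
      rw [h0, zero_smul, add_zero]
    rw [e]
    exact ⟨fun q => (hmem _).2 ⟨h.mem q, h0 q⟩, fun z hz => h.sum_smul z ((hmem z).1 hz).1,
      h.row, h.col⟩
  have hpp : G p p = 1 := (zmod_two_cases _).resolve_left fun h0 => by
    rw [h.row p h0, zero_dotProduct] at hp
    exact zero_ne_one hp
  have h11 : ∀ c : ZMod 2, c + c = 0 := by decide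
  have hs : ∀ (c : ZMod 2) (z : Bits (Fin n)), z ∈ orth ys → c • z ∈ orth ys := by
    intro c z hz
    rcases zmod_two_cases c with rfl | rfl
    · rw [zero_smul]; exact zero_mem_orth ys
    · rwa [one_smul]
  refine ⟨fun q => (hmem _).2 ⟨add_mem_orth (h.mem q) (hs _ _ (h.mem p)), ?_⟩, fun z hz => ?_,
    fun q hq => ?_, fun q q' hq' hne => ?_⟩
  · rw [add_dotProduct, smul_dotProduct, hp, smul_eq_mul, mul_one, h11]
  · obtain ⟨hz1, hz2⟩ := (hmem z).1 hz
    have hz3 := h.sum_smul z hz1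
    simp only [smul_add, sum_add_distrib]
    rw [hz3]
    have : ∑ q, z q • (G q ⬝ᵥ y) • G p = (z ⬝ᵥ y) • G p := by
      conv_rhs => rw [← hz3, sum_dotProduct, Finset.sum_smul]
      exact sum_congr rfl fun q _ => by rw [smul_dotProduct, smul_smul, smul_eq_mul]
    rw [this, hz2, zero_smul, add_zero]
  · by_cases hqp : q = p
    · subst hqp
      simp only [hp, one_smul]
      exact bits_add_self _
    simp only [Pi.add_apply, Pi.smul_apply, smul_eq_mul] at hq
    have hG : G q = 0 := by
      rcases zmod_two_cases (G q q) with h0 | h1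
      · exact h.row q h0
      · rw [h.col p q h1 (Ne.symm hqp), h1, mul_zero, add_zero] at hq
        exact absurd hq one_ne_zero
    simp [hG]
  · by_cases hqp : q' = p
    · subst hqp
      simp only [hp, one_smul, Pi.add_apply, h11] at hq'
      exact absurd hq' zero_ne_one
    simp only [Pi.add_apply, Pi.smul_apply, smul_eq_mul] at hq' ⊢
    have hq1 : G q' q' = 1 := by
      refine (zmod_two_cases _).resolve_left fun h0 => ?_
      rw [h.row q' h0] at hq'
      simp at hq'
    rw [h.col q q' hq1 hne, h.col p q' hq1 (Ne.symm hqp), mul_zero, add_zero]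

theorem IsReduced.mem_spanOf_iff {n : ℕ} {G : Fin n → Bits (Fin n)} {ys : List (Bits (Fin n))}
    (h : IsReduced G ys) (y : Bits (Fin n)) : y ∈ spanOf ys ↔ ∀ q, G q ⬝ᵥ y = 0 := by
  rw [HiddenCut.mem_spanOf_iff]
  refine ⟨fun hy q => hy _ (h.mem q), fun hy z hz => ?_⟩
  rw [← h.sum_smul z hz, sum_dotProduct]
  exact sum_eq_zero fun q _ => by rw [smul_dotProduct, hy, smul_zero]

/-- The free coordinates. -/
def freeSet {n : ℕ} (G : Fin n → Bits (Fin n)) : Finset (Fin n) :=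
  univ.filter fun q => G q q = 1

theorem IsReduced.mem_orth_iff {n : ℕ} {G : Fin n → Bits (Fin n)} {ys : List (Bits (Fin n))}
    (h : IsReduced G ys) (z : Bits (Fin n)) : z ∈ orth ys ↔ ∑ q, z q • G q = z := by
  refine ⟨h.sum_smul z, fun hz => mem_orth.2 fun y hy => ?_⟩
  rw [← hz, sum_dotProduct]
  exact sum_eq_zero fun q _ => by rw [smul_dotProduct, mem_orth.1 (h.mem q) y hy, smul_zero]

theorem IsReduced.sum_smul_apply {n : ℕ} {G : Fin n → Bits (Fin n)} {ys : List (Bits (Fin n))}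
    (h : IsReduced G ys) (z : Bits (Fin n)) {q : Fin n} (hq : G q q = 1) :
    (∑ p, z p • G p) q = z q := by
  rw [Finset.sum_apply, sum_eq_single q]
  · rw [Pi.smul_apply, hq, smul_eq_mul, mul_one]
  · intro p _ hp
    rw [Pi.smul_apply, h.col p q hq hp, smul_zero]
  · simp

theorem IsReduced.card_orth {n : ℕ} {G : Fin n → Bits (Fin n)} {ys : List (Bits (Fin n))}
    (h : IsReduced G ys) : #(orth ys) = 2 ^ #(freeSet G) := by
  have hc : #(univ : Finset ({q // q ∈ freeSet G} → ZMod 2)) = 2 ^ #(freeSet G) := by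
    rw [card_univ, Fintype.card_fun, ZMod.card, Fintype.card_coe]
  have hval : ∀ (f : {q // q ∈ freeSet G} → ZMod 2) (q : Fin n) (hq : q ∈ freeSet G),
      (∑ p : Fin n, (if hp : p ∈ freeSet G then f ⟨p, hp⟩ else 0) • G p) q = f ⟨q, hq⟩ := by
    intro f q hq
    rw [h.sum_smul_apply (fun p => if hp : p ∈ freeSet G then f ⟨p, hp⟩ else 0)
      (mem_filter.1 hq).2, dif_pos hq]
  rw [← hc]
  refine card_bij' (fun z _ q => z q)
    (fun f _ => ∑ p : Fin n, (if hp : p ∈ freeSet G then f ⟨p, hp⟩ else 0) • G p)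
    (fun _ _ => mem_univ _) (fun f _ => ?_) (fun z hz => ?_) (fun f _ => ?_)
  · refine mem_orth.2 fun y hy => ?_
    rw [sum_dotProduct]
    exact sum_eq_zero fun q _ => by rw [smul_dotProduct, mem_orth.1 (h.mem q) y hy, smul_zero]
  · conv_rhs => rw [← h.sum_smul z hz]
    refine sum_congr rfl fun p _ => ?_
    split_ifs with hp
    · rfl
    · have : G p = 0 := h.row p ((zmod_two_cases _).resolve_right fun h1 =>
        hp (mem_filter.2 ⟨mem_univ _, h1⟩))
      rw [this, smul_zero, smul_zero]
  · funext q
    exact hval f q q.2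

/-- If the nullspace is that of a cut, every nonzero row shows the cut: it is not the all-ones
string as it vanishes at the other free coordinate. -/
theorem IsReduced.eq_indicator {n : ℕ} {G : Fin n → Bits (Fin n)} {ys : List (Bits (Fin n))}
    (h : IsReduced G ys) (hys : Indep ys) (hlen : ys.length + 2 = n) {S : Finset (Fin n)}
    (hS : NullspaceIsCut ys S) {q : Fin n} (hq : G q q = 1) :
    G q = indicator S ∨ G q = indicator Sᶜ := by
  have hcard : #(freeSet G) = 2 := by
    have h1 := h.card_orth
    rw [HiddenCut.card_orth hys, show n - ys.length = 2 by omega] at h1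
    exact (Nat.pow_right_injective le_rfl h1).symm
  obtain ⟨q', hq', hne⟩ := exists_mem_ne (by omega : 1 < #(freeSet G)) q
  have hq'1 := (mem_filter.1 hq').2
  have h0 : G q q' = 0 := h.col q q' hq'1 hne.symm
  have hmem : G q ∈ Submodule.span (ZMod 2) {indicator S, indicator Sᶜ} := by
    have : G q ∈ (orth ys : Set (Bits (Fin n))) := h.mem q
    rw [hS] at this
    exact this
  obtain ⟨a, b, hab⟩ := Submodule.mem_span_pair.1 hmem
  rcases zmod_two_cases a with rfl | rfl <;> rcases zmod_two_cases b with rfl | rfl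
  · rw [← hab] at hq
    simp at hq
  · right; rw [← hab]; simp
  · left; rw [← hab]; simp
  · rw [← hab] at h0
    simp only [one_smul, Pi.add_apply, indicator, mem_compl] at h0
    by_cases hS' : q' ∈ S <;> simp [hS'] at h0

theorem IsReduced.freeSet_nonempty {n : ℕ} {G : Fin n → Bits (Fin n)} {ys : List (Bits (Fin n))}
    (h : IsReduced G ys) (hys : Indep ys) (hlen : ys.length + 2 = n) : ∃ q, G q q = 1 := by
  have h1 := h.card_orth
  rw [HiddenCut.card_orth hys, show n - ys.length = 2 by omega] at h1
  have h2 : #(freeSet G) = 2 := (Nat.pow_right_injective le_rfl h1).symm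
  obtain ⟨q, hq⟩ := card_pos.1 (by omega : 0 < #(freeSet G))
  exact ⟨q, (mem_filter.1 hq).2⟩

/-! ### Depth of circuits -/

/-- One gate's update of the table of wire depths. -/
def depthStep {W : Type} [DecidableEq W] (d : W → ℕ) (g : Gate W) : W → ℕ :=
  fun w => if w ∈ g.wires then g.wires.sup d + 1 else d w

/-- Appended to any circuit, `c` increases the depth by at most `k`. -/
def DepthLE {W : Type} [DecidableEq W] (c : Circuit W) (k : ℕ) : Prop :=
  ∀ (D : ℕ) (d : W → ℕ), (∀ w, d w ≤ D) → ∀ w, c.foldl depthStep d w ≤ D + k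

theorem DepthLE.depth_le {W : Type} [Fintype W] [DecidableEq W] {c : Circuit W} {k : ℕ}
    (h : DepthLE c k) : c.depth ≤ k :=
  Finset.sup_le fun w _ => (h 0 (fun _ => 0) (fun _ => le_rfl) w).trans (Nat.zero_add k).le

theorem DepthLE.append {W : Type} [DecidableEq W] {c c' : Circuit W} {k k' : ℕ}
    (h : DepthLE c k) (h' : DepthLE c' k') : DepthLE (c ++ c') (k + k') := by
  intro D d hd w
  rw [List.foldl_append, ← add_assoc]
  exact h' _ _ (h D d hd) w

theorem DepthLE.mono {W : Type} [DecidableEq W] {c : Circuit W} {k k' : ℕ}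
    (h : DepthLE c k) (hk : k ≤ k') : DepthLE c k' := fun D d hd w =>
  (h D d hd w).trans (by omega)

theorem depthLE_nil {W : Type} [DecidableEq W] : DepthLE ([] : Circuit W) 0 := fun _ _ hd w => hd w

theorem depthStep_le {W : Type} [DecidableEq W] {g : Gate W} {d : W → ℕ} {D : ℕ}
    (hd : ∀ w, d w ≤ D) (w : W) : depthStep d g w ≤ D + 1 := by
  unfold depthStep
  split_ifs
  · exact Nat.succ_le_succ (Finset.sup_le fun u _ => hd u)
  · exact (hd w).trans (Nat.le_succ D)

theorem depthLE_length {W : Type} [DecidableEq W] (c : Circuit W) : DepthLE c c.length := by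
  induction c with
  | nil => exact depthLE_nil
  | cons g c ih =>
    intro D d hd w
    have := ih (D + 1) (depthStep d g) (fun w => depthStep_le hd w) w
    rw [List.foldl_cons, List.length_cons]
    omega

/-- Gates on pairwise disjoint sets of wires form one layer. -/
theorem depthLE_one {W : Type} [DecidableEq W] {c : Circuit W}
    (h : c.Pairwise fun g g' => Disjoint g.wires g'.wires) : DepthLE c 1 := by
  intro D d hd
  have key : ∀ (c : Circuit W) (d : W → ℕ), (c.Pairwise fun g g' => Disjoint g.wires g'.wires) →
      (∀ w, d w ≤ D + 1) → (∀ g ∈ c, ∀ w ∈ g.wires, d w ≤ D) →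
      ∀ w, c.foldl depthStep d w ≤ D + 1 := by
    intro c
    induction c with
    | nil => intro d _ hd _ w; exact hd w
    | cons g c ih =>
      intro d hp hd hg w
      rw [List.pairwise_cons] at hp
      refine ih (depthStep d g) hp.2 (fun w => ?_) (fun g' hg' u hu => ?_) w
      · unfold depthStep
        split_ifs
        · exact Nat.succ_le_succ
            (Finset.sup_le fun u hu => hg g List.mem_cons_self u hu)
        · exact hd w
      · unfold depthStep
        rw [if_neg fun hu' => (disjoint_left.1 (hp.1 g' hg')) hu' hu]
        exact hg g' (List.mem_cons_of_mem _ hg') u hu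
  exact key c d h (fun w => (hd w).trans (Nat.le_succ D)) (fun _ _ w _ => hd w)

/-! ### Classical gates -/

/-- The map on basis states of a controlled-NOT or controlled-SWAP gate. -/
def Gate.act {W : Type} [DecidableEq W] : Gate W → Bits W → Bits W
  | .had _, x => x
  | .cnot c q _, x => Function.update x q (x q + x c)
  | .cswap c p q _ _ _, x => if x c = 1 then fun w => x (Equiv.swap p q w) else x

/-- The gate permutes the basis states. -/
def Gate.IsClassical {W : Type} : Gate W → Prop
  | .had _ => False
  | _ => True

theorem Circuit.run_append {W : Type} [DecidableEq W] (c c' : Circuit W) (v : Amp W) :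
    Circuit.run (c ++ c') v = Circuit.run c' (Circuit.run c v) := List.foldl_append

theorem Circuit.run_classical {W : Type} [DecidableEq W] (c : Circuit W)
    (h : ∀ g ∈ c, g.IsClassical) (v : Amp W) (x : Bits W) :
    Circuit.run c v x = v (c.foldr Gate.act x) := by
  induction c generalizing v with
  | nil => rfl
  | cons g c ih =>
    have hg := h g List.mem_cons_self
    rw [show Circuit.run (g :: c) v = Circuit.run c (g.apply v) from rfl,
      ih (fun g' hg' => h g' (List.mem_cons_of_mem _ hg')), List.foldr_cons]
    cases g with
    | had q => exact hg.elim
    | cnot => rfl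
    | cswap => rfl

theorem Gate.act_of_notMem {W : Type} [DecidableEq W] (g : Gate W) (x : Bits W) {w : W}
    (hw : w ∉ g.wires) : g.act x w = x w := by
  cases g with
  | had q => rfl
  | cnot c q h =>
    simp only [Gate.wires, mem_insert, mem_singleton, not_or] at hw
    exact Function.update_of_ne hw.2 _ _
  | cswap c p q h1 h2 h3 =>
    simp only [Gate.wires, mem_insert, mem_singleton, not_or] at hw
    change (if x c = 1 then fun w => x (Equiv.swap p q w) else x) w = x w
    split_ifs
    · exact congrArg x (Equiv.swap_apply_of_ne_of_ne hw.2.1 hw.2.2)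
    · rfl

theorem Gate.act_congr {W : Type} [DecidableEq W] (g : Gate W) {x x' : Bits W}
    (h : ∀ w ∈ g.wires, x w = x' w) {w : W} (hw : x w = x' w) : g.act x w = g.act x' w := by
  cases g with
  | had q => exact hw
  | cnot c q hcq =>
    simp only [Gate.wires, mem_insert, mem_singleton, forall_eq_or_imp, forall_eq] at h
    simp only [Gate.act, h.1, h.2, Function.update_apply, hw]
  | cswap c p q h1 h2 h3 =>
    simp only [Gate.wires, mem_insert, mem_singleton, forall_eq_or_imp, forall_eq] at h
    simp only [Gate.act, h.1]
    split_ifs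
    · change x (Equiv.swap p q w) = x' (Equiv.swap p q w)
      by_cases hp : w = p
      · rw [hp, Equiv.swap_apply_left, h.2.2]
      · by_cases hq : w = q
        · rw [hq, Equiv.swap_apply_right, h.2.1]
        · rw [Equiv.swap_apply_of_ne_of_ne hp hq, hw]
    · exact hw

theorem Gate.act_act {W : Type} [DecidableEq W] (g : Gate W) (x : Bits W) :
    g.act (g.act x) = x := by
  have h2 : ∀ a b : ZMod 2, a + b + b = a := by decide
  cases g with
  | had q => rfl
  | cnot c q h => simp [Gate.act, Function.update_of_ne h, h2]
  | cswap c p q h1 h2 h3 =>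
    by_cases hc : x c = 1
    · simp [Gate.act, hc, Equiv.swap_apply_of_ne_of_ne h1 h2]
    · simp [Gate.act, hc]

theorem foldr_act_foldr_act_reverse {W : Type} [DecidableEq W] (c : Circuit W) (x : Bits W) :
    c.foldr Gate.act (c.reverse.foldr Gate.act x) = x := by
  induction c generalizing x with
  | nil => rfl
  | cons g c ih =>
    rw [List.reverse_cons, List.foldr_append, List.foldr_cons, ih]
    exact g.act_act x

theorem foldr_act_of_notMem {W : Type} [DecidableEq W] (c : Circuit W) (x : Bits W) {w : W}
    (hw : ∀ g ∈ c, w ∉ g.wires) : c.foldr Gate.act x w = x w := by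
  induction c with
  | nil => rfl
  | cons g c ih =>
    rw [List.foldr_cons, g.act_of_notMem _ (hw g List.mem_cons_self),
      ih fun g' hg' => hw g' (List.mem_cons_of_mem _ hg')]

theorem foldr_act_congr {W : Type} [DecidableEq W] (c : Circuit W) (P : W → Prop)
    (hP : ∀ g ∈ c, ∀ w ∈ g.wires, P w) {x x' : Bits W} (h : ∀ w, P w → x w = x' w) {w : W}
    (hw : P w) : c.foldr Gate.act x w = c.foldr Gate.act x' w := by
  induction c generalizing w with
  | nil => exact h w hw
  | cons g c ih =>
    have ih' := fun w hw => @ih (fun g' hg' => hP g' (List.mem_cons_of_mem _ hg')) w hw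
    exact g.act_congr (fun w hw => ih' w (hP g List.mem_cons_self w hw)) (ih' w hw)

/-- The gates of a layer act independently. -/
theorem foldr_act_of_mem {W : Type} [DecidableEq W] {c : Circuit W}
    (h : c.Pairwise fun g g' => Disjoint g.wires g'.wires) (x : Bits W) {g : Gate W} (hg : g ∈ c)
    {w : W} (hw : w ∈ g.wires) : c.foldr Gate.act x w = g.act x w := by
  induction c with
  | nil => simp at hg
  | cons g' c ih =>
    rw [List.pairwise_cons] at h
    rw [List.foldr_cons]
    rcases List.mem_cons.1 hg with rfl | hg'
    · have hc : ∀ u ∈ g.wires, c.foldr Gate.act x u = x u := fun u hu =>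
        foldr_act_of_notMem c x fun g'' hg'' hu' => disjoint_left.1 (h.1 g'' hg'') hu hu'
      exact g.act_congr hc (hc w hw)
    · rw [g'.act_of_notMem _ fun hw' => disjoint_left.1 (h.1 g hg') hw' hw, ih h.2 hg']

/-- What a controlled-NOT adds to the wire `w`, when the string on the controls is `x`. -/
def Gate.addend {W : Type} [DecidableEq W] (x : Bits W) (w : W) : Gate W → ZMod 2
  | .cnot c q _ => if q = w then x c else 0
  | _ => 0

/-- Controlled-NOT gates whose targets are never controls add up. -/
theorem foldr_act_cnot {W : Type} [DecidableEq W] (c : Circuit W) (P : W → Prop)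
    (hc : ∀ g ∈ c, ∃ a b h, g = .cnot a b h ∧ P a ∧ ¬ P b) (x : Bits W) (w : W) :
    c.foldr Gate.act x w = x w + (c.map (Gate.addend x w)).sum := by
  induction c generalizing w with
  | nil => simp
  | cons g c ih =>
    obtain ⟨a, b, h, rfl, ha, hb⟩ := hc g List.mem_cons_self
    have hc' : ∀ g ∈ c, ∃ a b h, g = .cnot a b h ∧ P a ∧ ¬ P b :=
      fun g' hg' => hc g' (List.mem_cons_of_mem _ hg')
    have hA : c.foldr Gate.act x a = x a := by
      refine (ih hc' a).trans ?_
      rw [List.sum_eq_zero, add_zero]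
      intro t ht
      obtain ⟨g', hg', rfl⟩ := List.mem_map.1 ht
      obtain ⟨a', b', h', rfl, _, hb'⟩ := hc' g' hg'
      exact if_neg fun e : b' = a => hb' (e ▸ ha)
    rw [List.foldr_cons, List.map_cons, List.sum_cons]
    simp only [Gate.act, Gate.addend, Function.update_apply, hA]
    by_cases hw : w = b
    · subst hw
      rw [if_pos rfl, if_pos rfl, ih hc']
      ring
    · rw [if_neg hw, if_neg (Ne.symm hw), zero_add, ih hc']

/-! ### Hadamard gates -/

/-- Hadamard gates on qubits in the state zero create uniform superpositions. -/
theorem run_map_had_of_zero {W : Type} [DecidableEq W] (qs : List W) (hqs : qs.Nodup) (v : Amp W)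
    (hv : ∀ x q, q ∈ qs → x q ≠ 0 → v x = 0) (x y : Bits W) (hy0 : ∀ w ∈ qs, y w = 0)
    (hy : ∀ w, w ∉ qs → y w = x w) :
    Circuit.run (qs.map Gate.had) v x = ((1 / √2 : ℝ) : ℂ) ^ qs.length * v y := by
  induction qs generalizing v y with
  | nil => rw [show y = x from funext fun w => hy w List.not_mem_nil]; simp [Circuit.run]
  | cons q qs ih =>
    rw [List.nodup_cons] at hqs
    have h2 : ∀ f : ZMod 2 → ℂ, ∑ b, f b = f 0 + f 1 := Fin.sum_univ_two
    have hhad : ∀ y, (Gate.had q).apply v y =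
        ((1 / √2 : ℝ) : ℂ) * v (Function.update y q 0) := by
      intro y
      simp only [Gate.apply]
      rw [h2, hv (Function.update y q 1) q List.mem_cons_self (by simp)]
      simp
    have hne : ∀ p ∈ qs, p ≠ q := fun p hp e => hqs.1 (e ▸ hp)
    rw [List.map_cons, show Circuit.run (Gate.had q :: qs.map Gate.had) v =
      Circuit.run (qs.map Gate.had) ((Gate.had q).apply v) from rfl,
      ih hqs.2 _ ?_ (Function.update y q (x q))]
    · rw [hhad, List.length_cons, pow_succ, mul_assoc, Function.update_idem,
        ← hy0 q List.mem_cons_self, Function.update_eq_self]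
    · intro w hw
      rw [Function.update_of_ne (hne w hw), hy0 w (List.mem_cons_of_mem _ hw)]
    · intro w hw
      by_cases hwq : w = q
      · rw [hwq, Function.update_self]
      · rw [Function.update_of_ne hwq, hy w (by simp [hwq, hw])]
    · intro y p hp hy
      rw [hhad, hv _ p (List.mem_cons_of_mem _ hp) (by rwa [Function.update_of_ne (hne p hp)]),
        mul_zero]

theorem sum_sum_update {W : Type} [Fintype W] [DecidableEq W] (q : W) (c : ZMod 2)
    (f : Bits W → ℂ) :
    ∑ z, (if z q = c then ∑ b : ZMod 2, f (Function.update z q b) else 0) = ∑ z, f z := by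
  rw [← sum_filter, ← sum_product' _ _ (fun z b => f (Function.update z q b))]
  refine sum_bij' (fun p _ => Function.update p.1 q p.2)
    (fun z _ => (Function.update z q c, z q)) (fun _ _ => mem_univ _) (fun z _ => ?_)
    (fun p hp => ?_) (fun z _ => ?_) (fun _ _ => rfl)
  · simp
  · have : p.1 q = c := by simpa using hp
    refine Prod.ext ?_ ?_
    · simp [← this]
    · simp
  · simp

/-- Hadamard gates on distinct qubits: a sum over the strings that agree with `x` on the others. -/
theorem run_map_had {W : Type} [Fintype W] [DecidableEq W] (qs : List W) (hqs : qs.Nodup)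
    (v : Amp W) (x : Bits W) :
    Circuit.run (qs.map Gate.had) v x =
      ∑ z : Bits W, if ∀ w, w ∉ qs → z w = x w then
        (qs.map fun q => (-1 : ℂ) ^ (x q * z q).val / (√2 : ℝ)).prod * v z else 0 := by
  induction qs generalizing v with
  | nil =>
    rw [sum_eq_single x]
    · simp [Circuit.run]
    · intro z _ hz
      rw [if_neg fun h => hz (funext fun w => h w (by simp))]
    · simp
  | cons q qs ih =>
    rw [List.nodup_cons] at hqs
    rw [List.map_cons, show Circuit.run (Gate.had q :: qs.map Gate.had) v =
      Circuit.run (qs.map Gate.had) ((Gate.had q).apply v) from rfl, ih hqs.2,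
      ← sum_sum_update q (x q) (fun z => if ∀ w, w ∉ q :: qs → z w = x w then _ else 0)]
    refine sum_congr rfl fun z _ => ?_
    by_cases hz : z q = x q
    · rw [if_pos hz]
      have hiff : (∀ w, w ∉ qs → z w = x w) ↔
          ∀ b, ∀ w, w ∉ q :: qs → Function.update z q b w = x w := by
        constructor
        · intro h b w hw
          rw [List.mem_cons, not_or] at hw
          rw [Function.update_of_ne hw.1]
          exact h w hw.2
        · intro h w hw
          by_cases hwq : w = q
          · rw [hwq, hz]
          · have := h 0 w (by simp [hwq, hw])
            rwa [Function.update_of_ne hwq] at this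
      by_cases h : ∀ w, w ∉ qs → z w = x w
      · rw [if_pos h]
        simp only [Gate.apply]
        rw [mul_sum]
        refine sum_congr rfl fun b _ => ?_
        rw [if_pos (hiff.1 h b), List.map_cons, List.prod_cons, Function.update_self, hz]
        have : (qs.map fun p => (-1 : ℂ) ^ (x p * Function.update z q b p).val / (√2 : ℝ)) =
            qs.map fun p => (-1 : ℂ) ^ (x p * z p).val / (√2 : ℝ) := by
          refine List.map_congr_left fun p hp => ?_
          rw [Function.update_of_ne fun e : p = q => hqs.1 (e ▸ hp)]
        rw [this]
        ring
      · rw [if_neg h]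
        symm
        refine sum_eq_zero fun b _ => if_neg fun hb => h fun w hw => ?_
        by_cases hwq : w = q
        · rw [hwq, hz]
        · have := hb w (by simp [hwq, hw])
          rwa [Function.update_of_ne hwq] at this
    · rw [if_neg hz, if_neg fun h => hz (h q hqs.1)]

/-! ### The Fourier-sampling circuit -/

/-- The `j`-th qubit of the group register. -/
abbrev grp {n m a : ℕ} (j : Fin n) : Wire n m a := .inl j

/-- The `j`-th qubit of copy `b` in pair `i`. -/
abbrev cpy {n m a : ℕ} (i : Fin m) (b : ZMod 2) (j : Fin n) : Wire n m a := .inr (.inl ((i, b), j))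

/-- The ancilla that holds the `j`-th bit of the group register for the use of pair `i`. -/
abbrev anc {n m : ℕ} (i : Fin m) (j : Fin n) : Wire n m (m * n) :=
  .inr (.inr (finProdFinEquiv (i, j)))

theorem anc_inj {n m : ℕ} {i i' : Fin m} {j j' : Fin n} : anc i j = anc i' j' ↔ i = i' ∧ j = j' := by
  simp [anc, Prod.ext_iff]

/-- Hadamard gates on the free coordinates. -/
def hadFree {n : ℕ} (m : ℕ) (G : Fin n → Bits (Fin n)) : Circuit (Wire n m (m * n)) :=
  ((List.finRange n).filter fun q => G q q = 1).map fun q => .had (grp q)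

/-- Every free coordinate is added to the others that its row contains. -/
def spread {n : ℕ} (m : ℕ) (G : Fin n → Bits (Fin n)) : Circuit (Wire n m (m * n)) :=
  (List.finRange n).flatMap fun q => (List.finRange n).flatMap fun j =>
    if h : G q q = 1 ∧ G q j = 1 ∧ q ≠ j then
      [.cnot (grp q) (grp j) fun e => h.2.2 (Sum.inl_injective e)] else []

theorem withAncillas_of_forall {n m a : ℕ} (Φ : Joint n m) {x : Bits (Wire n m a)}
    (h : ∀ k, x (.inr (.inr k)) = 0) :
    withAncillas a Φ x = Φ (fun j => x (.inl j)) (fun q => x (.inr (.inl q))) := if_pos h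

theorem withAncillas_of_not_forall {n m a : ℕ} (Φ : Joint n m) {x : Bits (Wire n m a)}
    (h : ¬ ∀ k, x (.inr (.inr k)) = 0) : withAncillas a Φ x = 0 := if_neg h

theorem run_hadFree {n m : ℕ} (G : Fin n → Bits (Fin n)) (f : Amp (CopyQubit n m))
    (x : Bits (Wire n m (m * n))) :
    Circuit.run (hadFree m G) (withAncillas (m * n) fun z w => if z = 0 then f w else 0) x =
      withAncillas (m * n) (fun z w => if ∀ j, G j j ≠ 1 → z j = 0 then
        ((1 / √2 : ℝ) : ℂ) ^ #(freeSet G) * f w else 0) x := by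
  set L : List (Wire n m (m * n)) :=
    ((List.finRange n).filter fun q => G q q = 1).map grp with hL
  have hl : hadFree m G = L.map Gate.had := by
    rw [hadFree, hL, List.map_map]; rfl
  have hnd : ((List.finRange n).filter fun q => G q q = 1).Nodup :=
    (List.nodup_finRange n).filter _
  have hlen : L.length = #(freeSet G) := by
    rw [hL, List.length_map, ← List.toFinset_card_of_nodup hnd]
    congr 1
    ext q
    simp [freeSet]
  have hLnd : L.Nodup := hnd.map Sum.inl_injective
  have hg : ∀ j : Fin n, (.inl j : Wire n m (m * n)) ∈ L ↔ G j j = 1 := by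
    intro j
    simp [hL]
  have hr : ∀ u : CopyQubit n m ⊕ Fin (m * n), (Sum.inr u : Wire n m (m * n)) ∉ L := by
    intro u
    simp [hL]
  rw [hl, run_map_had_of_zero L hLnd _ ?_ x
    (Sum.elim (fun j => if G j j = 1 then 0 else x (.inl j)) fun u => x (.inr u)), hlen]
  · by_cases ha : ∀ k, x (.inr (.inr k)) = 0
    · rw [withAncillas_of_forall _ ha, withAncillas_of_forall]
      · have hiff : ((fun j : Fin n => if G j j = 1 then 0 else x (.inl j)) = 0) ↔
            ∀ j, G j j ≠ 1 → x (.inl j) = 0 := by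
          rw [funext_iff]
          refine forall_congr' fun j => ?_
          by_cases hj : G j j = 1 <;> simp [hj]
        by_cases h : ∀ j, G j j ≠ 1 → x (.inl j) = 0
        · rw [if_pos h]
          exact congrArg _ (if_pos (hiff.2 h))
        · rw [if_neg h]
          exact (congrArg _ (if_neg fun h' => h (hiff.1 h'))).trans (mul_zero _)
      · exact ha
    · rw [withAncillas_of_not_forall _ ha, withAncillas_of_not_forall, mul_zero]
      exact ha
  · rintro (j | u) hw
    · exact if_pos ((hg j).1 hw)
    · exact absurd hw (hr u)
  · rintro (j | u) hw
    · exact if_neg fun h => hw ((hg j).2 h)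
    · rfl
  · intro y w hw hy
    obtain ⟨q, -, rfl⟩ := List.mem_map.1 hw
    simp only [withAncillas]
    split_ifs with h1 h2
    · exact absurd (congrFun h2 q) hy
    · rfl
    · rfl

theorem sum_map_flatMap {α β : Type} (l : List α) (f : α → List β) (g : β → ZMod 2) :
    ((l.flatMap f).map g).sum = (l.map fun a => ((f a).map g).sum).sum := by
  induction l with
  | nil => rfl
  | cons a l ih => simp [List.flatMap_cons, ih]

theorem foldr_spread {n m : ℕ} {G : Fin n → Bits (Fin n)}
    {ys : List (Bits (Fin n))} (h : IsReduced G ys) (x : Bits (Wire n m (m * n))) :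
    (∀ j, (spread m G).foldr Gate.act x (.inl j) =
      x (.inl j) + ∑ q, if G q q = 1 ∧ G q j = 1 ∧ q ≠ j then x (.inl q) else 0) ∧
    ∀ u, (spread m G).foldr Gate.act x (.inr u) = x (.inr u) := by
  have hc : ∀ g ∈ spread m G, ∃ a b e, g = .cnot a b e ∧
      (∃ q, a = grp q ∧ G q q = 1) ∧ ¬ ∃ q, b = grp q ∧ G q q = 1 := by
    intro g hg
    simp only [spread, List.mem_flatMap, List.mem_finRange, true_and] at hg
    obtain ⟨q, j, hg⟩ := hg
    split_ifs at hg with hq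
    · rw [List.mem_singleton] at hg
      refine ⟨_, _, _, hg, ⟨q, rfl, hq.1⟩, ?_⟩
      rintro ⟨j', e, hj'⟩
      rw [← Sum.inl_injective e] at hj'
      rw [h.col q j hj' hq.2.2] at hq
      exact zero_ne_one hq.2.1
    · simp at hg
  have hsum : ∀ w, (spread m G).foldr Gate.act x w = x w + ∑ q, ∑ j,
      if G q q = 1 ∧ G q j = 1 ∧ q ≠ j then (if grp j = w then x (.inl q) else 0) else 0 := by
    intro w
    rw [foldr_act_cnot _ _ hc, spread, sum_map_flatMap, Fin.sum_univ_def]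
    congr 3
    funext q
    rw [sum_map_flatMap, Fin.sum_univ_def]
    congr 2
    funext j
    split_ifs <;> simp_all [Gate.addend]
  constructor
  · intro j
    rw [hsum]
    congr 1
    refine sum_congr rfl fun q _ => ?_
    rw [sum_eq_single j]
    · simp
    · intro j' _ hj'
      simp [hj']
    · simp
  · intro u
    rw [hsum]
    simp

theorem run_prepare {n m : ℕ} {G : Fin n → Bits (Fin n)}
    {ys : List (Bits (Fin n))} (h : IsReduced G ys) (f : Amp (CopyQubit n m)) :
    Circuit.run (hadFree m G ++ spread m G)
        (withAncillas (m * n) fun z w => if z = 0 then f w else 0) =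
      withAncillas (m * n) fun z w => uniformState (orth ys) z * f w := by
  funext x
  have hcl : ∀ g ∈ spread m G, g.IsClassical := by
    intro g hg
    simp only [spread, List.mem_flatMap, List.mem_finRange, true_and] at hg
    obtain ⟨q, j, hg⟩ := hg
    split_ifs at hg with hq
    · rw [List.mem_singleton.1 hg]; trivial
    · simp at hg
  rw [Circuit.run_append, Circuit.run_classical _ hcl, run_hadFree]
  obtain ⟨h1, h2⟩ := foldr_spread h x
  simp only [withAncillas, h2]
  by_cases ha : ∀ k, x (.inr (.inr k)) = 0
  swap
  · rw [if_neg ha, if_neg ha]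
  rw [if_pos ha, if_pos ha]
  have hadd : ∀ a b : ZMod 2, a + b = 0 ↔ b = a := by decide
  have hiff : (∀ j, G j j ≠ 1 → (spread m G).foldr Gate.act x (.inl j) = 0) ↔
      (fun j => x (.inl j)) ∈ orth ys := by
    rw [h.mem_orth_iff, funext_iff]
    refine forall_congr' fun j => ?_
    by_cases hj : G j j = 1
    · simp only [hj, ne_eq, not_true, false_imp_iff, true_iff]
      exact h.sum_smul_apply (fun j => x (.inl j)) hj
    · simp only [ne_eq, hj, not_false_iff, true_imp_iff]
      rw [h1, hadd, Finset.sum_apply]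
      have : ∑ q, (if G q q = 1 ∧ G q j = 1 ∧ q ≠ j then x (.inl q) else 0) =
          ∑ q, (x (.inl q) • G q) j := by
        refine sum_congr rfl fun q _ => ?_
        rw [Pi.smul_apply, smul_eq_mul]
        rcases zmod_two_cases (G q j) with h0 | h0
        · simp [h0]
        · have hq : G q q = 1 := (zmod_two_cases _).resolve_left fun hz => by
            rw [h.row q hz] at h0; exact zero_ne_one h0
          have hne : q ≠ j := fun e => hj (e ▸ hq)
          simp [h0, hq, hne]
      rw [this]
  simp only [uniformState]
  by_cases hz : (fun j => x (.inl j)) ∈ orth ys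
  · rw [if_pos (hiff.2 hz), if_pos hz]
    congr 1
    rw [h.card_orth, ← Complex.ofReal_pow]
    congr 1
    push_cast
    rw [show (2 : ℝ) ^ #(freeSet G) = √2 ^ #(freeSet G) * √2 ^ #(freeSet G) by
      rw [← mul_pow, Real.mul_self_sqrt (by norm_num)], Real.sqrt_mul_self (by positivity),
      div_pow, one_pow]
  · rw [if_neg fun h => hz (hiff.1 h), if_neg hz, zero_mul]

/-! ### Fanning out the group register -/

/-- The pair from whose ancillas those of pair `i` are copied: `i` without its leading binary
digit. -/
def fanParent (i : ℕ) : ℕ := i - 2 ^ Nat.log 2 i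

theorem fanParent_lt {i : ℕ} (hi : i ≠ 0) : fanParent i < i :=
  Nat.sub_lt (Nat.pos_of_ne_zero hi) (by positivity)

/-- The source of the ancilla `anc i j`. -/
def fanSource {n m : ℕ} (i : Fin m) (j : Fin n) : Wire n m (m * n) :=
  if h : (i : ℕ) = 0 then grp j else anc ⟨fanParent i, (fanParent_lt h).trans i.2⟩ j

theorem fanSource_ne {n m : ℕ} (i : Fin m) (j j' : Fin n) : fanSource i j ≠ anc i j' := by
  unfold fanSource
  split_ifs with h
  · simp
  · rw [Ne, anc_inj]
    exact fun e => (fanParent_lt h).ne (congrArg Fin.val e.1)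

/-- The copying gates for pair `i`. -/
def fanRow {n m : ℕ} (i : ℕ) : Circuit (Wire n m (m * n)) :=
  if h : i < m then (List.finRange n).map fun j =>
    .cnot (fanSource ⟨i, h⟩ j) (anc ⟨i, h⟩ j) (fanSource_ne _ _ _) else []

/-- The gates that copy the group register for the pairs before the `k`-th. -/
def fan {n m : ℕ} (k : ℕ) : Circuit (Wire n m (m * n)) := (List.range k).flatMap fanRow

theorem fan_succ {n m : ℕ} (k : ℕ) : (fan (k + 1) : Circuit (Wire n m (m * n))) =
    fan k ++ fanRow k := by
  simp [fan, List.range_succ, List.flatMap_append]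

theorem mem_fan {n m k : ℕ} {g : Gate (Wire n m (m * n))} (hg : g ∈ fan k) :
    ∃ (i : Fin m) (j : Fin n), g = .cnot (fanSource i j) (anc i j) (fanSource_ne _ _ _) := by
  obtain ⟨i, -, hi⟩ := List.mem_flatMap.1 hg
  unfold fanRow at hi
  split_ifs at hi with h
  · obtain ⟨j, -, rfl⟩ := List.mem_map.1 hi
    exact ⟨_, j, rfl⟩
  · simp at hi

theorem foldr_fanRow {n m : ℕ} (i : Fin m) (x : Bits (Wire n m (m * n)))
    (w : Wire n m (m * n)) :
    ((fanRow i).reverse).foldr Gate.act x w =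
      x w + ∑ j, if anc i j = w then x (fanSource i j) else 0 := by
  rw [foldr_act_cnot _ (fun w => ∀ j, w ≠ anc i j), List.map_reverse, List.sum_reverse, fanRow,
    dif_pos i.2, List.map_map, Fin.sum_univ_def]
  · rfl
  · intro g hg
    rw [List.mem_reverse, fanRow, dif_pos i.2] at hg
    obtain ⟨j, -, rfl⟩ := List.mem_map.1 hg
    exact ⟨_, _, _, rfl, fun j' => fanSource_ne _ _ _, fun h => h j rfl⟩

theorem foldr_act_cnot_of_ne {W : Type} [DecidableEq W] (c : Circuit W) (w : W)
    (hc : ∀ g ∈ c, ∃ a b h, g = .cnot a b h ∧ b ≠ w) (x : Bits W) :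
    c.foldr Gate.act x w = x w := by
  induction c with
  | nil => rfl
  | cons g c ih =>
    obtain ⟨a, b, h, rfl, hb⟩ := hc g List.mem_cons_self
    rw [List.foldr_cons, ← ih fun g' hg' => hc g' (List.mem_cons_of_mem _ hg')]
    exact Function.update_of_ne hb.symm _ _

theorem foldr_fan_grp {n m : ℕ} (k : ℕ) (x : Bits (Wire n m (m * n))) (j : Fin n) :
    (fan k).reverse.foldr Gate.act x (.inl j) = x (.inl j) := by
  refine foldr_act_cnot_of_ne _ _ (fun g hg => ?_) x
  obtain ⟨i, j', rfl⟩ := mem_fan (List.mem_reverse.1 hg)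
  exact ⟨_, _, _, rfl, by simp⟩

/-- The fan-out fills ancillas in the state zero with copies of the group register. -/
theorem foldr_fan_anc {n m : ℕ} (k : ℕ) (hk : k ≤ m) (x : Bits (Wire n m (m * n)))
    (hx : ∀ a, x (.inr (.inr a)) = 0) (i : Fin m) (j : Fin n) :
    (fan k).reverse.foldr Gate.act x (anc i j) = if (i : ℕ) < k then x (.inl j) else 0 := by
  induction k generalizing i j with
  | zero => exact hx _
  | succ k ih =>
    have ih' := ih (by omega)
    rw [fan_succ, List.reverse_append, List.foldr_append,
      show (fanRow k : Circuit (Wire n m (m * n))) =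
        fanRow ((⟨k, by omega⟩ : Fin m) : ℕ) from rfl, foldr_fanRow, ih']
    by_cases hik : (i : ℕ) = k
    · have e : i = ⟨k, by omega⟩ := Fin.ext hik
      rw [if_neg (by omega), if_pos (by omega), zero_add, sum_eq_single j]
      · rw [if_pos (by rw [e]), fanSource]
        split_ifs with h0
        · exact foldr_fan_grp k x j
        · rw [ih', if_pos]
          exact fanParent_lt h0
      · intro j' _ hj'
        exact if_neg fun e' => hj' (anc_inj.1 e').2
      · simp
    · rw [sum_eq_zero, add_zero]
      · by_cases h : (i : ℕ) < k
        · rw [if_pos h, if_pos (by omega)]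
        · rw [if_neg h, if_neg (by omega)]
      · intro j' _
        exact if_neg fun e' => hik (congrArg Fin.val (anc_inj.1 e').1).symm

/-- The controlled swaps, pair `i` being controlled by its own copy of the group register. -/
def swaps {n m : ℕ} : Circuit (Wire n m (m * n)) :=
  (List.finRange m).flatMap fun i => (List.finRange n).map fun j =>
    .cswap (anc i j) (cpy i 0 j) (cpy i 1 j) (by simp) (by simp) (by simp)

theorem pairwise_swaps {n m : ℕ} : (swaps : Circuit (Wire n m (m * n))).Pairwise
    fun g g' => Disjoint g.wires g'.wires := by
  rw [swaps, List.pairwise_flatMap]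
  constructor
  · intro i _
    rw [List.pairwise_map]
    refine (List.nodup_finRange n).imp fun {j j'} hj => ?_
    simp only [Gate.wires]
    simp [disjoint_left, hj]
  · refine (List.nodup_finRange m).imp fun {i i'} hi => ?_
    intro g hg g' hg'
    obtain ⟨j, -, rfl⟩ := List.mem_map.1 hg
    obtain ⟨j', -, rfl⟩ := List.mem_map.1 hg'
    simp only [Gate.wires]
    simp [disjoint_left, hi]

theorem mem_swaps {n m : ℕ} (i : Fin m) (j : Fin n) :
    (.cswap (anc i j) (cpy i 0 j) (cpy i 1 j) (by simp) (by simp) (by simp) :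
      Gate (Wire n m (m * n))) ∈ swaps :=
  List.mem_flatMap.2 ⟨i, List.mem_finRange i, List.mem_map.2 ⟨j, List.mem_finRange j, rfl⟩⟩

theorem foldr_swaps {n m : ℕ} (x : Bits (Wire n m (m * n))) (i : Fin m) (b : ZMod 2) (j : Fin n) :
    swaps.foldr Gate.act x (cpy i b j) = x (cpy i (b + x (anc i j)) j) ∧
    swaps.foldr Gate.act x (anc i j) = x (anc i j) ∧
    swaps.foldr Gate.act x (.inl j) = x (.inl j) := by
  have h11 : (1 + 1 : ZMod 2) = 0 := rfl
  refine ⟨?_, ?_, ?_⟩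
  · rw [foldr_act_of_mem pairwise_swaps x (mem_swaps i j)]
    · simp only [Gate.act]
      rcases zmod_two_cases (x (anc i j)) with h0 | h1
      · rw [h0, if_neg zero_ne_one, add_zero]
      · rw [h1, if_pos rfl]
        rcases zmod_two_cases b with rfl | rfl
        · rw [Equiv.swap_apply_left, zero_add]
        · rw [Equiv.swap_apply_right, h11]
    · rcases zmod_two_cases b with rfl | rfl <;> simp [Gate.wires]
  · rw [foldr_act_of_mem pairwise_swaps x (mem_swaps i j) (by simp [Gate.wires])]
    simp only [Gate.act]
    split_ifs
    · exact congrArg x (Equiv.swap_apply_of_ne_of_ne (by simp) (by simp))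
    · rfl
  · refine foldr_act_of_notMem _ _ fun g hg => ?_
    obtain ⟨i', -, hg⟩ := List.mem_flatMap.1 hg
    obtain ⟨j', -, rfl⟩ := List.mem_map.1 hg
    simp [Gate.wires]

/-- The controlled action: fan out the group register, swap, and undo the fan-out. -/
theorem run_controlledAction {n m : ℕ} (Φ : Joint n m) :
    Circuit.run (fan m ++ swaps ++ (fan m).reverse) (withAncillas (m * n) Φ) =
      withAncillas (m * n) (controlledAction Φ) := by
  funext x
  have hcl : ∀ g ∈ (fan m ++ swaps ++ (fan m).reverse : Circuit (Wire n m (m * n))),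
      g.IsClassical := by
    intro g hg
    simp only [List.mem_append, List.mem_reverse] at hg
    rcases hg with (hg | hg) | hg
    · obtain ⟨_, _, rfl⟩ := mem_fan hg; trivial
    · obtain ⟨i', -, hg⟩ := List.mem_flatMap.1 hg
      obtain ⟨j', -, rfl⟩ := List.mem_map.1 hg
      trivial
    · obtain ⟨_, _, rfl⟩ := mem_fan hg; trivial
  rw [Circuit.run_classical _ hcl, List.foldr_append, List.foldr_append]
  set Y := (fan m).reverse.foldr Gate.act x with hY
  set S := swaps.foldr Gate.act Y with hS
  set X := (fan m).foldr Gate.act S with hX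
  have hanc : ∀ a : Fin (m * n), ∃ i j, (Sum.inr (Sum.inr a) : Wire n m (m * n)) = anc i j := by
    intro a
    exact ⟨(finProdFinEquiv.symm a).1, (finProdFinEquiv.symm a).2,
      congrArg (fun a => Sum.inr (Sum.inr a)) (finProdFinEquiv.apply_symm_apply a).symm⟩
  have hfan : ∀ g ∈ (fan m : Circuit (Wire n m (m * n))), ∀ w ∈ g.wires, ∀ q, w ≠ .inr (.inl q) := by
    intro g hg w hw q
    obtain ⟨i, j, rfl⟩ := mem_fan hg
    rintro rfl
    simp only [Gate.wires, mem_insert, mem_singleton] at hw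
    rcases hw with hw | hw
    · unfold fanSource at hw
      split_ifs at hw
      simp at hw
    · simp at hw
  have hSY : ∀ w : Wire n m (m * n), (∀ q, w ≠ .inr (.inl q)) → S w = Y w := by
    intro w hw
    rcases w with j | q | a
    · by_cases hm : 0 < m
      · exact (foldr_swaps Y ⟨0, hm⟩ 0 j).2.2
      · obtain rfl : m = 0 := by omega
        rfl
    · exact absurd rfl (hw q)
    · obtain ⟨i, j, h⟩ := hanc a
      rw [h]
      exact (foldr_swaps Y i 0 j).2.1
  have hXx : ∀ w : Wire n m (m * n), (∀ q, w ≠ .inr (.inl q)) → X w = x w := by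
    intro w hw
    rw [hX, foldr_act_congr (fan m) (fun w => ∀ q, w ≠ .inr (.inl q)) hfan hSY hw, hY,
      foldr_act_foldr_act_reverse]
  have hXc : ∀ q, X (.inr (.inl q)) = S (.inr (.inl q)) := fun q =>
    foldr_act_of_notMem _ _ fun g hg hw => hfan g hg _ hw q rfl
  simp only [withAncillas]
  have h1 : ∀ a, X (.inr (.inr a)) = x (.inr (.inr a)) := fun a => hXx _ (by simp)
  have h2 : ∀ j, X (.inl j) = x (.inl j) := fun a => hXx _ (by simp)
  simp only [h1, h2]
  by_cases ha : ∀ k, x (.inr (.inr k)) = 0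
  · rw [if_pos ha, if_pos ha, controlledAction]
    congr 1
    funext ⟨⟨i, b⟩, j⟩
    rw [hXc]
    refine (foldr_swaps Y i b j).1.trans ?_
    rw [hY, foldr_fan_anc m le_rfl x ha, if_pos i.2]
    refine foldr_act_of_notMem _ _ fun g hg hw => hfan g (List.mem_reverse.1 hg) _ hw _ rfl
  · rw [if_neg ha, if_neg ha]

/-- Hadamard gates on the group register. -/
def hadAll (n m : ℕ) : Circuit (Wire n m (m * n)) :=
  (List.finRange n).map fun j => .had (grp j)

theorem neg_one_pow_val_sum {ι : Type} (s : Finset ι) (f : ι → ZMod 2) :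
    (-1 : ℂ) ^ (∑ i ∈ s, f i).val = ∏ i ∈ s, (-1) ^ (f i).val := by
  classical
  induction s using Finset.induction_on with
  | empty => simp
  | insert a s ha ih => rw [sum_insert ha, prod_insert ha, neg_one_pow_val_add, ih]

theorem run_hadAll {n m : ℕ} (Φ : Joint n m) :
    Circuit.run (hadAll n m) (withAncillas (m * n) Φ) = withAncillas (m * n) (hadamardGroup Φ) := by
  funext x
  have hl : hadAll n m = ((List.finRange n).map (grp (m := m) (a := m * n))).map Gate.had := by
    rw [hadAll, List.map_map]; rfl
  rw [hl, run_map_had _ ((List.nodup_finRange n).map Sum.inl_injective)]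
  have hoff : ∀ z : Bits (Wire n m (m * n)),
      (∀ w, w ∉ (List.finRange n).map (grp (m := m) (a := m * n)) → z w = x w) ↔
      ∀ u, z (.inr u) = x (.inr u) := by
    intro z
    constructor
    · intro h u
      exact h _ (by simp)
    · intro h w hw
      rcases w with j | u
      · simp at hw
      · exact h u
  simp only [hoff]
  rw [← sum_filter]
  have hsum : ∀ f : Bits (Wire n m (m * n)) → ℂ,
      ∑ z ∈ univ.filter (fun z : Bits (Wire n m (m * n)) => ∀ u, z (.inr u) = x (.inr u)), f z =
      ∑ z : Bits (Fin n), f (Sum.elim z fun u => x (.inr u)) := by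
    intro f
    refine sum_bij' (fun z _ j => z (.inl j)) (fun z _ => Sum.elim z fun u => x (.inr u))
      (fun _ _ => mem_univ _) (fun z _ => by simp) (fun z hz => ?_) (fun z _ => rfl)
      (fun z hz => ?_) <;>
    · have hz' := (mem_filter.1 hz).2
      have : (Sum.elim (fun j => z (.inl j)) fun u => x (.inr u)) = z := by
        funext w
        rcases w with j | u
        · rfl
        · exact (hz' u).symm
      rw [this]
  rw [hsum]
  simp only [withAncillas, Sum.elim_inl, Sum.elim_inr]
  by_cases ha : ∀ k, x (.inr (.inr k)) = 0
  · simp only [ha, implies_true, if_true]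
    rw [hadamardGroup]
    refine sum_congr rfl fun z _ => ?_
    congr 1
    rw [List.map_map, ← Fin.prod_univ_def]
    simp only [Function.comp_def, Sum.elim_inl]
    rw [prod_div_distrib, ← neg_one_pow_val_sum, prod_const, card_univ, Fintype.card_fin]
    congr 1
    rw [← Complex.ofReal_pow]
    congr 1
    rw [eq_comm, show (2 : ℝ) ^ n = √2 ^ n * √2 ^ n by
      rw [← mul_pow, Real.mul_self_sqrt (by norm_num)], Real.sqrt_mul_self (by positivity)]
  · simp only [ha, if_false, mul_zero, sum_const_zero]

/-- The circuit of one round. -/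
def samplingCircuit {n : ℕ} (m : ℕ) (G : Fin n → Bits (Fin n)) : Circuit (Wire n m (m * n)) :=
  (hadFree m G ++ spread m G) ++ (fan m ++ swaps ++ (fan m).reverse) ++ hadAll n m

theorem preparesFourierState_samplingCircuit {n : ℕ} (m : ℕ) {G : Fin n → Bits (Fin n)}
    {ys : List (Bits (Fin n))} (h : IsReduced G ys) :
    PreparesFourierState (samplingCircuit m G) (orth ys) := by
  intro ψ
  rw [samplingCircuit, Circuit.run_append, Circuit.run_append, run_prepare h,
    run_controlledAction, run_hadAll]
  rfl

/-! ### Depth of the Fourier-sampling circuit -/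

theorem fanParent_two_pow_add {l i : ℕ} (hi : i < 2 ^ l) : fanParent (2 ^ l + i) = i := by
  have : Nat.log 2 (2 ^ l + i) = l :=
    (Nat.log_eq_iff (Or.inr ⟨by norm_num, by positivity⟩)).2 ⟨by omega, by rw [pow_succ]; omega⟩
  rw [fanParent, this, Nat.add_sub_cancel_left]

theorem pairwise_fanRow {n m : ℕ} (i : ℕ) : (fanRow i : Circuit (Wire n m (m * n))).Pairwise
    fun g g' => Disjoint g.wires g'.wires := by
  unfold fanRow
  split_ifs with h
  · rw [List.pairwise_map]
    refine (List.nodup_finRange n).imp fun {j j'} hj => ?_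
    simp only [Gate.wires, fanSource]
    split_ifs <;> simp [disjoint_left, hj]
  · exact List.Pairwise.nil

/-- The gates with targets in one dyadic block have their sources before this block, so that each
block is one layer. -/
theorem pairwise_fan_block {n m : ℕ} (l : ℕ) :
    ((List.range (2 ^ l)).flatMap fun i => (fanRow (2 ^ l + i) : Circuit (Wire n m (m * n)))).Pairwise
      fun g g' => Disjoint g.wires g'.wires := by
  rw [List.pairwise_flatMap]
  refine ⟨fun i _ => pairwise_fanRow _, ?_⟩
  refine (List.nodup_range (n := 2 ^ l)).imp_of_mem fun {i i'} hi hi' hne => ?_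
  rw [List.mem_range] at hi hi'
  intro g hg g' hg'
  have hmem : ∀ i < 2 ^ l, ∀ g ∈ (fanRow (2 ^ l + i) : Circuit (Wire n m (m * n))),
      ∃ (a b : Fin m) (j : Fin n), (a : ℕ) = i ∧ (b : ℕ) = 2 ^ l + i ∧
        g.wires = {anc a j, anc b j} := by
    intro i hi g hg
    unfold fanRow at hg
    split_ifs at hg with h
    · obtain ⟨j, -, rfl⟩ := List.mem_map.1 hg
      refine ⟨⟨i, by omega⟩, ⟨2 ^ l + i, h⟩, j, rfl, rfl, ?_⟩
      have h0 : 2 ^ l + i ≠ 0 := by positivity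
      simp only [Gate.wires, fanSource, h0, dif_neg, not_false_iff, fanParent_two_pow_add hi]
    · simp at hg
  obtain ⟨a, b, j, ha, hb, h1⟩ := hmem i hi g hg
  obtain ⟨a', b', j', ha', hb', h2⟩ := hmem i' hi' g' hg'
  rw [h1, h2, disjoint_left]
  have e1 : a ≠ a' := fun e => hne (by rw [← ha, ← ha', e])
  have e2 : a ≠ b' := fun e => by have := congrArg Fin.val e; omega
  have e3 : b ≠ a' := fun e => by have := congrArg Fin.val e; omega
  have e4 : b ≠ b' := fun e => by have := congrArg Fin.val e; omega
  intro w hw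
  simp only [mem_insert, mem_singleton] at hw ⊢
  rcases hw with rfl | rfl <;> simp [e1, e2, e3, e4]

theorem List.Pairwise.reverse_disjoint {W : Type} [DecidableEq W] {c : Circuit W}
    (h : c.Pairwise fun g g' => Disjoint g.wires g'.wires) :
    c.reverse.Pairwise fun g g' => Disjoint g.wires g'.wires :=
  List.pairwise_reverse.2 (h.imp fun hd => hd.symm)

theorem depthLE_fan_two_pow {n m : ℕ} (l : ℕ) :
    DepthLE (fan (2 ^ l) : Circuit (Wire n m (m * n))) (l + 1) ∧
    DepthLE (fan (2 ^ l) : Circuit (Wire n m (m * n))).reverse (l + 1) := by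
  induction l with
  | zero =>
    have : (fan (2 ^ 0) : Circuit (Wire n m (m * n))) = fanRow 0 := by
      simp [fan]
    rw [this]
    exact ⟨depthLE_one (pairwise_fanRow 0),
      depthLE_one (List.Pairwise.reverse_disjoint (pairwise_fanRow 0))⟩
  | succ l ih =>
    have hs : (fan (2 ^ (l + 1)) : Circuit (Wire n m (m * n))) = fan (2 ^ l) ++
        (List.range (2 ^ l)).flatMap fun i => fanRow (2 ^ l + i) := by
      rw [fan, pow_succ, mul_two, List.range_add, List.flatMap_append, List.flatMap_map]
      rfl
    rw [hs, List.reverse_append]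
    refine ⟨ih.1.append (depthLE_one (pairwise_fan_block l)), ?_⟩
    exact ((depthLE_one (List.Pairwise.reverse_disjoint (pairwise_fan_block l))).append
      ih.2).mono (by omega)

theorem fan_of_le {n m k : ℕ} (hk : m ≤ k) : (fan k : Circuit (Wire n m (m * n))) = fan m := by
  induction k, hk using Nat.le_induction with
  | base => rfl
  | succ k hk ih => rw [fan_succ, ih, fanRow, dif_neg (by omega), List.append_nil]

theorem length_flatMap_le {α β : Type} (l : List α) (f : α → List β) (k : ℕ)
    (h : ∀ a, (f a).length ≤ k) : (l.flatMap f).length ≤ l.length * k := by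
  induction l with
  | nil => simp
  | cons a l ih =>
    rw [List.flatMap_cons, List.length_append, List.length_cons, add_mul, one_mul]
    have := h a
    omega

theorem depth_samplingCircuit_le {n : ℕ} (m : ℕ) (G : Fin n → Bits (Fin n)) :
    (samplingCircuit m G).depth ≤ n * n + 2 * n + 2 * Nat.clog 2 m + 3 := by
  have h1 : DepthLE (hadFree m G) n := (depthLE_length _).mono (by
    rw [hadFree, List.length_map]
    exact (List.length_filter_le _ _).trans (List.length_finRange).le)
  have h2 : DepthLE (spread m G) (n * n) := (depthLE_length _).mono (by
    refine (length_flatMap_le _ _ n fun q => ?_).trans (by rw [List.length_finRange])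
    refine (length_flatMap_le _ _ 1 fun j => ?_).trans (by rw [List.length_finRange, mul_one])
    split_ifs <;> simp)
  have hm : m ≤ 2 ^ Nat.clog 2 m := Nat.le_pow_clog (by norm_num) m
  have h3 := depthLE_fan_two_pow (n := n) (m := m) (Nat.clog 2 m)
  rw [fan_of_le hm] at h3
  have h4 : DepthLE (hadAll n m) n := (depthLE_length _).mono (by
    rw [hadAll, List.length_map, List.length_finRange])
  refine DepthLE.depth_le ((((h1.append h2).append
    ((h3.1.append (depthLE_one pairwise_swaps)).append h3.2)).append h4).mono ?_)
  omega

theorem clog_pairs_le {ε : ℝ} (h0 : 0 < ε) (h1 : ε ≤ 1) :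
    (Nat.clog 2 (pairs ε) : ℝ) ≤ 2 + 4 * Real.log ε⁻¹ := by
  have hlog : 0 ≤ Real.log ε⁻¹ := Real.log_nonneg ((one_le_inv₀ h0).2 h1)
  rcases Nat.lt_or_ge 1 (pairs ε) with hm | hm
  · have h2 := Nat.pow_pred_clog_lt_self (b := 2) (by norm_num) hm
    have h3 : (pairs ε : ℝ) ≤ 2 * (ε⁻¹) ^ 2 := by
      have := (Nat.ceil_lt_add_one (by positivity : 0 ≤ 1 / ε ^ 2)).le
      have h4 : 1 ≤ 1 / ε ^ 2 := by
        rw [le_div_iff₀ (by positivity)]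
        nlinarith
      rw [inv_pow, ← one_div]
      exact this.trans (by linarith)
    have h4 : (2 : ℝ) ^ (Nat.clog 2 (pairs ε)).pred ≤ 2 * (ε⁻¹) ^ 2 := by
      refine le_trans ?_ h3
      exact_mod_cast h2.le
    have h5 := Real.log_le_log (by positivity) h4
    rw [Real.log_pow, Real.log_mul (by norm_num) (by positivity), Real.log_pow] at h5
    have h6 : (1 / 2 : ℝ) < Real.log 2 := by have := Real.log_two_gt_d9; linarith
    have h7 : (Nat.clog 2 (pairs ε) : ℝ) = (Nat.clog 2 (pairs ε)).pred + 1 := by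
      have : 0 < Nat.clog 2 (pairs ε) := Nat.clog_pos (by norm_num) hm
      have h8 : Nat.clog 2 (pairs ε) = (Nat.clog 2 (pairs ε)).pred + 1 :=
        (Nat.succ_pred_eq_of_pos this).symm
      exact_mod_cast h8
    rw [h7]
    push_cast at h5
    nlinarith
  · rw [Nat.clog_of_right_le_one hm]
    push_cast
    linarith

/-! ### Description of the circuit by numbers -/

/-- The code of a copying gate of the fan-out. -/
def fanCode (n m i j : ℕ) : List ℕ :=
  [2, if i = 0 then 0 else 2 * m + 1, n * fanParent i + j, 2 * m + 1, n * i + j]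

/-- The gates of the sampling circuit, when `g` holds the matrix `G`. -/
def circuitCodes (n m : ℕ) (g : ℕ → ℕ → ℕ) : List (List ℕ) :=
  ((List.range n).flatMap fun q => if g q q = 1 then [[1, 0, q]] else []) ++
  ((List.range n).flatMap fun q => (List.range n).flatMap fun j =>
    if g q q = 1 ∧ g q j = 1 ∧ q ≠ j then [[2, 0, q, 0, j]] else []) ++
  ((List.range m).flatMap fun i => (List.range n).flatMap fun j => [fanCode n m i j]) ++
  ((List.range m).flatMap fun i => (List.range n).flatMap fun j =>
    [[3, 2 * m + 1, n * i + j, 1 + 2 * i, j, 2 + 2 * i, j]]) ++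
  ((List.range m).flatMap fun i => (List.range n).flatMap fun j =>
    [fanCode n m (m - 1 - i) (n - 1 - j)]) ++
  ((List.range n).flatMap fun q => [[1, 0, q]])

theorem flatMap_finRange {α : Type} (n : ℕ) (f : ℕ → List α) :
    (List.finRange n).flatMap (fun q : Fin n => f (q : ℕ)) = (List.range n).flatMap f := by
  rw [← List.map_coe_finRange_eq_range, List.flatMap_map]

theorem map_eq_flatMap_singleton {α β : Type} (l : List α) (f : α → β) :
    l.map f = l.flatMap fun a => [f a] := by
  induction l with
  | nil => rfl
  | cons a l ih => rw [List.map_cons, List.flatMap_cons, ih]; rfl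

theorem map_filter_eq_flatMap {α β : Type} (l : List α) (p : α → Prop) [DecidablePred p]
    (f : α → β) : (l.filter p).map f = l.flatMap fun a => if p a then [f a] else [] := by
  induction l with
  | nil => rfl
  | cons a l ih =>
    rw [List.flatMap_cons, List.filter_cons]
    by_cases h : p a
    · simp [h, ih]
    · simp [h, ih]

theorem reverse_flatMap_range {α : Type} (m : ℕ) (f : ℕ → List α) :
    ((List.range m).flatMap f).reverse =
      (List.range m).flatMap fun i => (f (m - 1 - i)).reverse := by
  have h : (List.range m).reverse = (List.range m).map fun i => m - 1 - i := by
    rw [List.range_eq_range', List.reverse_range', ← List.range_eq_range', Nat.zero_add]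
  rw [List.reverse_flatMap, h, List.flatMap_map]
  rfl

theorem map_gateCode_fan {n m : ℕ} :
    (fan m : Circuit (Wire n m (m * n))).map gateCode =
      (List.range m).flatMap fun i => (List.range n).flatMap fun j => [fanCode n m i j] := by
  rw [fan, List.map_flatMap, ← flatMap_finRange, ← flatMap_finRange]
  congr 1
  funext i
  rw [fanRow, dif_pos i.2, List.map_map, ← flatMap_finRange, map_eq_flatMap_singleton]
  congr 1
  funext j
  simp only [Function.comp, fanSource, fanCode, gateCode]
  split_ifs with h
  · have h' : (i : ℕ) = 0 := h
    simp [wireCode, h', fanParent]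
  · simp [wireCode, add_comm]

theorem map_gateCode_samplingCircuit {n : ℕ} (m : ℕ) {G : Fin n → Bits (Fin n)} {g : ℕ → ℕ → ℕ}
    (hg : ∀ q j : Fin n, g q j = (G q j).val) :
    (samplingCircuit m G).map gateCode = circuitCodes n m g := by
  have hg1 : ∀ q j : Fin n, G q j = 1 ↔ g q j = 1 := by
    intro q j
    rw [hg]
    exact (show ∀ c : ZMod 2, c = 1 ↔ c.val = 1 by decide) _
  have e1 : (hadFree m G).map gateCode =
      (List.range n).flatMap fun q => if g q q = 1 then [[1, 0, q]] else [] := by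
    rw [hadFree, map_filter_eq_flatMap, List.map_flatMap, ← flatMap_finRange]
    congr 1
    funext q
    simp only [hg1]
    split_ifs <;> rfl
  have e2 : (spread m G).map gateCode =
      (List.range n).flatMap fun q => (List.range n).flatMap fun j =>
        if g q q = 1 ∧ g q j = 1 ∧ q ≠ j then [[2, 0, q, 0, j]] else [] := by
    rw [spread, List.map_flatMap, ← flatMap_finRange]
    congr 1
    funext q
    rw [List.map_flatMap, ← flatMap_finRange]
    congr 1
    funext j
    simp only [hg1, ne_eq, Fin.val_inj]
    split_ifs <;> rfl
  have e3 : (swaps : Circuit (Wire n m (m * n))).map gateCode =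
      (List.range m).flatMap fun i => (List.range n).flatMap fun j =>
        [[3, 2 * m + 1, n * i + j, 1 + 2 * i, j, 2 + 2 * i, j]] := by
    rw [swaps, List.map_flatMap, ← flatMap_finRange]
    congr 1
    funext i
    rw [List.map_map, ← flatMap_finRange, map_eq_flatMap_singleton]
    congr 1
    funext j
    have h1 : (1 : ZMod 2).val = 1 := rfl
    simp only [Function.comp, gateCode, wireCode, finProdFinEquiv_apply_val, ZMod.val_zero, h1]
    simp only [List.cons_append, List.nil_append, add_zero]
    rw [add_comm (j : ℕ), show 1 + 2 * (i : ℕ) + 1 = 2 + 2 * i by ring]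
  have e4 : ((fan m).reverse : Circuit (Wire n m (m * n))).map gateCode =
      (List.range m).flatMap fun i => (List.range n).flatMap fun j =>
        [fanCode n m (m - 1 - i) (n - 1 - j)] := by
    rw [List.map_reverse, map_gateCode_fan, reverse_flatMap_range]
    congr 1
    funext i
    rw [reverse_flatMap_range]
    rfl
  have e5 : (hadAll n m).map gateCode = (List.range n).flatMap fun q => [[1, 0, q]] := by
    rw [hadAll, List.map_map, ← flatMap_finRange, map_eq_flatMap_singleton]
    rfl
  simp only [samplingCircuit, List.map_append, e1, e2, e3, e4, e5, map_gateCode_fan, circuitCodes,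
    List.append_assoc]

theorem writesCircuit_iff_map {n m a : ℕ} (c : Circuit (Wire n m a)) (s : Mem) :
    WritesCircuit c s ↔ s 3 0 0 = a ∧ s 3 0 1 = (c.map gateCode).length ∧
      ∀ g, ∀ h : g < (c.map gateCode).length, ∀ k, k < ((c.map gateCode)[g]).length →
        s 4 g k = ((c.map gateCode)[g]).getD k 0 := by
  refine and_congr Iff.rfl (and_congr (by rw [List.length_map]) ?_)
  constructor
  · intro h g hg k hk
    simp only [List.getElem_map] at hk ⊢
    exact h ⟨g, by simpa using hg⟩ k hk
  · intro h g k hk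
    have := h g (by simp) k
    simp only [List.getElem_map] at this
    exact this hk

/-! ### A calculus for programs with time bounds -/

/-- Started in `s`, the program halts within `T` steps in a memory satisfying `Q`. -/
def Runs (p : Prog) (s : Mem) (T : ℕ) (Q : Mem → Prop) : Prop :=
  ∃ s' t, Exec p s s' t ∧ t ≤ T ∧ Q s'

theorem Runs.haltsWithin {p : Prog} {s : Mem} {T : ℕ} {Q : Mem → Prop} (h : Runs p s T Q)
    {time : ℝ} (hT : (T : ℝ) ≤ time) : HaltsWithin p s time Q := by
  obtain ⟨s', t, he, ht, hq⟩ := h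
  exact ⟨s', t, he, (Nat.cast_le.2 ht).trans hT, hq⟩

theorem Runs.imp {p : Prog} {s : Mem} {T T' : ℕ} {Q Q' : Mem → Prop} (h : Runs p s T Q)
    (hT : T ≤ T') (hQ : ∀ s', Q s' → Q' s') : Runs p s T' Q' := by
  obtain ⟨s', t, he, ht, hq⟩ := h
  exact ⟨s', t, he, ht.trans hT, hQ s' hq⟩

theorem Runs.seq {p q : Prog} {s : Mem} {T U : ℕ} {P Q : Mem → Prop} (h : Runs p s T P)
    (h' : ∀ s', P s' → Runs q s' U Q) : Runs (.seq p q) s (T + U) Q := by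
  obtain ⟨s', t, he, ht, hp⟩ := h
  obtain ⟨s'', u, he', hu, hq⟩ := h' s' hp
  exact ⟨s'', t + u, .seq he he', add_le_add ht hu, hq⟩

theorem runs_write {s : Mem} {arr : ℕ} {i j e : Expr} {Q : Mem → Prop}
    (h : Q (s.set arr (i.eval s) (j.eval s) (e.eval s))) :
    Runs (.write arr i j e) s (i.cost + j.cost + e.cost + 1) Q :=
  ⟨_, _, .write s arr i j e, le_rfl, h⟩

/-- A scalar variable, kept in the first cell of its own array. -/
def Expr.var (v : ℕ) : Expr := .read v (.lit 0) (.lit 0)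

/-- The sum modulo two of two bits. -/
def Expr.xor (a b : Expr) : Expr := .add (.sub a b) (.sub b a)

/-- The product of two bits. -/
def Expr.and (a b : Expr) : Expr := .sub (.add a b) (.lit 1)

@[simp] theorem eval_lit (s : Mem) (k : ℕ) : (Expr.lit k).eval s = k := rfl
@[simp] theorem eval_read (s : Mem) (arr : ℕ) (i j : Expr) :
    (Expr.read arr i j).eval s = s arr (i.eval s) (j.eval s) := rfl
@[simp] theorem eval_add (s : Mem) (a b : Expr) :
    (Expr.add a b).eval s = a.eval s + b.eval s := rfl
@[simp] theorem eval_sub (s : Mem) (a b : Expr) :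
    (Expr.sub a b).eval s = a.eval s - b.eval s := rfl
@[simp] theorem eval_var (s : Mem) (v : ℕ) : (Expr.var v).eval s = s v 0 0 := rfl
@[simp] theorem eval_xor (s : Mem) (a b : Expr) :
    (Expr.xor a b).eval s = (a.eval s - b.eval s) + (b.eval s - a.eval s) := rfl
@[simp] theorem eval_and (s : Mem) (a b : Expr) :
    (Expr.and a b).eval s = a.eval s + b.eval s - 1 := rfl

/-- Repeats `p` with the variable `v` running through the numbers below `b`. -/
def Prog.forLoop (v : ℕ) (b : Expr) (p : Prog) : Prog :=
  .seq (.write v (.lit 0) (.lit 0) (.lit 0))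
    (.loop (.sub b (.var v)) (.seq p (.write v (.lit 0) (.lit 0) (.add (.var v) (.lit 1)))))

/-- A bound for the number of steps of a program per iteration of its loops: with loops of at most
`B` iterations in total, a program `p` takes at most `p.weight * B` steps. -/
def Prog.weight : Prog → ℕ
  | .skip => 1
  | .write _ i j e => i.cost + j.cost + e.cost + 1
  | .seq p q => p.weight + q.weight
  | .cond e p q => e.cost + 1 + p.weight + q.weight
  | .loop e p => e.cost + p.weight + 40

/-- In `I i s`, the number `i` counts the iterations that are complete. The body may change the loop
variable as long as it restores it. -/
theorem runs_forLoop {v : ℕ} {b : Expr} {p : Prog} {s : Mem} (I : ℕ → Mem → Prop) (N T : ℕ)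
    (h0 : I 0 (s.set v 0 0 0)) (hb : ∀ i s, I i s → b.eval s = N)
    (hstep : ∀ i < N, ∀ s, I i s → s v 0 0 = i →
      Runs p s T fun s' => s' v 0 0 = i ∧ I (i + 1) (s'.set v 0 0 (i + 1))) :
    Runs (.forLoop v b p) s ((N + 1) * (T + b.cost + 20)) (I N) := by
  have key : ∀ k i s, i + k = N → I i s → s v 0 0 = i →
      Runs (.loop (.sub b (.var v)) (.seq p (.write v (.lit 0) (.lit 0)
        (.add (.var v) (.lit 1))))) s (k * (T + b.cost + 13) + b.cost + 5) (I N) := by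
    intro k
    induction k with
    | zero =>
      intro i s hi hI hv
      obtain rfl : i = N := by omega
      refine ⟨s, _, .loopDone ?_, ?_, hI⟩
      · simp [hb i s hI, hv]
      · simp only [Expr.cost, Expr.var]; omega
    | succ k ih =>
      intro i s hi hI hv
      obtain ⟨s', t, he, ht, hv', hI'⟩ := hstep i (by omega) s hI hv
      have hset : (s'.set v ((Expr.lit 0).eval s') ((Expr.lit 0).eval s')
          ((Expr.add (.var v) (.lit 1)).eval s')) = s'.set v 0 0 (i + 1) := by
        simp [hv']
      obtain ⟨s'', u, he', hu, hQ⟩ := ih (i + 1) (s'.set v 0 0 (i + 1)) (by omega) hI'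
        (by simp [Mem.set])
      refine ⟨s'', _, .loopStep ?_ (.seq he (.write _ _ _ _ _)) (hset ▸ he'), ?_, hQ⟩
      · simp [hb i s hI, hv]; omega
      · simp only [Expr.cost, Expr.var]
        have : (k + 1) * (T + b.cost + 13) = k * (T + b.cost + 13) + (T + b.cost + 13) := by ring
        omega
  have h1 := Runs.seq (P := fun s' => s' = s.set v 0 0 0)
    (runs_write (arr := v) (i := .lit 0) (j := .lit 0) (e := .lit 0) rfl)
    (fun s' hs' => key N 0 s' (Nat.zero_add N) (hs' ▸ h0) (by simp [hs', Mem.set]))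
  refine h1.imp ?_ fun _ h => h
  simp only [Expr.cost]
  have : (N + 1) * (T + b.cost + 20) = N * (T + b.cost + 13) + 7 * N + (T + b.cost + 20) := by ring
  omega

/-- The memories agree outside the arrays in `A`. -/
def Frame (A : List ℕ) (s s' : Mem) : Prop := ∀ arr, arr ∉ A → s' arr = s arr

theorem Frame.refl (A : List ℕ) (s : Mem) : Frame A s s := fun _ _ => rfl

theorem Frame.trans {A B : List ℕ} {s s' s'' : Mem} (h : Frame A s s') (h' : Frame B s' s'')
    (hA : ∀ x ∈ A, x ∈ B) : Frame B s s'' := fun arr harr =>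
  (h' arr harr).trans (h arr fun hm => harr (hA arr hm))

theorem Frame.mono {A B : List ℕ} {s s' : Mem} (h : Frame A s s') (hA : ∀ x ∈ A, x ∈ B) :
    Frame B s s' := fun arr harr => h arr fun hm => harr (hA arr hm)

theorem Mem.set_of_ne {s : Mem} {arr arr' i j v : ℕ} (h : arr' ≠ arr) :
    s.set arr i j v arr' = s arr' := by
  funext i' j'
  simp [Mem.set, h]

theorem Frame.set {A : List ℕ} {s s' : Mem} (h : Frame A s s') {arr : ℕ} (harr : arr ∈ A)
    (i j v : ℕ) : Frame A s (s'.set arr i j v) := fun arr' harr' =>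
  (Mem.set_of_ne fun e : arr' = arr => harr' (e ▸ harr)).trans (h arr' harr')

/-- Nested loops with the variables `20` and `21`. -/
def Prog.forLoop₂ (b b' : Expr) (p : Prog) : Prog := .forLoop 20 b (.forLoop 21 b' p)

/-- In `I i j s`, `i` rows and `j` entries of the next row are complete. -/
theorem runs_forLoop₂ {b b' : Expr} {p : Prog} {s : Mem} (I : ℕ → ℕ → Mem → Prop) (N M : ℕ)
    (hset : ∀ i j s v x, v = 20 ∨ v = 21 → I i j s → I i j (s.set v 0 0 x)) (h0 : I 0 0 s)
    (hrow : ∀ i s, I i M s → I (i + 1) 0 s) (hb : ∀ i j s, I i j s → b.eval s = N)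
    (hb' : ∀ i j s, I i j s → b'.eval s = M)
    (hstep : ∀ i < N, ∀ j < M, ∀ s, I i j s → s 20 0 0 = i → s 21 0 0 = j →
      Runs p s p.weight fun s' => s' 20 0 0 = i ∧ s' 21 0 0 = j ∧ I i (j + 1) s') :
    Runs (.forLoop₂ b b' p) s ((Prog.forLoop₂ b b' p).weight * ((N + 1) * (M + 1))) (I N 0) := by
  have hw : p.weight + b.cost + b'.cost + 40 ≤ (Prog.forLoop₂ b b' p).weight := by
    simp only [Prog.forLoop₂, Prog.forLoop, Prog.weight, Expr.cost, Expr.var]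
    omega
  refine Runs.imp ?_ (Nat.mul_le_mul_right _ hw) fun _ h => h
  generalize p.weight = T at hstep ⊢
  refine (runs_forLoop (fun i s => I i 0 s) N ((M + 1) * (T + b'.cost + 20))
    (hset _ _ _ _ _ (Or.inl rfl) h0) (fun i s h => hb i 0 s h) fun i hi s hI hv => ?_).imp ?_
    fun _ h => h
  · refine (runs_forLoop (fun j s => s 20 0 0 = i ∧ I i j s) M T
      ⟨by simpa [Mem.set] using hv, hset _ _ _ _ _ (Or.inr rfl) hI⟩
      (fun j s h => hb' i j s h.2) fun j hj s hI hv => ?_).imp le_rfl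
      fun s' h => ⟨h.1, hset _ _ _ _ _ (Or.inl rfl) (hrow i s' h.2)⟩
    refine (hstep i hi j hj s hI.2 hI.1 hv).imp le_rfl fun s' h => ⟨h.2.1, ?_, ?_⟩
    · simpa [Mem.set] using h.1
    · exact hset _ _ _ _ _ (Or.inr rfl) h.2.2
  · rw [mul_comm (T + b.cost + b'.cost + 40), mul_assoc]
    refine Nat.mul_le_mul le_rfl ?_
    have : (M + 1) * (T + b.cost + b'.cost + 40) =
      (M + 1) * (T + b'.cost + 20) + (b.cost + 20) + M * (b.cost + 20) := by ring
    omega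

/-- Nested loops around a single assignment to `arr`, with an invariant about this array only. -/
theorem runs_fill {arr : ℕ} {b b' r c e : Expr} {s : Mem} (harr : arr ≠ 20 ∧ arr ≠ 21) (N M : ℕ)
    (P : ℕ → ℕ → (ℕ → ℕ → ℕ) → Prop)
    (hb : ∀ s', Frame [arr, 20, 21] s s' → b.eval s' = N)
    (hb' : ∀ s', Frame [arr, 20, 21] s s' → b'.eval s' = M) (h0 : P 0 0 (s arr))
    (hrow : ∀ i f, P i M f → P (i + 1) 0 f)
    (hstep : ∀ i < N, ∀ j < M, ∀ s', Frame [arr, 20, 21] s s' → s' 20 0 0 = i → s' 21 0 0 = j →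
      P i j (s' arr) → P i (j + 1) fun x y =>
        if x = r.eval s' ∧ y = c.eval s' then e.eval s' else s' arr x y) :
    Runs (.forLoop₂ b b' (.write arr r c e)) s
      ((Prog.forLoop₂ b b' (.write arr r c e)).weight * ((N + 1) * (M + 1)))
      fun s' => Frame [arr, 20, 21] s s' ∧ P N 0 (s' arr) := by
  refine runs_forLoop₂ (fun i j s' => Frame [arr, 20, 21] s s' ∧ P i j (s' arr)) N M
    ?_ ⟨Frame.refl _ _, h0⟩ (fun i s' h => ⟨h.1, hrow i _ h.2⟩) (fun i j s' h => hb s' h.1)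
    (fun i j s' h => hb' s' h.1) ?_
  · intro i j s' v x hv h
    have hv1 : v ∈ [arr, 20, 21] := by rcases hv with rfl | rfl <;> simp
    have hv2 : arr ≠ v := by rcases hv with rfl | rfl; exacts [harr.1, harr.2]
    refine ⟨h.1.set hv1 _ _ _, ?_⟩
    rw [Mem.set_of_ne hv2]
    exact h.2
  · intro i hi j hj s' h hvi hvj
    refine runs_write ⟨?_, ?_, h.1.set (by simp) _ _ _, ?_⟩
    · rw [Mem.set_of_ne harr.1.symm, hvi]
    · rw [Mem.set_of_ne harr.2.symm, hvj]
    · have := hstep i hi j hj s' h.1 hvi hvj h.2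
      convert this using 3
      simp [Mem.set]

/-- Nested loops that treat all entries of an array independently. -/
theorem runs_entrywise {arr : ℕ} {b b' e : Expr} {s : Mem} (harr : arr ≠ 20 ∧ arr ≠ 21) (N M : ℕ)
    (new : ℕ → ℕ → ℕ) (hb : ∀ s', Frame [arr, 20, 21] s s' → b.eval s' = N)
    (hb' : ∀ s', Frame [arr, 20, 21] s s' → b'.eval s' = M)
    (hstep : ∀ i < N, ∀ j < M, ∀ s', Frame [arr, 20, 21] s s' → s' 20 0 0 = i → s' 21 0 0 = j →
      s' arr i j = s arr i j → e.eval s' = new i j) :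
    Runs (.forLoop₂ b b' (.write arr (.var 20) (.var 21) e)) s
      ((Prog.forLoop₂ b b' (.write arr (.var 20) (.var 21) e)).weight * ((N + 1) * (M + 1)))
      fun s' => Frame [arr, 20, 21] s s' ∧ ∀ i < N, ∀ j < M, s' arr i j = new i j := by
  refine (runs_fill harr N M (fun i j f => ∀ q, ∀ k < M, f q k =
    if q < i ∨ (q = i ∧ k < j) then new q k else s arr q k) hb hb' (fun q k _ => by simp)
    (fun i f h q k hk => ?_) (fun i hi j hj s' hF hi' hj' h q k hk => ?_)).imp le_rfl
    fun s' h => ⟨h.1, fun i hi j hj => by rw [h.2 i j hj, if_pos (Or.inl hi)]⟩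
  · rw [h q k hk]
    congr 1
    apply propext
    omega
  · simp only [eval_var, hi', hj']
    by_cases hc : q = i ∧ k = j
    · rw [if_pos hc, if_pos (Or.inr ⟨hc.1, by omega⟩), hc.1, hc.2]
      exact hstep i hi j hj s' hF hi' hj' ((h i j hj).trans (if_neg (by omega)))
    · rw [if_neg hc, h q k hk]
      congr 1
      apply propext
      omega

/-! ### Elimination on the machine -/

theorem val_add_eq : ∀ a b : ZMod 2, (a + b).val = (a.val - b.val) + (b.val - a.val) := by decide

theorem val_mul_eq : ∀ a b : ZMod 2, (a * b).val = a.val + b.val - 1 := by decide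

/-- The part of a dot product that comes from the first `k` coordinates. -/
def partialDot {n : ℕ} (x y : Bits (Fin n)) (k : ℕ) : ZMod 2 :=
  ∑ j ∈ univ.filter (fun j : Fin n => (j : ℕ) < k), x j * y j

theorem partialDot_zero {n : ℕ} (x y : Bits (Fin n)) : partialDot x y 0 = 0 := by
  simp [partialDot]

theorem partialDot_self {n : ℕ} (x y : Bits (Fin n)) : partialDot x y n = x ⬝ᵥ y := by
  simp [partialDot, dotProduct]

theorem partialDot_succ {n : ℕ} (x y : Bits (Fin n)) (j : Fin n) :
    partialDot x y (j + 1) = partialDot x y j + x j * y j := by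
  have : univ.filter (fun k : Fin n => (k : ℕ) < j + 1) =
      insert j (univ.filter fun k : Fin n => (k : ℕ) < j) := by
    ext k
    simp only [mem_filter, mem_univ, true_and, mem_insert, Fin.ext_iff]
    omega
  rw [partialDot, this, sum_insert (by simp), add_comm]
  rfl

/-- Computes the products of the rows of array `5` with row `r` of array `ya` into row `k` of
array `9`. -/
def dotProg (ya : ℕ) (r k : Expr) : Prog :=
  .forLoop₂ (.read 0 (.lit 0) (.lit 0)) (.read 0 (.lit 0) (.lit 0))
    (.write 9 k (.var 20) (.xor (.read 9 k (.var 20))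
      (.and (.read 5 (.var 20) (.var 21)) (.read ya r (.var 21)))))

theorem runs_dotProg {ya : ℕ} {r k : Expr} (hya : ya ∉ [9, 20, 21]) {n : ℕ} {s : Mem}
    {G : Fin n → Bits (Fin n)} {y : Bits (Fin n)} {r' k' : ℕ} (hn : s 0 0 0 = n)
    (hG : ∀ q j : Fin n, s 5 q j = (G q j).val) (hy : ∀ j : Fin n, s ya r' j = (y j).val)
    (hrk : ∀ s', Frame [9, 20, 21] s s' → r.eval s' = r' ∧ k.eval s' = k')
    (h9 : ∀ q, s 9 k' q = 0) :
    Runs (dotProg ya r k) s ((dotProg ya r k).weight * ((n + 1) * (n + 1))) fun s' =>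
      Frame [9, 20, 21] s s' ∧
      (∀ q : Fin n, s' 9 k' q = (G q ⬝ᵥ y).val) ∧ ∀ a, a ≠ k' → s' 9 a = s 9 a := by
  have hb : ∀ s', Frame [9, 20, 21] s s' → (Expr.read 0 (.lit 0) (.lit 0)).eval s' = n := by
    intro s' hF
    simp [hF 0 (by decide), hn]
  refine (runs_fill (by decide) n n (fun i j f => (∀ q : Fin n, f k' q = (partialDot (G q) y
    (if (q : ℕ) < i then n else if (q : ℕ) = i then j else 0)).val) ∧
    ∀ a, a ≠ k' → f a = s 9 a) hb hb ?_ ?_ ?_).imp le_rfl ?_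
  · refine ⟨fun q => ?_, fun _ _ => rfl⟩
    simp [h9, partialDot_zero]
  · intro i f h
    refine ⟨fun q => ?_, h.2⟩
    rw [h.1 q]
    congr 2
    split_ifs <;> omega
  · intro i hi j hj s' hF hi' hj' h
    obtain ⟨hr, hk⟩ := hrk s' hF
    refine ⟨fun q => ?_, fun a ha => ?_⟩
    · simp only [hk, eval_var, hi', hj', eval_xor, eval_and, eval_read, hr, true_and]
      by_cases hq : (q : ℕ) = i
      · subst hq
        have h1 := h.1 q
        rw [if_neg (lt_irrefl _), if_pos rfl] at h1 ⊢
        rw [if_pos rfl, h1, hF 5 (by decide), hF ya hya, hG q ⟨j, hj⟩, hy ⟨j, hj⟩,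
          partialDot_succ (G q) y ⟨j, hj⟩, val_add_eq, val_mul_eq]
      · rw [if_neg hq, h.1 q, if_neg hq, if_neg hq]
    · funext x
      simp only [hk, ha, false_and, if_false]
      rw [h.2 a ha]
  · intro s' h
    refine ⟨h.1, fun q => ?_, h.2.2⟩
    rw [h.2.1 q, if_pos q.2, partialDot_self]

/-- The last row, among the first `i`, that `d` selects, and zero if there is none. -/
def lastRow {n : ℕ} (d : Fin n → ZMod 2) (G : Fin n → Bits (Fin n)) : ℕ → Bits (Fin n)
  | 0 => 0
  | i + 1 => if h : i < n then (if d ⟨i, h⟩ = 1 then G ⟨i, h⟩ else lastRow d G i)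
      else lastRow d G i

theorem lastRow_spec {n : ℕ} (d : Fin n → ZMod 2) (G : Fin n → Bits (Fin n)) :
    (lastRow d G n = 0 ∧ ∀ q, d q = 0) ∨ ∃ p, d p = 1 ∧ lastRow d G n = G p := by
  have key : ∀ i, (lastRow d G i = 0 ∧ ∀ q : Fin n, (q : ℕ) < i → d q = 0) ∨
      ∃ p, d p = 1 ∧ lastRow d G i = G p := by
    intro i
    induction i with
    | zero => exact Or.inl ⟨rfl, fun q hq => absurd hq (Nat.not_lt_zero _)⟩
    | succ i ih =>
      rw [lastRow]
      split_ifs with h h1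
      · exact Or.inr ⟨_, h1, rfl⟩
      · refine ih.imp (fun h0 => ⟨h0.1, fun q hq => ?_⟩) fun h => h
        rcases Nat.lt_succ_iff_lt_or_eq.1 hq with hq | hq
        · exact h0.2 q hq
        · rw [show q = ⟨i, h⟩ from Fin.ext hq]
          exact (zmod_two_cases _).resolve_right h1
      · exact ih.imp (fun h0 => ⟨h0.1, fun q hq => h0.2 q (by omega)⟩) fun h => h
  exact (key n).imp (fun h => ⟨h.1, fun q => h.2 q q.2⟩) fun h => h

/-- Copies the last row of array `5` that `d` selects to row `k` of `arr`. -/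
def selectProg (arr : ℕ) (k d : Expr) : Prog :=
  .forLoop₂ (.read 0 (.lit 0) (.lit 0)) (.read 0 (.lit 0) (.lit 0))
    (.write arr k (.var 21) (.add (.sub (.read arr k (.var 21)) d)
      (.and d (.read 5 (.var 20) (.var 21)))))

theorem runs_selectProg {arr : ℕ} {k d : Expr} (harr : arr ∉ [0, 5, 20, 21]) {n : ℕ} {s : Mem}
    {G : Fin n → Bits (Fin n)} {d' : Fin n → ZMod 2} {k' : ℕ}
    (hn : s 0 0 0 = n) (hG : ∀ q j : Fin n, s 5 q j = (G q j).val)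
    (hk : ∀ s', Frame [arr, 20, 21] s s' → k.eval s' = k')
    (hd : ∀ s', Frame [arr, 20, 21] s s' → ∀ q : Fin n, s' 20 0 0 = q → d.eval s' = (d' q).val)
    (h0 : ∀ j, s arr k' j = 0) :
    Runs (selectProg arr k d) s ((selectProg arr k d).weight * ((n + 1) * (n + 1))) fun s' =>
      Frame [arr, 20, 21] s s' ∧
      (∀ j : Fin n, s' arr k' j = (lastRow d' G n j).val) ∧ ∀ a, a ≠ k' → s' arr a = s arr a := by
  simp only [List.mem_cons, List.not_mem_nil, or_false, not_or] at harr
  have hb : ∀ s', Frame [arr, 20, 21] s s' → (Expr.read 0 (.lit 0) (.lit 0)).eval s' = n := by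
    intro s' hF
    simp [hF 0 (by simp [Ne.symm harr.1]), hn]
  have h5 : ∀ s', Frame [arr, 20, 21] s s' → s' 5 = s 5 := fun s' hF =>
    hF 5 (by simp [Ne.symm harr.2.1])
  refine (runs_fill ⟨harr.2.2.1, harr.2.2.2⟩ n n (fun i j f => (∀ j' : Fin n, f k' j' =
    ((if (j' : ℕ) < j then lastRow d' G (i + 1) else lastRow d' G i) j').val) ∧
    ∀ a, a ≠ k' → f a = s arr a) hb hb ?_ ?_ ?_).imp le_rfl ?_
  · exact ⟨fun j => by simp [h0, lastRow], fun _ _ => rfl⟩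
  · intro i f h
    refine ⟨fun j' => ?_, h.2⟩
    rw [h.1 j', if_pos j'.2, if_neg (Nat.not_lt_zero _)]
  · intro i hi j hj s' hF hi' hj' h
    have hk' := hk s' hF
    have hd' := hd s' hF ⟨i, hi⟩ hi'
    refine ⟨fun j' => ?_, fun a ha => ?_⟩
    · simp only [hk', eval_var, hi', hj', eval_add, eval_sub, eval_and, eval_read, hd', true_and]
      by_cases hq : (j' : ℕ) = j
      · have h1 := h.1 j'
        rw [hq, if_neg (lt_irrefl _)] at h1
        rw [if_pos hq, if_pos (by omega), h5 s' hF, ← hq, hG ⟨i, hi⟩ j', hq, h1, lastRow,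
          dif_pos hi]
        have e1 : (1 : ZMod 2).val = 1 := rfl
        rcases zmod_two_cases (d' ⟨i, hi⟩) with hd0 | hd1
        · rw [hd0, if_neg zero_ne_one, ZMod.val_zero]
          have := ZMod.val_lt (G ⟨i, hi⟩ j')
          omega
        · rw [hd1, if_pos rfl, e1]
          have := ZMod.val_lt (lastRow d' G i j')
          omega
      · have hiff : (j' : ℕ) < j + 1 ↔ (j' : ℕ) < j := by omega
        rw [if_neg hq, h.1 j']
        simp only [hiff]
    · funext x
      simp only [hk', ha, false_and, if_false]
      rw [h.2 a ha]
  · intro s' h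
    exact ⟨h.1, fun j => by rw [h.2.1 j, if_neg (Nat.not_lt_zero _)], h.2.2⟩

/-- The number of qubits, as an expression. -/
abbrev Expr.size : Expr := .read 0 (.lit 0) (.lit 0)

/-- Adds row `k` of array `6` to the rows of array `5` that row `k` of array `9` selects, where `k`
is the variable `22`. -/
def addProg : Prog :=
  .forLoop₂ .size .size (.write 5 (.var 20) (.var 21) (.xor (.read 5 (.var 20) (.var 21))
    (.and (.read 9 (.var 22) (.var 20)) (.read 6 (.var 22) (.var 21)))))

theorem runs_addProg {n : ℕ} {s : Mem} {G : Fin n → Bits (Fin n)} {d : Fin n → ZMod 2}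
    {R : Bits (Fin n)} (hn : s 0 0 0 = n) (hG : ∀ q j : Fin n, s 5 q j = (G q j).val)
    (hd : ∀ q : Fin n, s 9 (s 22 0 0) q = (d q).val)
    (hR : ∀ j : Fin n, s 6 (s 22 0 0) j = (R j).val) :
    Runs addProg s (addProg.weight * ((n + 1) * (n + 1))) fun s' => Frame [5, 20, 21] s s' ∧
      ∀ q j : Fin n, s' 5 q j = ((G q + d q • R) j).val := by
  have hb : ∀ s', Frame [5, 20, 21] s s' → Expr.size.eval s' = n := by
    intro s' hF
    simp [hF 0 (by decide), hn]
  refine (runs_entrywise (by decide) n n (fun q j => if h : q < n ∧ j < n then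
    ((G ⟨q, h.1⟩ + d ⟨q, h.1⟩ • R) ⟨j, h.2⟩).val else 0) hb hb ?_).imp le_rfl
    fun s' h => ⟨h.1, fun q j => by rw [h.2 q q.2 j j.2, dif_pos ⟨q.2, j.2⟩]⟩
  intro i hi j hj s' hF hi' hj' he
  rw [dif_pos ⟨hi, hj⟩]
  simp only [eval_xor, eval_and, eval_read, eval_var, hi', hj', he]
  rw [hF 9 (by decide), hF 6 (by decide), hF 22 (by decide), hG ⟨i, hi⟩ ⟨j, hj⟩, hd ⟨i, hi⟩,
    hR ⟨j, hj⟩, Pi.add_apply, Pi.smul_apply, smul_eq_mul, val_add_eq, val_mul_eq]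

/-- Imposes orthogonality to the string in row `k` of array `1`, where `k` is the variable `22`.
Row `k` of array `9` receives the products with the generators, and row `k` of array `6` a generator
with product `1`; each step uses rows of its own, as these have to be zero beforehand. -/
def elimStep : Prog :=
  .seq (dotProg 1 (.var 22) (.var 22))
    (.seq (selectProg 6 (.var 22) (.read 9 (.var 22) (.var 20))) addProg)

/-- The memory after elimination with the strings `ys`, of which there are `k`: array `5` holds
a reduced generating set, and the rows of the work arrays `6` and `9` from the `k`-th on are still
empty. -/
def ElimState {n : ℕ} (ys : List (Bits (Fin n))) (k : ℕ) (s : Mem) : Prop :=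
  ∃ G : Fin n → Bits (Fin n), IsReduced G ys ∧ (∀ q j : Fin n, s 5 q j = (G q j).val) ∧
    (∀ i, k ≤ i → ∀ q, s 9 i q = 0) ∧ ∀ i, k ≤ i → ∀ j, s 6 i j = 0

theorem runs_elimStep {n : ℕ} {s : Mem} {ys : List (Bits (Fin n))} {k : ℕ} {y : Bits (Fin n)}
    (hn : s 0 0 0 = n) (hk : s 22 0 0 = k) (hy : ∀ j : Fin n, s 1 k j = (y j).val)
    (h : ElimState ys k s) :
    Runs elimStep s (elimStep.weight * ((n + 1) * (n + 1))) fun s' =>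
      Frame [5, 6, 9, 20, 21] s s' ∧ ElimState (ys ++ [y]) (k + 1) s' := by
  obtain ⟨G, hG, h5, h9, h6⟩ := h
  have hw : elimStep.weight * ((n + 1) * (n + 1)) =
      (dotProg 1 (.var 22) (.var 22)).weight * ((n + 1) * (n + 1)) +
      ((selectProg 6 (.var 22) (.read 9 (.var 22) (.var 20))).weight * ((n + 1) * (n + 1)) +
        addProg.weight * ((n + 1) * (n + 1))) := by
    rw [elimStep, Prog.weight, Prog.weight]; ring
  rw [hw]
  refine Runs.seq (runs_dotProg (r' := k) (k' := k) (by decide) hn h5 hy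
    (fun s' hF => by simp [hF 22 (by decide), hk]) (h9 k le_rfl)) fun s₁ ⟨F₁, hd₁, ho₁⟩ => ?_
  refine Runs.seq (runs_selectProg (G := G) (k' := k) (d' := fun q => G q ⬝ᵥ y) (by decide)
    (by rw [F₁ 0 (by decide), hn]) (fun q j => by rw [F₁ 5 (by decide), h5])
    (fun s' hF => by simp [hF 22 (by decide), F₁ 22 (by decide), hk])
    (fun s' hF q hq => by
      simp [hF 22 (by decide), F₁ 22 (by decide), hk, hF 9 (by decide), hq, hd₁])
    (fun j => by rw [F₁ 6 (by decide), h6 k le_rfl])) fun s₂ ⟨F₂, hd₂, ho₂⟩ => ?_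
  have h22 : s₂ 22 0 0 = k := by rw [F₂ 22 (by decide), F₁ 22 (by decide), hk]
  refine (runs_addProg (G := G) (d := fun q => G q ⬝ᵥ y) (R := lastRow (fun q => G q ⬝ᵥ y) G n)
    (by rw [F₂ 0 (by decide), F₁ 0 (by decide), hn])
    (fun q j => by rw [F₂ 5 (by decide), F₁ 5 (by decide), h5])
    (fun q => by rw [h22, F₂ 9 (by decide), hd₁]) (fun j => by rw [h22, hd₂])).imp le_rfl
    fun s₃ ⟨F₃, h₃⟩ => ?_
  refine ⟨(F₁.mono (by simp)).trans ((F₂.mono (by simp)).trans (F₃.mono (by simp))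
    (fun _ h => h)) (fun _ h => h), _, hG.step y (lastRow (fun q => G q ⬝ᵥ y) G n) ?_, h₃,
    fun i hi q => ?_, fun i hi j => ?_⟩
  · exact (lastRow_spec (fun q => G q ⬝ᵥ y) G).imp (fun h => h.2) fun h => h
  · rw [F₃ 9 (by decide), F₂ 9 (by decide), ho₁ i (by omega), h9 i (by omega)]
  · rw [F₃ 6 (by decide), ho₂ i (by omega), F₁ 6 (by decide), h6 i (by omega)]

/-- Computes a reduced generating set of the nullspace of the strings in array `1`, starting from
the unit vectors. -/
def elimProg : Prog :=
  .seq (.forLoop₂ .size .size (.write 5 (.var 20) (.var 21)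
      (.sub (.lit 1) (.add (.sub (.var 20) (.var 21)) (.sub (.var 21) (.var 20))))))
    (.forLoop 22 (.read 0 (.lit 0) (.lit 2)) elimStep)

theorem bitAt_eq {n : ℕ} (y : Bits (Fin n)) (j : Fin n) : bitAt y j = (y j).val := by
  simp [bitAt]

theorem runs_elimProg {n : ℕ} (m : ℕ) {ys : List (Bits (Fin n))} (y : Bits (Fin n))
    (hlen : ys.length ≤ n) :
    Runs elimProg (inputMem m ys y) (elimProg.weight * (n + 1) ^ 3) fun s' =>
      Frame [5, 6, 9, 20, 21, 22] (inputMem m ys y) s' ∧ ElimState ys ys.length s' := by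
  set s := inputMem m ys y with hs
  have h0 : s 0 0 0 = n := by simp [hs, inputMem]
  have h02 : s 0 0 2 = ys.length := by simp [hs, inputMem]
  have hz : ∀ a, a ≠ 0 → a ≠ 1 → a ≠ 2 → ∀ i j, s a i j = 0 := by
    intro a h h' h'' i j
    simp [hs, inputMem, h, h', h'']
  have hb : ∀ s', Frame [5, 20, 21] s s' → Expr.size.eval s' = n := by
    intro s' hF
    simp [hF 0 (by decide), h0]
  have hw : (Prog.forLoop₂ .size .size (.write 5 (.var 20) (.var 21)
      (.sub (.lit 1) (.add (.sub (.var 20) (.var 21)) (.sub (.var 21) (.var 20)))))).weight *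
      ((n + 1) * (n + 1)) + (ys.length + 1) * (elimStep.weight * ((n + 1) * (n + 1)) +
      (Expr.read 0 (.lit 0) (.lit 2)).cost + 20) ≤ elimProg.weight * (n + 1) ^ 3 := by
    rw [elimProg, Prog.weight]
    generalize (Prog.forLoop₂ .size .size _).weight = w
    have h1 : elimStep.weight + 23 ≤
        (Prog.forLoop 22 (.read 0 (.lit 0) (.lit 2)) elimStep).weight := by
      simp only [Prog.forLoop, Prog.weight, Expr.cost, Expr.var]
      omega
    generalize (Prog.forLoop 22 (.read 0 (.lit 0) (.lit 2)) elimStep).weight = w' at h1 ⊢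
    have hB : 1 ≤ (n + 1) * (n + 1) := Nat.mul_pos (Nat.succ_pos n) (Nat.succ_pos n)
    rw [show (n + 1) ^ 3 = (n + 1) * ((n + 1) * (n + 1)) by ring]
    generalize (n + 1) * (n + 1) = B at hB ⊢
    rw [add_mul w]
    refine add_le_add (Nat.mul_le_mul le_rfl (Nat.le_mul_of_pos_left _ (Nat.succ_pos n))) ?_
    calc (ys.length + 1) * (elimStep.weight * B + (Expr.read 0 (.lit 0) (.lit 2)).cost + 20)
        ≤ (n + 1) * ((elimStep.weight + 23) * B) := by
          refine Nat.mul_le_mul (by omega) ?_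
          simp only [Expr.cost]
          nlinarith
      _ ≤ (n + 1) * (w' * B) := Nat.mul_le_mul le_rfl (Nat.mul_le_mul h1 le_rfl)
      _ = w' * ((n + 1) * B) := by ring
  refine (Runs.seq (runs_entrywise (by decide) n n (fun i j => if i = j then 1 else 0) hb hb ?_)
    fun s₁ ⟨F₁, h₁⟩ => runs_forLoop (fun k s' => Frame [5, 6, 9, 20, 21, 22] s s' ∧
      ElimState (ys.take k) k s') ys.length (elimStep.weight * ((n + 1) * (n + 1)))
      ?_ ?_ ?_).imp hw fun s' h => ?_
  · intro i hi j hj s' hF hi' hj' _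
    simp only [eval_sub, eval_add, eval_var, eval_lit, hi', hj']
    split_ifs <;> omega
  · refine ⟨(F₁.mono (by simp)).set (by simp) _ _ _, fun q => Pi.single q (1 : ZMod 2),
      isReduced_nil, fun q j => ?_, fun i _ q => ?_, fun i _ q => ?_⟩
    · rw [Mem.set_of_ne (by decide), h₁ q q.2 j j.2]
      change _ = ((Pi.single q (1 : ZMod 2) : Bits (Fin n)) j).val
      rw [Pi.single_apply]
      by_cases h : j = q
      · rw [if_pos h, if_pos (congrArg Fin.val h.symm)]; rfl
      · rw [if_neg h, if_neg fun e => h (Fin.ext e.symm)]; rfl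
    · rw [Mem.set_of_ne (by decide), F₁ 9 (by decide), hz 9 (by decide) (by decide) (by decide)]
    · rw [Mem.set_of_ne (by decide), F₁ 6 (by decide), hz 6 (by decide) (by decide) (by decide)]
  · intro i s' h
    simp [h.1 0 (by decide), h02]
  · intro k hk s' h hk'
    refine (runs_elimStep (y := ys[k]) (by rw [h.1 0 (by decide), h0]) hk' (fun j => ?_)
      h.2).imp le_rfl fun s'' h' => ⟨?_, (h.1.trans (h'.1.mono (by simp)) fun _ h => h).set
        (by simp) _ _ _, ?_⟩
    · rw [h.1 1 (by decide), ← bitAt_eq]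
      simp [hs, inputMem, hk]
    · rw [h'.1 22 (by decide), hk']
    · obtain ⟨G, hG, h5, h9, h6⟩ := h'.2
      rw [List.take_append_getElem] at hG
      exact ⟨G, hG, h5, h9, h6⟩
  · rw [List.take_length] at h
    exact h

/-! ### The decision whether to keep a sample, and the output -/

/-- Tests whether the string in array `2` is orthogonal to the nullspace: adds up its products with
a generating set. -/
def testProg : Prog :=
  .seq elimProg (.seq (dotProg 2 (.lit 0) (.read 0 (.lit 0) (.lit 2)))
    (.forLoop₂ .size (.lit 1) (.write 3 (.lit 0) (.lit 0) (.add (.read 3 (.lit 0) (.lit 0))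
      (.read 9 (.read 0 (.lit 0) (.lit 2)) (.var 20))))))

theorem Runs.seq_weight {p q : Prog} {s : Mem} {B : ℕ} {P Q : Mem → Prop}
    (h : Runs p s (p.weight * B) P) (h' : ∀ s', P s' → Runs q s' (q.weight * B) Q) :
    Runs (.seq p q) s ((Prog.seq p q).weight * B) Q :=
  (h.seq h').imp (by rw [Prog.weight, add_mul]) fun _ h => h

theorem runs_testProg {n : ℕ} (m : ℕ) {ys : List (Bits (Fin n))} (y : Bits (Fin n))
    (hlen : ys.length ≤ n) :
    Runs testProg (inputMem m ys y) (testProg.weight * (2 * (n + 1) ^ 3)) fun s =>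
      s 3 0 0 = 0 ↔ y ∈ spanOf ys := by
  have h0 : inputMem m ys y 0 0 0 = n := by simp [inputMem]
  have h02 : inputMem m ys y 0 0 2 = ys.length := by simp [inputMem]
  have hB1 : 1 ≤ (n + 1) * (n + 1) := Nat.mul_pos (Nat.succ_pos n) (Nat.succ_pos n)
  have hB : (n + 1) * (n + 1) ≤ 2 * (n + 1) ^ 3 := by
    rw [show (n + 1) ^ 3 = (n + 1) * ((n + 1) * (n + 1)) by ring]
    nlinarith
  have hB' : (n + 1) * (1 + 1) ≤ 2 * (n + 1) ^ 3 := by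
    rw [show (n + 1) ^ 3 = (n + 1) * ((n + 1) * (n + 1)) by ring]
    nlinarith
  refine Runs.seq_weight ((runs_elimProg m y hlen).imp
    (Nat.mul_le_mul le_rfl (Nat.le_mul_of_pos_left _ two_pos)) fun _ h => h)
    fun s₁ ⟨F₁, G, hG, h5, h9, _⟩ => ?_
  refine Runs.seq_weight ((runs_dotProg (G := G) (y := y) (r' := 0) (k' := ys.length) (by decide)
    (by rw [F₁ 0 (by decide), h0]) h5 (fun j => ?_) (fun s' hF => ⟨rfl, ?_⟩)
    (h9 _ le_rfl)).imp (Nat.mul_le_mul le_rfl hB) fun _ h => h) fun s₂ ⟨F₂, hd₂, _⟩ => ?_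
  · rw [F₁ 2 (by decide), ← bitAt_eq]
    simp [inputMem]
  · simp [hF 0 (by decide), F₁ 0 (by decide), h02]
  have h3 : s₂ 3 0 0 = 0 := by
    rw [F₂ 3 (by decide), F₁ 3 (by decide)]
    simp [inputMem]
  refine (runs_fill (by decide) n 1 (fun i j f => f 0 0 = 0 ↔
    ∀ q : Fin n, (q : ℕ) < i + j → G q ⬝ᵥ y = 0) (fun s' hF => ?_) (fun s' hF => rfl)
    (by simp [h3]) (fun i f h => h) fun i hi j hj s' hF hi' hj' h => ?_).imp
    (Nat.mul_le_mul le_rfl hB') fun s' h => ?_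
  · simp [hF 0 (by decide), F₂ 0 (by decide), F₁ 0 (by decide), h0]
  · obtain rfl : j = 0 := by omega
    have hl : s' 0 0 2 = ys.length := by
      rw [hF 0 (by decide), F₂ 0 (by decide), F₁ 0 (by decide), h02]
    simp only [eval_add, eval_read, eval_lit, eval_var, and_self, if_true, hl, hi']
    rw [hF 9 (by decide), hd₂ ⟨i, hi⟩, Nat.add_eq_zero_iff, h, ZMod.val_eq_zero]
    constructor
    · rintro ⟨h1, h2⟩ q hq
      rcases Nat.lt_succ_iff_lt_or_eq.1 hq with hq | hq
      · exact h1 q hq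
      · rw [show q = ⟨i, hi⟩ from Fin.ext hq]
        exact h2
    · intro h1
      exact ⟨fun q hq => h1 q (by omega), h1 ⟨i, hi⟩ (Nat.lt_succ_self i)⟩
  · rw [h.2, hG.mem_spanOf_iff]
    exact ⟨fun h q => h q (by have := q.2; omega), fun h q _ => h q⟩

/-- Writes a nonzero row of a reduced generating set of the nullspace. -/
def answerProg : Prog := .seq elimProg (selectProg 3 (.lit 0) (.read 5 (.var 20) (.var 20)))

theorem runs_answerProg {n : ℕ} (m : ℕ) {ys : List (Bits (Fin n))} (y : Bits (Fin n))
    (hys : Indep ys) (hlen : ys.length + 2 = n) : ∃ S : Finset (Fin n),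
    Runs answerProg (inputMem m ys y) (answerProg.weight * (n + 1) ^ 3) (WritesSet S) ∧
    ∀ S' : Finset (Fin n), NullspaceIsCut ys S' → S = S' ∨ S = S'ᶜ := by
  -- `elimProg` halts in some memory, from which `G` and with it `S` can be read off
  obtain ⟨s₁, t, he, ht, F₁, G, hG, h5, -, -⟩ := runs_elimProg m y (by omega : ys.length ≤ n)
  have h0 : inputMem m ys y 0 0 0 = n := by simp [inputMem]
  have hB : (n + 1) * (n + 1) ≤ (n + 1) ^ 3 := by
    rw [← pow_two]; exact Nat.pow_le_pow_right (by omega) (by norm_num)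
  set r := lastRow (fun q => G q q) G n with hr
  have hind : r = indicator (univ.filter fun j => r j = 1) := by
    funext j
    simp only [indicator, mem_filter, mem_univ, true_and]
    rcases zmod_two_cases (r j) with h | h
    · rw [h, if_neg zero_ne_one]
    · rw [h, if_pos rfl]
  refine ⟨univ.filter fun j => r j = 1, Runs.seq_weight ⟨s₁, t, he, ht, rfl⟩ fun s' hs' => ?_,
    fun S' hS' => ?_⟩
  · subst hs'
    refine (runs_selectProg (G := G) (d' := fun q => G q q) (k' := 0) (by decide)
      (by rw [F₁ 0 (by decide), h0]) h5 (fun _ _ => rfl) (fun s' hF q hq => ?_)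
      (fun j => ?_)).imp (Nat.mul_le_mul le_rfl hB) fun s₂ ⟨_, h₂, _⟩ j => ?_
    · simp [hF 5 (by decide), hq, h5]
    · rw [F₁ 3 (by decide)]
      simp [inputMem]
    · rw [h₂ j, ← hr]
      simp only [mem_filter, mem_univ, true_and]
      rcases zmod_two_cases (r j) with h | h
      · rw [h, if_neg zero_ne_one, ZMod.val_zero]
      · rw [h, if_pos rfl]; rfl
  · obtain ⟨p, hp, hrp⟩ : ∃ p, G p p = 1 ∧ r = G p := by
      rcases lastRow_spec (fun q => G q q) G with ⟨-, h⟩ | h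
      · obtain ⟨q, hq⟩ := hG.freeSet_nonempty hys hlen
        exact absurd ((h q).symm.trans hq) zero_ne_one
      · exact h
    have hinj : ∀ A B : Finset (Fin n), indicator A = indicator B → A = B := by
      intro A B hAB
      ext j
      have := congrFun hAB j
      by_cases h1 : j ∈ A <;> by_cases h2 : j ∈ B <;> simp [indicator, h1, h2] at this ⊢
    refine (hG.eq_indicator hys hlen hS' hp).imp (fun h => hinj _ _ ?_) fun h => hinj _ _ ?_
    · rw [← hind, hrp, h]
    · rw [← hind, hrp, h]

/-! ### Writing the circuit on the machine -/

/-- Writes the values of the expressions `es` to row `L` of array `4`, from column `k` on, where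
`L` is the number of gates written before. -/
def emitFrom : ℕ → List Expr → Prog
  | _, [] => .skip
  | k, e :: es => .seq (.write 4 (.read 3 (.lit 0) (.lit 1)) (.lit k) e) (emitFrom (k + 1) es)

theorem runs_emitFrom (es : List Expr) : ∀ (k : ℕ) (s : Mem) (c : List ℕ),
    (∀ s', Frame [4] s s' → es.map (Expr.eval s') = c) →
    Runs (emitFrom k es) s (emitFrom k es).weight fun s' => Frame [4] s s' ∧
      (∀ g x, g ≠ s 3 0 1 ∨ x < k → s' 4 g x = s 4 g x) ∧
      ∀ x < c.length, s' 4 (s 3 0 1) (k + x) = c.getD x 0 := by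
  induction es with
  | nil =>
    intro k s c h
    obtain rfl : [] = c := h s (Frame.refl _ _)
    exact ⟨s, 1, .skip s, le_rfl, Frame.refl _ _, fun _ _ _ => rfl,
      fun x hx => absurd hx (Nat.not_lt_zero x)⟩
  | cons e es ih =>
    intro k s c h
    obtain ⟨v, c, rfl⟩ : ∃ v c', c = v :: c' := ⟨_, _, (h s (Frame.refl _ _)).symm⟩
    refine Runs.seq (P := fun s' => s' = s.set 4 (s 3 0 1) k v) (runs_write ?_) fun s₁ hs₁ => ?_
    · have := h s (Frame.refl _ _)
      rw [List.map_cons, List.cons.injEq] at this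
      simp [this.1]
    have F₁ : Frame [4] s s₁ := hs₁ ▸ (Frame.refl _ _).set (by simp) _ _ _
    have hL : s₁ 3 = s 3 := F₁ 3 (by decide)
    refine (ih (k + 1) s₁ c fun s' hF => ?_).imp le_rfl fun s₂ ⟨F₂, ho, hc⟩ => ?_
    · have := h s' (F₁.trans hF fun _ h => h)
      rw [List.map_cons, List.cons.injEq] at this
      exact this.2
    rw [hL] at ho hc
    refine ⟨F₁.trans F₂ fun _ h => h, fun g x hgx => ?_, fun x hx => ?_⟩
    · rw [ho g x (hgx.imp (fun h => h) fun h => by omega), hs₁, Mem.set,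
        if_neg (by rintro ⟨-, h1, h2⟩; exact hgx.elim (fun h => h h1) fun h => by omega)]
    · cases x with
      | zero =>
        rw [Nat.add_zero, ho _ _ (Or.inr (Nat.lt_succ_self k)), hs₁, Mem.set, if_pos ⟨rfl, rfl, rfl⟩]
        rfl
      | succ x =>
        rw [show k + (x + 1) = k + 1 + x by ring,
          hc x (Nat.lt_of_succ_lt_succ (by simpa using hx))]
        rfl

/-- The memory lists `a` as the number of ancillas and `L` as the codes of the gates. -/
def ListsGates (a : ℕ) (L : List (List ℕ)) (s : Mem) : Prop :=
  s 3 0 0 = a ∧ s 3 0 1 = L.length ∧ ∀ g, ∀ h : g < L.length, ∀ k, k < L[g].length →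
    s 4 g k = L[g].getD k 0

/-- Writes a gate behind the list of gates, and counts it if the flag is set. A gate that is not
counted is overwritten by the next one. -/
def emit (es : List Expr) (flag : Expr) : Prog :=
  .seq (emitFrom 0 es) (.write 3 (.lit 0) (.lit 1) (.add (.read 3 (.lit 0) (.lit 1)) flag))

theorem runs_emit {es : List Expr} {flag : Expr} {s : Mem} {a : ℕ} {L : List (List ℕ)}
    {c : List ℕ} {p : Prop} [Decidable p] (hL : ListsGates a L s)
    (hes : ∀ s', Frame [4] s s' → es.map (Expr.eval s') = c)
    (hfl : ∀ s', Frame [4] s s' → flag.eval s' = if p then 1 else 0) :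
    Runs (emit es flag) s (emit es flag).weight fun s' => Frame [3, 4] s s' ∧
      ListsGates a (L ++ if p then [c] else []) s' := by
  refine Runs.seq (runs_emitFrom es 0 s c hes) fun s₁ ⟨F₁, ho, hc⟩ => runs_write ?_
  have h3 : s₁ 3 = s 3 := F₁ 3 (by decide)
  simp only [eval_lit, eval_add, eval_read, hfl s₁ F₁, h3, hL.2.1]
  refine ⟨(F₁.mono (by simp)).set (by simp) _ _ _, ?_, ?_, fun g hg k hk => ?_⟩
  · simp [Mem.set, h3, hL.1]
  · simp only [Mem.set, and_self, if_true, List.length_append]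
    split_ifs <;> rfl
  · rw [Mem.set_of_ne (by decide)]
    by_cases hg' : g < L.length
    · rw [List.getElem_append_left hg'] at hk ⊢
      rw [ho g k (Or.inl (by rw [hL.2.1]; omega)), hL.2.2 g hg' k hk]
    · have hp : p := by
        by_contra hp
        rw [if_neg hp, List.append_nil] at hg
        exact hg' hg
      simp only [if_pos hp, List.length_append, List.length_singleton] at hg
      obtain rfl : g = L.length := by omega
      simp only [if_pos hp, List.getElem_concat_length] at hk ⊢
      rw [← hL.2.1, ← hc k hk, Nat.zero_add]

theorem runs_emitLoop {b b' flag : Expr} {es : List Expr} {s : Mem} {A : Mem → Prop} {a : ℕ}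
    {L : List (List ℕ)} (hA : ∀ s s', Frame [3, 4, 20, 21] s s' → A s → A s') (N M : ℕ)
    (code : ℕ → ℕ → List ℕ) (p : ℕ → ℕ → Prop) [∀ i j, Decidable (p i j)] (hs : A s)
    (hL : ListsGates a L s) (hb : ∀ s', A s' → b.eval s' = N) (hb' : ∀ s', A s' → b'.eval s' = M)
    (hes : ∀ i < N, ∀ j < M, ∀ s', A s' → s' 20 0 0 = i → s' 21 0 0 = j →
      es.map (Expr.eval s') = code i j)
    (hfl : ∀ i < N, ∀ j < M, ∀ s', A s' → s' 20 0 0 = i → s' 21 0 0 = j →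
      flag.eval s' = if p i j then 1 else 0) :
    Runs (.forLoop₂ b b' (emit es flag)) s
      ((Prog.forLoop₂ b b' (emit es flag)).weight * ((N + 1) * (M + 1))) fun s' => A s' ∧
        ListsGates a (L ++ (List.range N).flatMap fun i => (List.range M).flatMap fun j =>
          if p i j then [code i j] else []) s' := by
  refine (runs_forLoop₂ (fun i j s' => A s' ∧ ListsGates a (L ++ ((List.range i).flatMap fun i =>
    (List.range M).flatMap fun j => if p i j then [code i j] else []) ++
      (List.range j).flatMap fun j => if p i j then [code i j] else []) s') N M
    ?_ ⟨hs, by simpa using hL⟩ (fun i s' h => ⟨h.1, ?_⟩) (fun _ _ s' h => hb s' h.1)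
    (fun _ _ s' h => hb' s' h.1) ?_).imp le_rfl fun s' h => ⟨h.1, by simpa using h.2⟩
  · intro i j s' v x hv h
    have hv3 : 3 ≠ v := by rcases hv with rfl | rfl <;> decide
    have hv4 : 4 ≠ v := by rcases hv with rfl | rfl <;> decide
    refine ⟨hA _ _ ((Frame.refl _ _).set (by rcases hv with rfl | rfl <;> simp) _ _ _) h.1, ?_⟩
    rw [ListsGates, Mem.set_of_ne hv3, Mem.set_of_ne hv4]
    exact h.2
  · rw [List.range_succ, List.flatMap_append, List.flatMap_singleton, List.range_zero,
      List.flatMap_nil, List.append_nil, ← List.append_assoc]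
    exact h.2
  · intro i hi j hj s' h hvi hvj
    have hfr : ∀ s'', Frame [4] s' s'' → A s'' ∧ s'' 20 0 0 = i ∧ s'' 21 0 0 = j := fun s'' hF =>
      ⟨hA _ _ (hF.mono (by simp)) h.1, by rw [hF 20 (by decide), hvi],
        by rw [hF 21 (by decide), hvj]⟩
    refine (runs_emit (p := p i j) h.2
      (fun s'' hF => hes i hi j hj s'' (hfr s'' hF).1 (hfr s'' hF).2.1 (hfr s'' hF).2.2)
      (fun s'' hF => hfl i hi j hj s'' (hfr s'' hF).1 (hfr s'' hF).2.1 (hfr s'' hF).2.2)).imp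
      le_rfl fun s'' h' => ⟨by rw [h'.1 20 (by decide), hvi], by rw [h'.1 21 (by decide), hvj],
        hA _ _ (h'.1.mono (by simp)) h.1, ?_⟩
    rw [List.range_succ, List.flatMap_append, List.flatMap_singleton, ← List.append_assoc]
    exact h'.2

theorem fanParent_zero : fanParent 0 = 0 := rfl

theorem fanParent_one : fanParent 1 = 0 := by simp [fanParent]

theorem fanParent_two_mul_add {i j : ℕ} (hi : i ≠ 0) (hj : j < 2) :
    fanParent (2 * i + j) = 2 * fanParent i + j := by
  have h : Nat.log 2 (2 * i + j) = Nat.log 2 i + 1 := by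
    rw [Nat.log_of_one_lt_of_le (by norm_num) (by omega), show (2 * i + j) / 2 = i by omega]
  have h' : 2 ^ Nat.log 2 i ≤ i := Nat.pow_log_le_self 2 hi
  rw [fanParent, fanParent, h, pow_succ]
  omega

/-- The number of pairs of copies, as an expression. -/
abbrev Expr.pairCount : Expr := .read 0 (.lit 0) (.lit 1)

/-- The row of the ancillas, as an expression. -/
abbrev Expr.ancRow : Expr := .add (.add .pairCount .pairCount) (.lit 1)

/-- The memory when gates are being written: array `5` holds the generating set, and arrays `7`,
`8` and `11` hold tables of `n * i`, of `n * fanParent i`, and of the rows of the wires from which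
the `i`-th copy of the group register is made. -/
structure Tables (n m : ℕ) (g : ℕ → ℕ → ℕ) (s : Mem) : Prop where
  size : s 0 0 0 = n
  pairCount : s 0 0 1 = m
  gen : s 5 = g
  mul : ∀ i ≤ m, s 7 0 i = n * i
  parent : ∀ i < m, s 8 0 i = n * fanParent i
  row : ∀ i < m, s 11 0 i = if i = 0 then 0 else 2 * m + 1

theorem Tables.frame {n m : ℕ} {g : ℕ → ℕ → ℕ} (s s' : Mem) (hF : Frame [3, 4, 20, 21] s s')
    (h : Tables n m g s) : Tables n m g s' := by
  obtain ⟨h1, h2, h3, h4, h5, h6⟩ := h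
  refine ⟨?_, ?_, ?_, ?_, ?_, ?_⟩
  · rwa [hF 0 (by decide)]
  · rwa [hF 0 (by decide)]
  · rwa [hF 5 (by decide)]
  · rwa [hF 7 (by decide)]
  · rwa [hF 8 (by decide)]
  · rwa [hF 11 (by decide)]

/-- Fills the tables. -/
def tableProg : Prog :=
  .seq (.forLoop₂ .pairCount (.lit 1) (.write 7 (.lit 0) (.add (.var 20) (.lit 1))
    (.add (.read 7 (.lit 0) (.var 20)) .size)))
  (.seq (.forLoop₂ .pairCount (.lit 2) (.write 8 (.lit 0)
    (.add (.add (.add (.var 20) (.lit 1)) (.add (.var 20) (.lit 1))) (.var 21))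
    (.add (.add (.read 8 (.lit 0) (.add (.var 20) (.lit 1)))
      (.read 8 (.lit 0) (.add (.var 20) (.lit 1)))) (.read 7 (.lit 0) (.var 21)))))
  (.seq (.forLoop₂ .pairCount (.lit 1) (.write 11 (.lit 0) (.add (.var 20) (.lit 1)) .ancRow))
  (.write 3 (.lit 0) (.lit 0) (.read 7 (.lit 0) .pairCount))))

theorem runs_tableProg {n m : ℕ} {s : Mem} (hm : 0 < m) (h0 : s 0 0 0 = n) (h1 : s 0 0 1 = m)
    (h3 : s 3 0 1 = 0) (h7 : s 7 0 0 = 0) (h8 : ∀ j, s 8 0 j = 0) (h11 : s 11 0 0 = 0) :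
    Runs tableProg s (tableProg.weight * (3 * (n + 1) ^ 3 * (m + 1))) fun s' =>
      Tables n m (s 5) s' ∧ ListsGates (m * n) [] s' := by
  have hB : 3 * (m + 1) ≤ 3 * (n + 1) ^ 3 * (m + 1) := by
    refine Nat.mul_le_mul_right _ (Nat.le_mul_of_pos_right _ (Nat.pow_pos (Nat.succ_pos n)))
  refine Runs.seq_weight ((runs_fill (by decide) m 1 (fun i j f => ∀ x ≤ i + j, f 0 x = n * x)
    (fun s' hF => by simp [hF 0 (by decide), h1]) (fun s' hF => rfl) ?_ (fun i f h => h)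
    ?_).imp (Nat.mul_le_mul le_rfl (by omega)) fun _ h => h) fun s₁ ⟨F₁, t₁⟩ => ?_
  · intro x hx
    obtain rfl : x = 0 := by omega
    simpa using h7
  · intro i hi j hj s' hF hi' hj' h x hx
    obtain rfl : j = 0 := by omega
    simp only [eval_lit, eval_add, eval_var, eval_read, hi', true_and, hF 0 (by decide), h0,
      h i le_rfl]
    split_ifs with hxi
    · rw [hxi]; ring
    · exact h x (by omega)
  have e0 : s₁ 0 = s 0 := F₁ 0 (by decide)
  refine Runs.seq_weight ((runs_fill (by decide) m 2
    (fun i j f => ∀ x < 2 * (i + 1) + j, f 0 x = n * fanParent x)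
    (fun s' hF => by simp [hF 0 (by decide), e0, h1]) (fun s' hF => rfl) ?_ (fun i f h => h)
    ?_).imp (Nat.mul_le_mul le_rfl (by omega)) fun _ h => h) fun s₂ ⟨F₂, t₂⟩ => ?_
  · intro x hx
    rw [F₁ 8 (by decide), h8]
    interval_cases x
    · rw [fanParent_zero, mul_zero]
    · rw [fanParent_one, mul_zero]
  · intro i hi j hj s' hF hi' hj' h x hx
    simp only [eval_lit, eval_add, eval_var, eval_read, hi', hj', true_and, hF 7 (by decide),
      h (i + 1) (by omega), t₁ j (by omega)]
    split_ifs with hxi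
    · rw [hxi, show i + 1 + (i + 1) + j = 2 * (i + 1) + j by ring,
        fanParent_two_mul_add (Nat.succ_ne_zero i) hj]
      ring
    · exact h x (by omega)
  have e0' : s₂ 0 = s 0 := by rw [F₂ 0 (by decide), e0]
  refine Runs.seq_weight ((runs_fill (by decide) m 1
    (fun i j f => f 0 0 = 0 ∧ ∀ x, x ≠ 0 → x ≤ i + j → f 0 x = 2 * m + 1)
    (fun s' hF => by simp [hF 0 (by decide), e0', h1]) (fun s' hF => rfl) ?_ (fun i f h => h)
    ?_).imp (Nat.mul_le_mul le_rfl (by omega)) fun _ h => h) fun s₃ ⟨F₃, t₃⟩ => ?_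
  · rw [F₂ 11 (by decide), F₁ 11 (by decide)]
    exact ⟨h11, fun x hx hx' => by omega⟩
  · intro i hi j hj s' hF hi' hj' h
    simp only [eval_lit, eval_add, eval_var, eval_read, hi', true_and, hF 0 (by decide), e0', h1]
    refine ⟨by rw [if_neg (by omega)]; exact h.1, fun x hx hx' => ?_⟩
    split_ifs with hxi
    · ring
    · exact h.2 x hx (by omega)
  refine (runs_write (Q := fun s' => Tables n m (s 5) s' ∧ ListsGates (m * n) [] s') ?_).imp
    (Nat.le_mul_of_pos_right _ (by positivity)) fun _ h => h
  have e0'' : s₃ 0 = s 0 := by rw [F₃ 0 (by decide), e0']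
  have e7 : s₃ 7 = s₁ 7 := by rw [F₃ 7 (by decide), F₂ 7 (by decide)]
  refine ⟨⟨?_, ?_, ?_, fun i hi => ?_, fun i hi => ?_, fun i hi => ?_⟩, ?_, ?_,
    fun g hg => absurd hg (Nat.not_lt_zero g)⟩
  · rw [Mem.set_of_ne (by decide), e0'', h0]
  · rw [Mem.set_of_ne (by decide), e0'', h1]
  · rw [Mem.set_of_ne (by decide), F₃ 5 (by decide), F₂ 5 (by decide), F₁ 5 (by decide)]
  · rw [Mem.set_of_ne (by decide), e7, t₁ i hi]
  · rw [Mem.set_of_ne (by decide), F₃ 8 (by decide), t₂ i (by omega)]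
  · rw [Mem.set_of_ne (by decide)]
    split_ifs with h
    · rw [h, t₃.1]
    · exact t₃.2 i h hi.le
  · simp [Mem.set, e0'', h1, e7, t₁ m le_rfl, mul_comm]
  · simp [Mem.set, F₃ 3 (by decide), F₂ 3 (by decide), F₁ 3 (by decide), h3]

/-- Writes the gates of the sampling circuit. -/
def gatesProg : Prog :=
  .seq (.forLoop₂ .size (.lit 1) (emit [.lit 1, .lit 0, .var 20] (.read 5 (.var 20) (.var 20))))
  (.seq (.forLoop₂ .size .size (emit [.lit 2, .lit 0, .var 20, .lit 0, .var 21]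
    (.and (.and (.read 5 (.var 20) (.var 20)) (.read 5 (.var 20) (.var 21)))
      (.sub (.lit 1) (.sub (.lit 1) (.xor (.var 20) (.var 21)))))))
  (.seq (.forLoop₂ .pairCount .size (emit [.lit 2, .read 11 (.lit 0) (.var 20),
    .add (.read 8 (.lit 0) (.var 20)) (.var 21), .ancRow,
    .add (.read 7 (.lit 0) (.var 20)) (.var 21)] (.lit 1)))
  (.seq (.forLoop₂ .pairCount .size (emit [.lit 3, .ancRow,
    .add (.read 7 (.lit 0) (.var 20)) (.var 21), .add (.lit 1) (.add (.var 20) (.var 20)), .var 21,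
    .add (.lit 2) (.add (.var 20) (.var 20)), .var 21] (.lit 1)))
  (.seq (.forLoop₂ .pairCount .size (emit [.lit 2,
    .read 11 (.lit 0) (.sub (.sub .pairCount (.lit 1)) (.var 20)),
    .add (.read 8 (.lit 0) (.sub (.sub .pairCount (.lit 1)) (.var 20)))
      (.sub (.sub .size (.lit 1)) (.var 21)), .ancRow,
    .add (.read 7 (.lit 0) (.sub (.sub .pairCount (.lit 1)) (.var 20)))
      (.sub (.sub .size (.lit 1)) (.var 21))] (.lit 1)))
  (.forLoop₂ .size (.lit 1) (emit [.lit 1, .lit 0, .var 20] (.lit 1)))))))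

theorem runs_gatesProg {n m : ℕ} {g : ℕ → ℕ → ℕ} {s : Mem} {a : ℕ}
    (hg : ∀ q < n, ∀ j < n, g q j < 2) (hs : Tables n m g s) (hL : ListsGates a [] s) :
    Runs gatesProg s (gatesProg.weight * (3 * (n + 1) ^ 3 * (m + 1)))
      (ListsGates a (circuitCodes n m g)) := by
  have hsz : ∀ s', Tables n m g s' → Expr.size.eval s' = n := fun s' h => h.size
  have hpc : ∀ s', Tables n m g s' → Expr.pairCount.eval s' = m := fun s' h => h.pairCount
  have hn2 : (n + 1) * (n + 1) ≤ (n + 1) ^ 3 := by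
    rw [← pow_two]; exact Nat.pow_le_pow_right (Nat.succ_pos n) (by norm_num)
  have hn1 : n + 1 ≤ (n + 1) ^ 3 := Nat.le_self_pow (by norm_num) _
  have hB1 : (n + 1) * (1 + 1) ≤ 3 * (n + 1) ^ 3 * (m + 1) := by nlinarith
  have hB2 : (n + 1) * (n + 1) ≤ 3 * (n + 1) ^ 3 * (m + 1) := by nlinarith
  have hB3 : (m + 1) * (n + 1) ≤ 3 * (n + 1) ^ 3 * (m + 1) := by nlinarith
  refine Runs.seq_weight ((runs_emitLoop Tables.frame n 1 (fun q _ => [1, 0, q])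
    (fun q _ => g q q = 1) hs hL hsz (fun s' h => rfl) ?_ ?_).imp
    (Nat.mul_le_mul le_rfl hB1) fun _ h => h) fun s₁ ⟨hs₁, hL₁⟩ => ?_
  · intro i hi j hj s' h hi' hj'
    simp [hi']
  · intro i hi j hj s' h hi' hj'
    simp only [eval_read, eval_var, hi', h.gen]
    have := hg i hi i hi
    split_ifs <;> omega
  refine Runs.seq_weight ((runs_emitLoop Tables.frame n n (fun q j => [2, 0, q, 0, j])
    (fun q j => g q q = 1 ∧ g q j = 1 ∧ q ≠ j) hs₁ hL₁ hsz hsz ?_ ?_).imp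
    (Nat.mul_le_mul le_rfl hB2) fun _ h => h) fun s₂ ⟨hs₂, hL₂⟩ => ?_
  · intro i hi j hj s' h hi' hj'
    simp [hi', hj']
  · intro i hi j hj s' h hi' hj'
    simp only [eval_read, eval_var, eval_and, eval_sub, eval_xor, eval_lit, hi', hj', h.gen]
    have := hg i hi i hi
    have := hg i hi j hj
    split_ifs <;> omega
  refine Runs.seq_weight ((runs_emitLoop Tables.frame m n (fanCode n m) (fun _ _ => True) hs₂ hL₂
    hpc hsz ?_ fun _ _ _ _ _ _ _ _ => rfl).imp
    (Nat.mul_le_mul le_rfl hB3) fun _ h => h) fun s₃ ⟨hs₃, hL₃⟩ => ?_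
  · intro i hi j hj s' h hi' hj'
    simp [hi', hj', h.pairCount, h.row i hi, h.parent i hi, h.mul i hi.le, fanCode, two_mul]
  refine Runs.seq_weight ((runs_emitLoop Tables.frame m n
    (fun i j => [3, 2 * m + 1, n * i + j, 1 + 2 * i, j, 2 + 2 * i, j]) (fun _ _ => True) hs₃ hL₃
    hpc hsz ?_ fun _ _ _ _ _ _ _ _ => rfl).imp
    (Nat.mul_le_mul le_rfl hB3) fun _ h => h) fun s₄ ⟨hs₄, hL₄⟩ => ?_
  · intro i hi j hj s' h hi' hj'
    simp [hi', hj', h.pairCount, h.mul i hi.le, two_mul]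
  refine Runs.seq_weight ((runs_emitLoop Tables.frame m n
    (fun i j => fanCode n m (m - 1 - i) (n - 1 - j)) (fun _ _ => True) hs₄ hL₄
    hpc hsz ?_ fun _ _ _ _ _ _ _ _ => rfl).imp
    (Nat.mul_le_mul le_rfl hB3) fun _ h => h) fun s₅ ⟨hs₅, hL₅⟩ => ?_
  · intro i hi j hj s' h hi' hj'
    have hi'' : m - 1 - i < m := by omega
    simp [hi', hj', h.pairCount, h.size, h.row _ hi'', h.parent _ hi'', h.mul _ hi''.le, fanCode,
      two_mul]
  refine (runs_emitLoop Tables.frame n 1 (fun q _ => [1, 0, q]) (fun _ _ => True) hs₅ hL₅ hsz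
    (fun s' h => rfl) ?_ fun _ _ _ _ _ _ _ _ => rfl).imp
    (Nat.mul_le_mul le_rfl hB1) fun s₆ ⟨_, hL₆⟩ => ?_
  · intro i hi j hj s' h hi' hj'
    simp [hi']
  · simpa only [List.nil_append, List.range_one, List.flatMap_singleton, if_true, circuitCodes]
      using hL₆

/-- Computes the circuit of the next round. -/
def prepareProg : Prog := .seq elimProg (.seq tableProg gatesProg)

theorem runs_prepareProg {n m : ℕ} {ys : List (Bits (Fin n))} (y : Bits (Fin n)) (hm : 0 < m)
    (hlen : ys.length ≤ n) : ∃ G, IsReduced G ys ∧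
      Runs prepareProg (inputMem m ys y) (prepareProg.weight * (3 * (n + 1) ^ 3 * (m + 1)))
        (WritesCircuit (samplingCircuit m G)) := by
  -- `elimProg` halts in some memory, from which `G` can be read off
  obtain ⟨s₁, t, he, ht, F₁, G, hG, h5, -, -⟩ := runs_elimProg m y hlen
  refine ⟨G, hG, Runs.seq_weight ⟨s₁, t, he, ht.trans (Nat.mul_le_mul le_rfl ?_), rfl⟩
    fun s' hs' => ?_⟩
  · nlinarith [Nat.zero_le ((n + 1) ^ 3)]
  subst hs'
  refine Runs.seq_weight (runs_tableProg hm (n := n) ?_ ?_ ?_ ?_ (fun j => ?_) ?_)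
    fun s₂ ⟨hs₂, hL₂⟩ => (runs_gatesProg (fun q hq j hj => ?_) hs₂ hL₂).imp le_rfl
      fun s₃ h₃ => ?_
  · rw [F₁ 0 (by decide)]; simp [inputMem]
  · rw [F₁ 0 (by decide)]; simp [inputMem]
  · rw [F₁ 3 (by decide)]; simp [inputMem]
  · rw [F₁ 7 (by decide)]; simp [inputMem]
  · rw [F₁ 8 (by decide)]; simp [inputMem]
  · rw [F₁ 11 (by decide)]; simp [inputMem]
  · rw [h5 ⟨q, hq⟩ ⟨j, hj⟩]
    exact ZMod.val_lt _
  · rw [writesCircuit_iff_map, map_gateCode_samplingCircuit m h5]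
    exact h₃

/-! ### The constants -/

theorem pairs_pos {ε : ℝ} (h0 : 0 < ε) : 0 < pairs ε :=
  Nat.ceil_pos.2 (by positivity)

theorem pairs_le {ε : ℝ} (h0 : 0 < ε) (h1 : ε ≤ 1) : (pairs ε : ℝ) ≤ 2 / ε ^ 2 := by
  have h : 1 ≤ 1 / ε ^ 2 := by
    rw [le_div_iff₀ (by positivity), one_mul]
    exact pow_le_one₀ h0.le h1
  have h' : (pairs ε : ℝ) < 1 / ε ^ 2 + 1 := Nat.ceil_lt_add_one (by positivity)
  rw [show 2 / ε ^ 2 = 1 / ε ^ 2 + 1 / ε ^ 2 by ring]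
  linarith

theorem cube_time_le {n w K : ℕ} (hn : 0 < n) (hw : 8 * w ≤ K) (hK : 3 ≤ K) :
    ((w * (n + 1) ^ 3 : ℕ) : ℝ) ≤ K * (n : ℝ) ^ K := by
  have h1 : (n + 1) ^ 3 ≤ (2 * n) ^ 3 := Nat.pow_le_pow_left (by omega) 3
  have h2 : n ^ 3 ≤ n ^ K := Nat.pow_le_pow_right hn hK
  have : w * (n + 1) ^ 3 ≤ K * n ^ K :=
    calc w * (n + 1) ^ 3 ≤ w * (2 * n) ^ 3 := Nat.mul_le_mul le_rfl h1
      _ = 8 * w * n ^ 3 := by ring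
      _ ≤ K * n ^ K := Nat.mul_le_mul hw h2
  exact_mod_cast this

theorem prepare_time_le {n w K : ℕ} {ε : ℝ} (hn : 0 < n) (h0 : 0 < ε) (h1 : ε ≤ 1)
    (hw : 72 * w ≤ K) (hK : 3 ≤ K) :
    ((w * (3 * (n + 1) ^ 3 * (pairs ε + 1)) : ℕ) : ℝ) ≤ K * (n / ε) ^ K := by
  have hn1 : (1 : ℝ) ≤ n := by exact_mod_cast hn
  have hm : (pairs ε : ℝ) + 1 ≤ 3 / ε ^ 3 := by
    have h2 : 1 ≤ 1 / ε ^ 2 := by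
      rw [le_div_iff₀ (by positivity), one_mul]
      exact pow_le_one₀ h0.le h1
    have h3 : 3 / ε ^ 2 ≤ 3 / ε ^ 3 :=
      div_le_div_of_nonneg_left (by norm_num) (by positivity)
        (pow_le_pow_of_le_one h0.le h1 (by norm_num))
    have h4 : 3 / ε ^ 2 = 2 / ε ^ 2 + 1 / ε ^ 2 := by ring
    linarith [pairs_le h0 h1]
  have hd : 1 ≤ (n : ℝ) / ε := by
    rw [le_div_iff₀ h0]; linarith
  have hc : ((n : ℝ) + 1) ^ 3 ≤ (2 * n) ^ 3 := pow_le_pow_left₀ (by positivity) (by linarith) 3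
  have hw' : (72 * w : ℝ) ≤ K := by exact_mod_cast hw
  push_cast
  calc (w : ℝ) * (3 * ((n : ℝ) + 1) ^ 3 * (pairs ε + 1))
      ≤ w * (3 * (2 * n) ^ 3 * (3 / ε ^ 3)) := by gcongr
    _ = 72 * w * ((n : ℝ) / ε) ^ 3 := by rw [div_pow]; ring
    _ ≤ K * (n / ε) ^ K := by gcongr

theorem depth_le {n K : ℕ} {ε : ℝ} (hn : 0 < n) (h0 : 0 < ε) (h1 : ε ≤ 1) (hK : 10 ≤ K)
    (G : Fin n → Bits (Fin n)) :
    ((samplingCircuit (pairs ε) G).depth : ℝ) ≤ K * (n : ℝ) ^ 2 + K * Real.log ε⁻¹ := by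
  have hn1 : (1 : ℝ) ≤ n := by exact_mod_cast hn
  have hK' : (10 : ℝ) ≤ K := by exact_mod_cast hK
  have hlog : 0 ≤ Real.log ε⁻¹ := Real.log_nonneg ((one_le_inv₀ h0).2 h1)
  have h2 : ((samplingCircuit (pairs ε) G).depth : ℝ) ≤
      n * n + 2 * n + 2 * Nat.clog 2 (pairs ε) + 3 := by
    exact_mod_cast depth_samplingCircuit_le (pairs ε) G
  have h3 := clog_pairs_le h0 h1
  have h4 : 10 * (n : ℝ) ^ 2 ≤ K * (n : ℝ) ^ 2 := by gcongr
  have h5 : 10 * Real.log ε⁻¹ ≤ K * Real.log ε⁻¹ := by gcongr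
  nlinarith

/-- With `16 n` rounds, the failure probability is at most one third. -/
theorem failure_le {n : ℕ} (hn : 0 < n) :
    (2 : ℝ) ^ (n - 2) * (7 / 8 : ℝ) ^ (16 * n) ≤ 1 / 3 :=
  calc (2 : ℝ) ^ (n - 2) * (7 / 8 : ℝ) ^ (16 * n) ≤ 2 ^ n * (7 / 8 : ℝ) ^ (16 * n) := by
        gcongr
        · norm_num
        · omega
    _ = (2 * (7 / 8) ^ 16) ^ n := by rw [mul_pow, pow_mul]
    _ ≤ 2 * (7 / 8) ^ 16 := pow_le_of_le_one (by positivity) (by norm_num) hn.ne'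
    _ ≤ 1 / 3 := by norm_num

end HiddenCut

theorem theorem1 :
    ∃ (r K : ℕ) (prepare test answer : HiddenCut.Prog),
      ∀ (n : ℕ) (ε : ℝ), 0 < n → Even n → 0 < ε → ε ≤ 1 →
        -- copies acted on coherently, and copies consumed in at most `r * n` rounds
        ((2 * HiddenCut.pairs ε : ℕ) : ℝ) ≤ K / ε ^ 2 ∧
        ((r * n * (2 * HiddenCut.pairs ε) : ℕ) : ℝ) ≤ K * n / ε ^ 2 ∧
        -- the circuits: implementation, width, depth, and polynomial-time generation
        (∀ ys : List (HiddenCut.Bits (Fin n)), HiddenCut.Indep ys → ys.length + 2 < n →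
          ∃ (a : ℕ) (c : HiddenCut.Circuit (HiddenCut.Wire n (HiddenCut.pairs ε) a)),
            HiddenCut.PreparesFourierState c (HiddenCut.orth ys) ∧
            (a : ℝ) ≤ K * n / ε ^ 2 ∧
            (HiddenCut.Circuit.depth c : ℝ) ≤ K * (n : ℝ) ^ 2 + K * Real.log ε⁻¹ ∧
            HiddenCut.HaltsWithin prepare (HiddenCut.inputMem (HiddenCut.pairs ε) ys 0)
              (K * (n / ε) ^ K) (HiddenCut.WritesCircuit c)) ∧
        -- the decision whether a new sample is kept, in polynomial time
        (∀ (ys : List (HiddenCut.Bits (Fin n))) (y : HiddenCut.Bits (Fin n)),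
          HiddenCut.Indep ys → ys.length + 2 < n →
            HiddenCut.HaltsWithin test (HiddenCut.inputMem 0 ys y) (K * (n : ℝ) ^ K)
              (fun s => s 3 0 0 = 0 ↔ y ∈ HiddenCut.spanOf ys)) ∧
        -- the final post-processing, in polynomial time, which reads the cut off the nullspace
        (∀ ys : List (HiddenCut.Bits (Fin n)), HiddenCut.Indep ys → ys.length + 2 = n →
          ∃ S : Finset (Fin n),
            HiddenCut.HaltsWithin answer (HiddenCut.inputMem 0 ys 0) (K * (n : ℝ) ^ K)
              (HiddenCut.WritesSet S) ∧
            ∀ S' : Finset (Fin n), HiddenCut.NullspaceIsCut ys S' → S = S' ∨ S = S'ᶜ) ∧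
        -- success: the output is the hidden cut
        (∀ (C : Finset (Fin n)) (φ₁ : HiddenCut.Amp {i // i ∈ C})
            (φ₂ : HiddenCut.Amp {i // i ∈ Cᶜ}),
          2 * C.card = n → HiddenCut.IsState φ₁ → HiddenCut.IsState φ₂ →
          HiddenCut.FarFromSeparable ε φ₁ → HiddenCut.FarFromSeparable ε φ₂ →
            2 / 3 ≤ HiddenCut.loopProb (HiddenCut.pairs ε) (HiddenCut.productState C φ₁ φ₂)
              (fun ys => ys.length + 2 = n ∧ ∃ S : Finset (Fin n), (S = C ∨ S = Cᶜ) ∧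
                HiddenCut.HaltsWithin answer (HiddenCut.inputMem 0 ys 0) (K * (n : ℝ) ^ K)
                  (HiddenCut.WritesSet S))
              (r * n) []) := by
  refine ⟨16, 72 * (HiddenCut.prepareProg.weight + HiddenCut.testProg.weight +
    HiddenCut.answerProg.weight) + 64, HiddenCut.prepareProg, HiddenCut.testProg,
    HiddenCut.answerProg, ?_⟩
  generalize hK : 72 * (HiddenCut.prepareProg.weight + HiddenCut.testProg.weight +
    HiddenCut.answerProg.weight) + 64 = K
  intro n ε hn _ h0 h1
  have hK64 : (64 : ℝ) ≤ K := by
    have : 64 ≤ K := by omega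
    exact_mod_cast this
  have hm := HiddenCut.pairs_le h0 h1
  have hanswer : ∀ ys : List (HiddenCut.Bits (Fin n)), HiddenCut.Indep ys → ys.length + 2 = n →
      ∃ S : Finset (Fin n),
        HiddenCut.HaltsWithin HiddenCut.answerProg (HiddenCut.inputMem 0 ys 0) (K * (n : ℝ) ^ K)
          (HiddenCut.WritesSet S) ∧
        ∀ S' : Finset (Fin n), HiddenCut.NullspaceIsCut ys S' → S = S' ∨ S = S'ᶜ := by
    intro ys hys hlen
    obtain ⟨S, hS, hS'⟩ := HiddenCut.runs_answerProg 0 0 hys hlen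
    exact ⟨S, hS.haltsWithin (HiddenCut.cube_time_le hn (by omega) (by omega)), hS'⟩
  refine ⟨?_, ?_, fun ys hys hlen => ?_, fun ys y _ hlen => ?_, hanswer, ?_⟩
  · push_cast
    calc 2 * (HiddenCut.pairs ε : ℝ) ≤ 2 * (2 / ε ^ 2) := by gcongr
      _ = 4 / ε ^ 2 := by ring
      _ ≤ K / ε ^ 2 := by gcongr; linarith
  · push_cast
    calc 16 * (n : ℝ) * (2 * HiddenCut.pairs ε) ≤ 16 * n * (2 * (2 / ε ^ 2)) := by gcongr
      _ = 64 * n / ε ^ 2 := by ring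
      _ ≤ K * n / ε ^ 2 := by gcongr
  · obtain ⟨G, hG, hrun⟩ := HiddenCut.runs_prepareProg (ys := ys) 0 (HiddenCut.pairs_pos h0)
      (by omega)
    refine ⟨_, _, HiddenCut.preparesFourierState_samplingCircuit _ hG, ?_,
      HiddenCut.depth_le hn h0 h1 (by omega) G,
      hrun.haltsWithin (HiddenCut.prepare_time_le hn h0 h1 (by omega) (by omega))⟩
    push_cast
    calc (HiddenCut.pairs ε : ℝ) * n ≤ 2 / ε ^ 2 * n := by gcongr
      _ = 2 * n / ε ^ 2 := by ring
      _ ≤ K * n / ε ^ 2 := by gcongr; linarith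
  · refine (HiddenCut.runs_testProg 0 y (by omega)).haltsWithin ?_
    rw [← mul_assoc]
    exact HiddenCut.cube_time_le hn (by omega) (by omega)
  · intro C φ₁ φ₂ hC hφ₁ hφ₂ hf₁ hf₂
    have hnil : ∀ z : HiddenCut.Bits (Fin n), z ∈ HiddenCut.orth [] := fun z => by
      simp [HiddenCut.mem_orth]
    have h := HiddenCut.one_sub_le_loopProb h0 h1 hφ₁ hφ₂ hf₁ hf₂
      (E := fun ys => ys.length + 2 = n ∧ ∃ S : Finset (Fin n), (S = C ∨ S = Cᶜ) ∧
        HiddenCut.HaltsWithin HiddenCut.answerProg (HiddenCut.inputMem 0 ys 0) (K * (n : ℝ) ^ K)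
          (HiddenCut.WritesSet S))
      (fun ys hys hCy hCy' hlen => by
        obtain ⟨S, hS, hS'⟩ := hanswer ys hys hlen
        exact ⟨hlen, S, hS' C (HiddenCut.nullspaceIsCut_of_mem hn hC hys hCy hCy' hlen), hS⟩)
      (16 * n) [] HiddenCut.indep_nil (hnil _) (hnil _) (by
        rw [List.length_nil]; omega)
    rw [List.length_nil, Nat.sub_zero] at h
    linarith [HiddenCut.failure_le hn]
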